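/- **Setting.** Let $\mathbb F_q$ be a finite field, $n\ge 0$, $G=\mathrm{GL}_n(\mathbb F_q)$, $U\subseteq G$ the subgroup of unipotent upper triangular matrices, $\psi:\mathbb F_q\to\mathbb C^*$ a nontrivial additive character, and $\mu=(\mu_1,\dots,\mu_\ell)$ a composition of $n$ (all $\mu_i>0$). Put $\mathcal B_\mu=\{\mu_1,\mu_1+\mu_2,\dots,\mu_1+\cdots+\mu_\ell\}$, let $\psi_\mu:U\to\mathbb C^*$ be the linear character $\psi_\mu(u)=\psi\big(\sum_{1\le i<n,\ i\notin\mathcal B_\mu}u_{i,i+1}\big)$, and let $\mathcal H_\mu=\mathrm{End}_G(\mathrm{Ind}_U^G\psi_\mu)$. Let $N\subseteq G$ be the set of matrices with exactly one nonzero entry in each row and column, and $$N_\mu=\{v\in N : u,\,vuv^{-1}\in U \text{ implies } \psi_\mu(u)=\psi_\mu(vuv^{-1})\}.$$ Let $M_\mu$ be the set of $\ell\times\ell$ matrices $a$ over $\mathbb F_q[X]$ whose entries are monic with $a_{ij}(0)\ne0$ and such that $\sum_j\deg a_{ij}=\mu_i$ for all $i$ and $\sum_i\deg a_{ij}=\mu_j$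 for all $j$. **The matrices $v_a$.** Let $w_{(k)}$ be the $k\times k$ antidiagonal permutation matrix. For a monic $f=a_0+a_1X^{i_1}+\cdots+a_rX^{i_r}+X^d$ with $a_0,\dots,a_r\neq0$ and $0<i_1<\cdots<i_r<d$, let $v_{(f)}=w_{(d)}\big(a_0w_{(i_1)}\oplus a_1w_{(i_2-i_1)}\oplus\cdots\oplus a_rw_{(d-i_r)}\big)$ (the empty matrix if $f=1$). For $a\in M_\mu$, let $v_a$ be the following $n\times n$ matrix, with rows and columns partitioned by $\mu$. Divide the $i$th block of rows, from bottom to top, into consecutive groups of $\deg a_{i1},\dots,\deg a_{i\ell}$ rows, and the $j$th block of columns, from right to left, into consecutive groups of $\deg a_{1j},\dots,\deg a_{\ell j}$ columns; place $v_{(a_{ij})}$ where the $j$th group of the $i$th row block meets the $i$th group of the $j$th column block; all other entries are $0$. **Tableaux.** For a set $S$ with a degree $d:S\to\mathbb Z_{>0}$, an $S$-partition $\lambda$ is a family of partitions $(\lambda^{(s)})_{s\in S}$, all but finitely many of them empty. A column strict tableau $P$ of shape $\lambda$ is a family of fillings $P^{(s)}$ of the $\lambda^{(s)}$ by positive integers,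 strictly increasing down columns and weakly increasing along rows. Its weight is given by $\mathrm{wt}(P)_k=\sum_{s}d(s)\cdot\#\{\text{entries } k\text{ in }P^{(s)}\}$; it has weight $\mu$ if $\mathrm{wt}(P)_k=\mu_k$ for $k\le\ell$ and $\mathrm{wt}(P)_k=0$ for $k>\ell$. Let $\Phi$ be the set of monic irreducible $f\in\mathbb F_q[X]$ with $f(0)\neq0$, with $d(f)=\deg f$. Let $L=\bigcup_{m\ge1}\mathrm{Hom}(\mathbb F_{q^m}^*,\mathbb C^*)$, where a character of $\mathbb F_{q^m}^*$ is identified with its composition with the norm $\mathbb F_{q^{mr}}^*\to\mathbb F_{q^m}^*$, $x\mapsto x^{1+q^m+\cdots+q^{m(r-1)}}$, and let $\Theta$ be the set of orbits in $L$ of $\gamma\mapsto\gamma^q$, with $d(\varphi)=|\varphi|$. For a $\Theta$-partition $\lambda$, let $\hat{\mathcal H}_\mu^\lambda$ be the set of column strict tableaux of shape $\lambda$ and weight $\mu$, and let $\hat{\mathcal H}_\mu=\{\lambda:\hat{\mathcal H}_\mu^\lambda\ne\emptyset\}$. **RSK.** For a column strict tableau $P$ and $j\ge 1$, let $P\leftarrow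 j$ be the result of column insertion: $j$ displaces the smallest entry $\ge j$ of the first column (or is placed at its bottom if there is none), the displaced entry is inserted in the same way into the next column, and so on until nothing is displaced. For an $\ell\times\ell$ matrix $b$ of nonnegative integers, list $b_{ij}$ copies of each pair $(i,j)$ in a sequence $(i_1,j_1),\dots,(i_N,j_N)$ with $i_1\le\cdots\le i_N$ and $j_k\ge j_{k+1}$ whenever $i_k=i_{k+1}$. Starting from $P_0=Q_0=\emptyset$, put $P_k=P_{k-1}\leftarrow j_k$ and let $Q_k$ be $Q_{k-1}$ with $i_k$ added in the box of $P_k$ that is not in $P_{k-1}$; put $P(b)=P_N$ and $Q(b)=Q_N$. For $a\in M_\mu$ and $f\in\Phi$, let $a^{(f)}_{ij}$ be the exponent of the highest power of $f$ dividing $a_{ij}$, and put $P(a)=(P(a^{(f)}))_{f\in\Phi}$ and $Q(a)=(Q(a^{(f)}))_{f\in\Phi}$. **Theorem 4.2.** The map $a\mapsto v_a$ is a bijection $M_\mu\to N_\mu$. Writing $v\mapsto a_v$ for its inverse, the map $$N_\mu\to M_\mu\to\{\text{pairs }(P,Q)\text{ of }\Phi\text{-column strict tableaux of the same shape and of weight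 }\mu\},\qquad v\mapsto a_v\mapsto(P(a_v),Q(a_v)),$$ is a (well defined) bijection. Moreover, all the sets below are finite and $$\dim_{\mathbb C}\mathcal H_\mu=|N_\mu|=\sum_{\lambda\in\hat{\mathcal H}_\mu}|\hat{\mathcal H}_\mu^\lambda|^2 ,$$ and there are finitely many irreducible $\mathcal H_\mu$-modules up to isomorphism, the sum of the squares of their dimensions being $\dim_{\mathbb C}\mathcal H_\mu$. -/

import Mathlib

universe u

open Polynomial

namespace UnipotentHecke

noncomputable section

/-! ### The group `GL_n(F)`, the characters `ψ_μ` and the Hecke algebra `H_μ` -/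

/-- The set `B_μ = {μ₁, μ₁ + μ₂, …, μ₁ + ⋯ + μ_ℓ}` of partial sums of a composition. -/
def partialSums {n : ℕ} (μ : Composition n) : Set ℕ :=
  {k | ∃ i : Fin μ.length, k = μ.sizeUpTo (i + 1)}

/-- Upper triangular matrices with ones on the diagonal. -/
def IsUnipotentUpper {F : Type u} [Field F] {n : ℕ} (g : Matrix (Fin n) (Fin n) F) : Prop :=
  g.IsUpperTriangular ∧ ∀ i, g i i = 1

lemma mul_diag_of_upper {F : Type u} [Field F] {n : ℕ} {g h : Matrix (Fin n) (Fin n) F}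
    (hg : g.IsUpperTriangular) (hh : h.IsUpperTriangular) (i : Fin n) :
    (g * h) i i = g i i * h i i := by
  rw [Matrix.mul_apply]
  refine Finset.sum_eq_single i (fun k _ hk => ?_) (by simp)
  rcases lt_or_gt_of_ne hk with h1 | h1
  · rw [hg h1, zero_mul]
  · rw [hh h1, mul_zero]

/-- The subgroup `U` of unipotent upper triangular matrices of `GL_n(F)`. -/
def unipotentSubgroup (F : Type u) [Field F] (n : ℕ) : Subgroup (GL (Fin n) F) where
  carrier := {g | IsUnipotentUpper (g : Matrix (Fin n) (Fin n) F)}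
  one_mem' := ⟨by simpa using Matrix.blockTriangular_one, by simp⟩
  mul_mem' := by
    rintro g h ⟨hg, hg'⟩ ⟨hh, hh'⟩
    refine ⟨by simpa using hg.mul hh, fun i => ?_⟩
    rw [Matrix.GeneralLinearGroup.coe_mul, mul_diag_of_upper hg hh, hg', hh', one_mul]
  inv_mem' := by
    rintro g ⟨hg, hg'⟩
    have hi : ((g⁻¹ : GL (Fin n) F) : Matrix (Fin n) (Fin n) F).IsUpperTriangular := by
      have : Invertible (g : Matrix (Fin n) (Fin n) F) := Units.invertible g
      rw [Matrix.coe_units_inv]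
      exact Matrix.blockTriangular_inv_of_blockTriangular hg
    refine ⟨hi, fun i => ?_⟩
    have h1 := mul_diag_of_upper hg hi i
    rw [← Matrix.GeneralLinearGroup.coe_mul, mul_inv_cancel, hg', one_mul] at h1
    simpa using h1.symm

/-- The sum of those superdiagonal entries `g_{i,i+1}` (rows and columns numbered from `1`)
for which `i ∉ B_μ`. -/
def superdiagSum {F : Type u} [Field F] {n : ℕ} (μ : Composition n)
    (g : Matrix (Fin n) (Fin n) F) : F :=
  open Classical in
  ∑ i : Fin n, ∑ j : Fin n, if (j : ℕ) = i + 1 ∧ (i : ℕ) + 1 ∉ partialSums μ then g i j else 0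

lemma superdiagSum_mul {F : Type u} [Field F] {n : ℕ} (μ : Composition n)
    {g h : Matrix (Fin n) (Fin n) F} (hg : IsUnipotentUpper g) (hh : IsUnipotentUpper h) :
    superdiagSum μ (g * h) = superdiagSum μ g + superdiagSum μ h := by
  classical
  unfold superdiagSum
  simp only [← Finset.sum_add_distrib]
  refine Finset.sum_congr rfl fun i _ => Finset.sum_congr rfl fun j _ => ?_
  split_ifs with hij
  · have hne : i ≠ j := by
      rintro rfl
      omega
    rw [Matrix.mul_apply, Finset.sum_eq_add i j hne]
    · rw [hg.2, hh.2, one_mul, mul_one, add_comm]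
    · rintro k - ⟨hki, hkj⟩
      rcases lt_or_gt_of_ne hki with h1 | h1
      · rw [hg.1 h1, zero_mul]
      · have h2 : j < k := by
          have := Fin.val_ne_of_ne hkj
          rw [Fin.lt_def] at h1 ⊢
          omega
        rw [hh.1 h2, mul_zero]
    · simp
    · simp
  · simp

/-- The character `ψ_μ : U → ℂ`: it sends the elementary matrix `x_{ij}(t)` to `ψ(t)` if
`j = i + 1` and `i ∉ B_μ`, and to `1` otherwise. -/
def psiMu {F : Type u} [Field F] (ψ : AddChar F ℂ) {n : ℕ} (μ : Composition n) :
    unipotentSubgroup F n →* ℂ where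
  toFun u := ψ (superdiagSum μ (u : GL (Fin n) F).1)
  map_one' := by
    have h : superdiagSum μ (1 : Matrix (Fin n) (Fin n) F) = 0 := by
      classical
      refine Finset.sum_eq_zero fun i _ => Finset.sum_eq_zero fun j _ => ?_
      split_ifs with hij
      · exact Matrix.one_apply_ne (by rintro rfl; omega)
      · rfl
    simp [h]
  map_mul' u v := by
    rw [← AddChar.map_add_eq_mul, ← superdiagSum_mul μ u.2 v.2]
    rfl

/-- The one-dimensional representation of `U` on `ℂ` given by `ψ_μ`. -/
def psiRep {F : Type u} [Field F] (ψ : AddChar F ℂ) {n : ℕ} (μ : Composition n) :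
    Representation ℂ (unipotentSubgroup F n) ℂ :=
  ((algebraMap ℂ (Module.End ℂ ℂ)) : ℂ →* Module.End ℂ ℂ).comp (psiMu ψ μ)

/-- The unipotent Hecke algebra `H_μ = End_G(Ind_U^G(ψ_μ))`: the algebra of all linear
endomorphisms of the induced representation that commute with the action of `G = GL_n(F)`. -/
abbrev HeckeAlgebra {F : Type u} [Field F] (ψ : AddChar F ℂ) {n : ℕ} (μ : Composition n) :=
  Subalgebra.centralizer ℂ
    (Set.range (Representation.ind (unipotentSubgroup F n).subtype (psiRep ψ μ)))

/-- The set `N` of monomial matrices: exactly one nonzero entry in each row and column. -/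
def IsMonomial {F : Type u} [Field F] {n : ℕ} (v : Matrix (Fin n) (Fin n) F) : Prop :=
  (∀ i, ∃! j, v i j ≠ 0) ∧ (∀ j, ∃! i, v i j ≠ 0)

/-- `N_μ = {v ∈ N : u, v u v⁻¹ ∈ U implies ψ_μ(u) = ψ_μ(v u v⁻¹)}`. -/
def Nset {F : Type u} [Field F] (ψ : AddChar F ℂ) {n : ℕ} (μ : Composition n) :
    Set (GL (Fin n) F) :=
  {v | IsMonomial (v : Matrix (Fin n) (Fin n) F) ∧
    ∀ (u : GL (Fin n) F) (hu : u ∈ unipotentSubgroup F n)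
      (hvu : v * u * v⁻¹ ∈ unipotentSubgroup F n),
      psiMu ψ μ ⟨u, hu⟩ = psiMu ψ μ ⟨v * u * v⁻¹, hvu⟩}

/-! ### The matrices `M_μ` and the monomial matrices `v_a` -/

/-- `M_μ`: the `ℓ × ℓ` matrices of monic polynomials with nonzero constant term whose degree row
sums and degree column sums are both equal to `μ`. -/
def Mset (F : Type u) [Field F] {n : ℕ} (μ : Composition n) :
    Set (Matrix (Fin μ.length) (Fin μ.length) F[X]) :=
  {a | (∀ i, ∑ j, (a i j).natDegree = μ.blocksFun i) ∧
    (∀ j, ∑ i, (a i j).natDegree = μ.blocksFun j) ∧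
    ∀ i j, (a i j).Monic ∧ (a i j).eval 0 ≠ 0}

/-- The largest exponent `m ≤ c` of a monomial that occurs in `f`. -/
def lowerExp {F : Type u} [Field F] (f : F[X]) (c : ℕ) : ℕ :=
  open Classical in Nat.findGreatest (fun m => f.coeff m ≠ 0) c

/-- The smallest exponent `m > c` of a monomial that occurs in `f`. -/
def upperExp {F : Type u} [Field F] (f : F[X]) (c : ℕ) : ℕ :=
  sInf {m | c < m ∧ f.coeff m ≠ 0}

/-- For `f = a₀ + a₁ X^{i₁} + ⋯ + a_r X^{i_r} + X^d` with `a₀, …, a_r ≠ 0` and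
`0 = i₀ < i₁ < ⋯ < i_r < i_{r+1} = d`, this is the `d × d` matrix
`v_(f) = w_(d) (a₀ w_(i₁) ⊕ a₁ w_(i₂ - i₁) ⊕ ⋯ ⊕ a_r w_(d - i_r))`, where `w_(k)` is the
antidiagonal permutation matrix, with rows and columns numbered from `0` (and with `0` outside
of the `d × d` square). If column `c` lies in the `k`-th summand, `i_k ≤ c < i_{k+1}`, then the
nonzero entry of that column of the direct sum is `a_k`, in row `i_k + i_{k+1} - 1 - c`;
multiplication by `w_(d)` moves it to row `d - 1 - (i_k + i_{k+1} - 1 - c)`. -/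
def vPoly {F : Type u} [Field F] (f : F[X]) (r c : ℕ) : F :=
  if r < f.natDegree ∧ c < f.natDegree ∧ r + lowerExp f c + upperExp f c = f.natDegree + c then
    f.coeff (lowerExp f c)
  else 0

/-- The `n × n` matrix `v_a`, with rows and columns partitioned according to `μ`. In the `i`-th
block of rows the entries `a_{i1}, a_{i2}, …` occupy successive groups of
`deg a_{i1}, deg a_{i2}, …` rows from bottom to top; in the `j`-th block of columns the entries
`a_{1j}, a_{2j}, …` occupy successive groups of `deg a_{1j}, deg a_{2j}, …` columns from right to
left; the matrix `v_(a_{ij})` is placed where the rows and the columns of `a_{ij}` meet. -/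
def vMatrix {F : Type u} [Field F] {n : ℕ} (μ : Composition n)
    (a : Matrix (Fin μ.length) (Fin μ.length) F[X]) : Matrix (Fin n) (Fin n) F :=
  fun p s =>
    let i := μ.index p
    let j := μ.index s
    let r : ℕ := μ.invEmbedding p
    let c : ℕ := μ.invEmbedding s
    let r₀ := ∑ k ∈ Finset.Ioi j, (a i k).natDegree
    let c₀ := ∑ k ∈ Finset.Ioi i, (a k j).natDegree
    if r₀ ≤ r ∧ c₀ ≤ c then vPoly (a i j) (r - r₀) (c - c₀) else 0

/-! ### The classical RSK correspondence (by column insertion)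

In the algorithm a tableau is the list of its columns, from left to right, each column read from
top to bottom. -/

/-- Insert `x` into a (strictly increasing) column: `x` displaces the smallest entry `≥ x`, or is
placed at the bottom if there is none. Returns the new column and the displaced entry, if any. -/
def insertColumn (x : ℕ) : List ℕ → List ℕ × Option ℕ
  | [] => ([x], none)
  | y :: ys =>
    if x ≤ y then (x :: ys, some y)
    else (y :: (insertColumn x ys).1, (insertColumn x ys).2)

/-- The tableau `P ← x`: insert `x` into the first column, insert the displaced entry into the
next column, and so on until no entry is displaced. -/
def insertTableau (x : ℕ) : List (List ℕ) → List (List ℕ)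
  | [] => [[x]]
  | C :: Cs =>
    match insertColumn x C with
    | (C', none) => C' :: Cs
    | (C', some y) => C' :: insertTableau y Cs

/-- The filling of the quadrant given by a list of columns: the entry in row `i` and column `j`,
both numbered from `0`, and `0` where there is no box. -/
def filling (C : List (List ℕ)) (i j : ℕ) : ℕ := (C.getD j []).getD i 0

/-- The sequence `(P_k, Q_k)` for a two-line array, given as the list of its columns `(i_k, j_k)`:
`P_k = P_{k-1} ← j_k`, and `Q_k` is `Q_{k-1}` with `i_k` in the box of `P_k` that is not in
`P_{k-1}`. -/
def rskSteps (w : List (ℕ × ℕ)) : List (List ℕ) × (ℕ → ℕ → ℕ) :=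
  w.foldl
    (fun PQ ij =>
      (insertTableau ij.2 PQ.1, fun r c =>
        if filling PQ.1 r c = 0 ∧ filling (insertTableau ij.2 PQ.1) r c ≠ 0 then ij.1
        else PQ.2 r c))
    ([], fun _ _ => 0)

/-- The two-line array of a matrix `b` of nonnegative integers: `b_{ij}` copies of each pair
`(i, j)` (numbered from `1`), with `i` weakly increasing, and `j` weakly decreasing among the
pairs with equal `i`. -/
def twoLineArray {l : ℕ} (b : Matrix (Fin l) (Fin l) ℕ) : List (ℕ × ℕ) :=
  (List.finRange l).flatMap fun i =>
    (List.finRange l).reverse.flatMap fun j =>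
      List.replicate (b i j) ((i : ℕ) + 1, (j : ℕ) + 1)

/-- The insertion tableau `P(b)`, as a filling of the quadrant (`0` where there is no box). -/
def rskP {l : ℕ} (b : Matrix (Fin l) (Fin l) ℕ) : ℕ → ℕ → ℕ :=
  filling (rskSteps (twoLineArray b)).1

/-- The recording tableau `Q(b)`, as a filling of the quadrant (`0` where there is no box). -/
def rskQ {l : ℕ} (b : Matrix (Fin l) (Fin l) ℕ) : ℕ → ℕ → ℕ :=
  (rskSteps (twoLineArray b)).2

/-! ### `S`-partitions and column strict tableaux -/

/-- An `S`-partition: a family of partitions indexed by `S`, all but finitely many of them empty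
(i.e. of finite size). -/
structure SPartition (S : Type*) where
  part : S → YoungDiagram
  finite_support : {s | part s ≠ ⊥}.Finite

/-- A column strict tableau: a filling of the boxes by positive integers that increases strictly
along columns and weakly along rows. -/
def ColumnStrictTableau (ν : YoungDiagram) :=
  {T : SemistandardYoungTableau ν // ∀ c ∈ ν.cells, 0 < T c.1 c.2}

/-- The number of entries equal to `k` in a tableau. -/
def ColumnStrictTableau.count {ν : YoungDiagram} (T : ColumnStrictTableau ν) (k : ℕ) : ℕ :=
  (ν.cells.filter fun c => T.1 c.1 c.2 = k).card

/-- A column strict tableau whose shape is an `S`-partition. -/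
abbrev STableau {S : Type*} (lam : SPartition S) := ∀ s, ColumnStrictTableau (lam.part s)

/-- `wt(P)_k = ∑_s d(s) · (number of k in P^{(s)})`, where `d(s)` is the degree of `s`. -/
def STableau.wt {S : Type*} (d : S → ℕ) {lam : SPartition S} (P : STableau lam) (k : ℕ) : ℕ :=
  ∑ s ∈ lam.finite_support.toFinset, d s * (P s).count k

/-- The column strict tableaux of shape `λ` and weight `μ = (μ₁, …, μ_ℓ)`: `wt(P)_k = μ_k` for
`1 ≤ k ≤ ℓ`, and `wt(P)_k = 0` for `k > ℓ`. -/
def TableauxOfWeight {S : Type*} (d : S → ℕ) {n : ℕ} (μ : Composition n) (lam : SPartition S) :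
    Type _ :=
  {P : STableau lam // ∀ k : ℕ, P.wt d (k + 1) = μ.blocks.getD k 0}

/-! ### The index set `Φ` -/

/-- `Φ`: the monic irreducible polynomials over `F` with nonzero constant term. -/
def Phi (F : Type u) [Field F] : Type u :=
  {f : F[X] // f.Monic ∧ Irreducible f ∧ f.eval 0 ≠ 0}

/-- The degree of an element of `Φ`. -/
def Phi.degree {F : Type u} [Field F] (f : Phi F) : ℕ := f.1.natDegree

/-- The matrix `a^{(f)}`: its `(i,j)` entry is the exponent of the highest power of `f` that
divides `a_{ij}`. -/
def exponentMatrix {F : Type u} [Field F] {l : ℕ} (a : Matrix (Fin l) (Fin l) F[X]) (f : Phi F) :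
    Matrix (Fin l) (Fin l) ℕ :=
  fun i j => multiplicity f.1 (a i j)

/-- The pairs of `Φ`-column strict tableaux of the same shape and of weight `μ`. -/
abbrev TableauPairs (F : Type u) [Field F] {n : ℕ} (μ : Composition n) :=
  Σ lam : SPartition (Phi F),
    TableauxOfWeight Phi.degree μ lam × TableauxOfWeight Phi.degree μ lam

/-! ### The index set `Θ` -/

/-- The group `𝔽_{q^m}^×`, realised in an algebraic closure of `F = 𝔽_q`. -/
abbrev extUnits (F : Type u) [Field F] (m : ℕ+) : Subgroup (AlgebraicClosure F)ˣ :=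
  rootsOfUnity (Nat.card F ^ (m : ℕ) - 1) (AlgebraicClosure F)

/-- The norm `𝔽_{q^{mr}}^× → 𝔽_{q^m}^×`, `x ↦ x^{1 + q^m + ⋯ + q^{m(r-1)}}`. -/
def normHom (F : Type u) [Field F] [Finite F] (m r : ℕ+) : extUnits F (m * r) →* extUnits F m :=
  ((powMonoidHom (∑ i ∈ Finset.range r, (Nat.card F ^ (m : ℕ)) ^ i)).comp
    (extUnits F (m * r)).subtype).codRestrict (extUnits F m) (by
      intro x
      have hx : (x : (AlgebraicClosure F)ˣ) ^ (Nat.card F ^ ((m * r : ℕ+) : ℕ) - 1) = 1 := x.2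
      have hq : 1 ≤ Nat.card F ^ (m : ℕ) := Nat.one_le_pow _ _ Nat.card_pos
      rw [mem_rootsOfUnity]
      simp only [MonoidHom.coe_comp, Function.comp_apply, powMonoidHom_apply,
        Subgroup.coe_subtype]
      rw [← pow_mul, geom_sum_mul_of_one_le hq, ← pow_mul]
      simpa using hx)

/-- `L = ⋃_m L_m`, where `L_m` is the character group of `𝔽_{q^m}^×`, and where `γ ∈ L_m` is
identified with its composition with the norm, an element of `L_{mr}`. -/
def CharUnion (F : Type u) [Field F] [Finite F] : Type u :=
  Quot (fun a b : Σ m : ℕ+, (extUnits F m →* ℂˣ) =>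
    ∃ r : ℕ+, b = ⟨a.1 * r, a.2.comp (normHom F a.1 r)⟩)

/-- The Frobenius map `γ ↦ γ^q` of `L`. -/
def CharUnion.frobenius (F : Type u) [Field F] [Finite F] : CharUnion F → CharUnion F :=
  Quot.map (fun a => ⟨a.1, a.2 ^ Nat.card F⟩) (by
    rintro a _ ⟨r, rfl⟩
    exact ⟨r, rfl⟩)

/-- `Θ`: the orbits of the Frobenius map on `L`. -/
def Theta (F : Type u) [Field F] [Finite F] : Type u :=
  Quot (fun x y : CharUnion F => y = CharUnion.frobenius F x)

/-- The size `|φ|` of an orbit `φ ∈ Θ`. -/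
def Theta.size {F : Type u} [Field F] [Finite F] (φ : Theta F) : ℕ :=
  Nat.card {x : CharUnion F // (Quot.mk _ x : Theta F) = φ}

/-- `Ĥ_μ^λ`: the column strict tableaux of shape `λ`, a `Θ`-partition, and of weight `μ`. -/
abbrev HhatTableaux {F : Type u} [Field F] [Finite F] {n : ℕ} (μ : Composition n)
    (lam : SPartition (Theta F)) :=
  TableauxOfWeight Theta.size μ lam

/-- `Ĥ_μ`: the `Θ`-partitions `λ` for which `Ĥ_μ^λ` is not empty. -/
def Hhat (F : Type u) [Field F] [Finite F] {n : ℕ} (μ : Composition n) :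
    Set (SPartition (Theta F)) :=
  {lam | Nonempty (HhatTableaux μ lam)}

end

end UnipotentHecke

open UnipotentHecke

/-!
Why the theorem holds.

*Monomial matrices.* The elements of `N_μ` are the monomial matrices `v`, given by a permutation
`w` and coefficients `c`, for which the condition holds at the elementary unipotents
(`mem_Nset_iff`): whenever `i < j` and `w i < w j`, the root `(i, j)` is simple and inside a block of
`μ` if and only if `(w i, w j)` is, and then `c i = c j`. Hence, in each pair of blocks, the columns
of one with nonzero entries in the rows of the other are consecutive, and so are these rows
(`exists_posIn_eq_offset`), so that the positions of the corresponding square submatrices are forced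
by their sizes. In each submatrix every ascent of `w` at consecutive places is by `1` and preserves the
coefficient: it is block antidiagonal with scalar blocks. These are the matrices `v_(f)`
(`exists_vRow_eq`), the block sizes and scalars being the gaps between the exponents of `f` and its
coefficients. This gives the bijection `a ↦ v_a` (`exists_equiv_Mset`).

*Pairs of tableaux.* By unique factorization in `F[X]` a matrix of monic polynomials with nonzero
constant terms is a finitely supported family, indexed by `Φ`, of matrices of natural numbers.
Column-insertion RSK is a bijection from such matrices to pairs of column strict tableaux of the
same shape: the last inserted letter is recovered by reverse insertion from the position of the
rightmost largest letter of `Q`, because successive insertions of weakly decreasing letters add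
boxes in strictly increasing columns (`newColumn_lt`, `newColumn_le`, `rskSteps_injective`,
`rskSteps_surjective`). Row and column sums become the weights (`exists_equiv_tableauPairs`).

*Dimension of the Hecke algebra.* By Mackey theory the endomorphisms of the induced representation
are the functions `h` on `G` with `h(u x u') = ψ_μ(u) h(x) ψ_μ(u')`, so the dimension is the number
of double cosets of `U` on which such a function may be nonzero (`finrank_indEnd`). The Bruhat
decomposition says that each double coset contains exactly one monomial matrix
(`exists_isMonomial_unipotent_mul`, `eq_of_unipotent_mul`), and the condition for that matrix to
support a function is membership in `N_μ`.

*From `Φ` to `Θ`.* A bijection `Φ ≃ Θ` preserving degrees transports tableaux. It exists since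
both sets have the same finite number of elements of each degree: the elements of degree dividing
`m` are counted, with multiplicity their degree, by the `q^m - 1` nonzero elements of the field with
`q^m` elements on one side and by the `q^m - 1` characters of its unit group on the other
(`card_phiOf_degree_dvd`, `card_theta_size_dvd`, `exists_equiv_of_card_eq`,
`exists_equiv_phi_theta`).

*Simple modules.* By Maschke's theorem the induced representation is semisimple, hence so is its
endomorphism algebra (`isSemisimpleRing_centralizer`), and over `ℂ` the dimension of a semisimple
algebra is the sum of the squares of the dimensions of its simple modules (`exists_simple_modules`).
-/

namespace UnipotentHecke

/-! ### Columns and tableaux as lists, and the reverse of column insertion -/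

lemma insertColumn_of_forall_lt {x : ℕ} {C : List ℕ} (h : ∀ a ∈ C, a < x) :
    insertColumn x C = (C ++ [x], none) := by
  induction C with
  | nil => rfl
  | cons a C ih =>
    have ha : ¬ x ≤ a := not_le.2 (h a (by simp))
    simp [insertColumn, ha, ih fun b hb => h b (by simp [hb])]

lemma insertColumn_append {x y : ℕ} {A B : List ℕ} (hA : ∀ a ∈ A, a < x) (hxy : x ≤ y) :
    insertColumn x (A ++ y :: B) = (A ++ x :: B, some y) := by
  induction A with
  | nil => simp [insertColumn, hxy]
  | cons a A ih =>
    have ha : ¬ x ≤ a := not_le.2 (hA a (by simp))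
    simp [insertColumn, ha, ih fun b hb => hA b (by simp [hb])]

lemma forall_lt_or_exists_split (x : ℕ) (C : List ℕ) :
    (∀ a ∈ C, a < x) ∨ ∃ A y B, C = A ++ y :: B ∧ (∀ a ∈ A, a < x) ∧ x ≤ y := by
  induction C with
  | nil => simp
  | cons a C ih =>
    by_cases ha : x ≤ a
    · exact Or.inr ⟨[], a, C, by simp [ha]⟩
    · rcases ih with h | ⟨A, y, B, rfl, hA, hxy⟩
      · left; simpa [not_le.1 ha] using h
      · exact Or.inr ⟨a :: A, y, B, by simp, by simpa [not_le.1 ha] using hA, hxy⟩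

/-- `RowLE C D` says that a column `D` may stand immediately to the right of the column `C`: it is
not longer, and rows increase weakly. -/
def RowLE : List ℕ → List ℕ → Prop
  | _, [] => True
  | [], _ :: _ => False
  | a :: C, b :: D => a ≤ b ∧ RowLE C D

/-- A column strict tableau, as the list of its columns. -/
def IsTab : List (List ℕ) → Prop
  | [] => True
  | C :: Cs => (C ≠ [] ∧ C.Pairwise (· < ·) ∧ ∀ a ∈ C, 0 < a) ∧ RowLE C (Cs.headD []) ∧ IsTab Cs

@[simp] lemma rowLE_nil (C : List ℕ) : RowLE C [] := by cases C <;> trivial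

lemma rowLE_append_right {C D E : List ℕ} (h : RowLE C D) : RowLE (C ++ E) D := by
  induction C generalizing D with
  | nil => cases D <;> simp_all [RowLE]
  | cons a C ih =>
    cases D with
    | nil => simp
    | cons d D => exact ⟨h.1, ih h.2⟩

lemma rowLE_replace {A B D : List ℕ} {x y : ℕ} (hxy : x ≤ y) (h : RowLE (A ++ y :: B) D) :
    RowLE (A ++ x :: B) D := by
  induction A generalizing D with
  | nil =>
    cases D with
    | nil => simp
    | cons d D => exact ⟨hxy.trans h.1, h.2⟩
  | cons a A ih =>
    cases D with
    | nil => simp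
    | cons d D => exact ⟨h.1, ih h.2⟩

lemma rowLE_replace_of_le {A B D : List ℕ} {x y : ℕ} (hD : ∀ d ∈ D, y ≤ d)
    (h : RowLE (A ++ x :: B) D) : RowLE (A ++ y :: B) D := by
  induction A generalizing D with
  | nil =>
    cases D with
    | nil => simp
    | cons d D => exact ⟨hD d (by simp), h.2⟩
  | cons a A ih =>
    cases D with
    | nil => simp
    | cons d D => exact ⟨h.1, ih (fun e he => hD e (by simp [he])) h.2⟩

/-- Rows stay weakly increasing when `x` displaces `y` and `y` is inserted into the next column. -/
lemma rowLE_insertColumn {A B D : List ℕ} {x y : ℕ} (hA : ∀ a ∈ A, a < x) (hxy : x ≤ y)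
    (h : RowLE (A ++ y :: B) D) : RowLE (A ++ x :: B) (insertColumn y D).1 := by
  induction A generalizing D with
  | nil =>
    cases D with
    | nil => simp [insertColumn, RowLE, hxy]
    | cons d D =>
      have : y ≤ d := h.1
      simp only [insertColumn, this, if_true]
      exact ⟨hxy, h.2⟩
  | cons a A ih =>
    have hax : a < x := hA a (by simp)
    cases D with
    | nil => simp [insertColumn, RowLE]; omega
    | cons d D =>
      by_cases hd : y ≤ d
      · simp only [insertColumn, hd, if_true]
        exact ⟨by omega, rowLE_replace hxy h.2⟩
      · simp only [insertColumn, hd, if_false]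
        exact ⟨h.1, ih (fun b hb => hA b (by simp [hb])) h.2⟩

lemma exists_head_insertColumn_le (y : ℕ) (D : List ℕ) :
    ∃ e E, (insertColumn y D).1 = e :: E ∧ e ≤ y := by
  cases D with
  | nil => exact ⟨y, [], rfl, le_rfl⟩
  | cons d D =>
    by_cases hd : y ≤ d
    · exact ⟨y, D, by simp [insertColumn, hd], le_rfl⟩
    · exact ⟨d, _, by simp only [insertColumn, hd, if_false]; rfl, by omega⟩

/-- The converse of `rowLE_insertColumn`: rows stay weakly increasing under the reverse step. -/
lemma rowLE_of_insertColumn {A B D : List ℕ} {x y : ℕ} (hD : D.Pairwise (· < ·))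
    (hA : ∀ a ∈ A, a < x) (hxy : x ≤ y) (hB : ∀ b ∈ B, y < b)
    (h : RowLE (A ++ x :: B) (insertColumn y D).1) : RowLE (A ++ y :: B) D := by
  induction A generalizing D with
  | nil =>
    cases D with
    | nil => simp
    | cons d D =>
      by_cases hd : y ≤ d
      · simp only [insertColumn, hd, if_true] at h
        exact ⟨hd, h.2⟩
      · simp only [insertColumn, hd, if_false] at h
        obtain ⟨e, E, hE, hey⟩ := exists_head_insertColumn_le y D
        have h2 := h.2
        rw [hE] at h2
        cases B with
        | nil => exact h2.elim
        | cons b B =>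
          have h3 := hB b (by simp)
          have h4 : b ≤ e := h2.1
          omega
  | cons a A ih =>
    have hax : a < x := hA a (by simp)
    cases D with
    | nil => simp
    | cons d D =>
      rw [List.pairwise_cons] at hD
      by_cases hd : y ≤ d
      · simp only [insertColumn, hd, if_true] at h
        refine ⟨by omega, rowLE_replace_of_le (fun e he => ?_) h.2⟩
        have := hD.1 e he
        omega
      · simp only [insertColumn, hd, if_false] at h
        exact ⟨h.1, ih hD.2 (fun b hb => hA b (by simp [hb])) h.2⟩

lemma headD_insertTableau (x : ℕ) (Cs : List (List ℕ)) :
    (insertTableau x Cs).headD [] = (insertColumn x (Cs.headD [])).1 := by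
  cases Cs with
  | nil => rfl
  | cons C Cs =>
    rw [insertTableau]
    rcases h : insertColumn x C with ⟨C', _ | y⟩ <;> simp [h]

lemma insertTableau_of_forall_lt {x : ℕ} {C : List ℕ} {Cs : List (List ℕ)}
    (h : ∀ a ∈ C, a < x) : insertTableau x (C :: Cs) = (C ++ [x]) :: Cs := by
  rw [insertTableau, insertColumn_of_forall_lt h]

lemma insertTableau_append {x y : ℕ} {A B : List ℕ} {Cs : List (List ℕ)} (hA : ∀ a ∈ A, a < x)
    (hxy : x ≤ y) :
    insertTableau x ((A ++ y :: B) :: Cs) = (A ++ x :: B) :: insertTableau y Cs := by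
  rw [insertTableau, insertColumn_append hA hxy]

/-- The number (from `0`) of the column in which the insertion of `x` ends. -/
def newColumn (x : ℕ) : List (List ℕ) → ℕ
  | [] => 0
  | C :: Cs =>
    match (insertColumn x C).2 with
    | none => 0
    | some y => newColumn y Cs + 1

lemma newColumn_of_forall_lt {x : ℕ} {C : List ℕ} {Cs : List (List ℕ)}
    (h : ∀ a ∈ C, a < x) : newColumn x (C :: Cs) = 0 := by
  rw [newColumn, insertColumn_of_forall_lt h]

lemma newColumn_append {x y : ℕ} {A B : List ℕ} {Cs : List (List ℕ)} (hA : ∀ a ∈ A, a < x)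
    (hxy : x ≤ y) : newColumn x ((A ++ y :: B) :: Cs) = newColumn y Cs + 1 := by
  rw [newColumn, insertColumn_append hA hxy]

lemma pairwise_append_replace {A B : List ℕ} {x y : ℕ} (h : (A ++ y :: B).Pairwise (· < ·))
    (hA : ∀ a ∈ A, a < x) (hB : ∀ b ∈ B, x < b) : (A ++ x :: B).Pairwise (· < ·) := by
  simp only [List.pairwise_append, List.pairwise_cons, List.mem_cons] at h ⊢
  refine ⟨h.1, ⟨hB, h.2.1.2⟩, ?_⟩
  rintro a ha b (rfl | hb)
  · exact hA a ha
  · exact (hA a ha).trans (hB b hb)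

lemma IsTab.insertTableau {x : ℕ} (hx : 0 < x) {Cs : List (List ℕ)} (h : IsTab Cs) :
    IsTab (insertTableau x Cs) := by
  induction Cs generalizing x with
  | nil => simp [UnipotentHecke.insertTableau, IsTab, hx]
  | cons C Cs ih =>
    obtain ⟨⟨hne, hC, hpos⟩, hR, hT⟩ := h
    rcases forall_lt_or_exists_split x C with hlt | ⟨A, y, B, rfl, hA, hxy⟩
    · rw [insertTableau_of_forall_lt hlt]
      refine ⟨⟨by simp, ?_, ?_⟩, rowLE_append_right hR, hT⟩
      · simpa [List.pairwise_append, hC] using hlt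
      · intro a ha
        rcases List.mem_append.1 ha with ha | ha
        · exact hpos a ha
        · simp at ha; omega
    · rw [insertTableau_append hA hxy]
      refine ⟨⟨by simp, pairwise_append_replace hC hA fun b hb => ?_, ?_⟩, ?_, ih (by omega) hT⟩
      · simp only [List.pairwise_append, List.pairwise_cons] at hC
        exact hxy.trans_lt (hC.2.1.1 b hb)
      · intro a ha
        simp only [List.mem_append, List.mem_cons] at ha hpos
        rcases ha with ha | rfl | ha
        · exact hpos a (Or.inl ha)
        · exact hx
        · exact hpos a (Or.inr (Or.inr ha))
      · rw [headD_insertTableau]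
        exact rowLE_insertColumn hA hxy hR

/-- The reverse of a displacement: `y` displaces the last entry `≤ y` of the column. Returns the
new column and the displaced entry. -/
def ejectColumn (y : ℕ) : List ℕ → List ℕ × ℕ
  | [] => ([], y)
  | z :: C =>
    if C.headD (y + 1) ≤ y then (z :: (ejectColumn y C).1, (ejectColumn y C).2) else (y :: C, z)

lemma ejectColumn_append {x y : ℕ} {A B : List ℕ} (hA : ∀ a ∈ A, a ≤ y) (hxy : x ≤ y)
    (hB : ∀ b ∈ B, y < b) : ejectColumn y (A ++ x :: B) = (A ++ y :: B, x) := by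
  induction A with
  | nil =>
    cases B with
    | nil => simp [ejectColumn]
    | cons b B =>
      have := hB b (by simp)
      simp [ejectColumn, not_le.2 this]
  | cons a A ih =>
    have ih := ih fun b hb => hA b (by simp [hb])
    have hd : (A ++ x :: B).headD (y + 1) ≤ y := by
      cases A with
      | nil => simpa using hxy
      | cons a' A => simpa using hA a' (by simp)
    simp only [List.cons_append, ejectColumn, hd, if_true, ih]

lemma exists_split_of_exists_le {y a : ℕ} {C : List ℕ} (h : (a :: C).Pairwise (· < ·))
    (hay : a ≤ y) : ∃ A x B, a :: C = A ++ x :: B ∧ (∀ a ∈ A, a < x) ∧ x ≤ y ∧ ∀ b ∈ B, y < b := by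
  induction C generalizing a with
  | nil => exact ⟨[], a, [], by simp [hay]⟩
  | cons b C ih =>
    rw [List.pairwise_cons] at h
    by_cases hb : b ≤ y
    · obtain ⟨A, x, B, hABC, hA, hxy, hB⟩ := ih h.2 hb
      refine ⟨a :: A, x, B, by simp [hABC], ?_, hxy, hB⟩
      simpa [h.1 x (by rw [hABC]; simp)] using hA
    · refine ⟨[], a, b :: C, by simp, by simp, hay, ?_⟩
      have h2 := (List.pairwise_cons.1 h.2).1
      intro c hc
      rcases List.mem_cons.1 hc with rfl | hc
      · omega
      · have := h2 c hc
        omega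

/-- The reverse of column insertion, started at the bottom box of column `c`: returns the entry
that leaves the tableau and the remaining tableau. -/
def extractTableau : ℕ → List (List ℕ) → ℕ × List (List ℕ)
  | _, [] => (0, [])
  | 0, C :: Cs => (C.getLastD 0, if C.dropLast = [] then [] else C.dropLast :: Cs)
  | c + 1, C :: Cs =>
    ((ejectColumn (extractTableau c Cs).1 C).2,
      (ejectColumn (extractTableau c Cs).1 C).1 :: (extractTableau c Cs).2)

/-- The length of column `c` (numbered from `0`). -/
def colLen (Cs : List (List ℕ)) (c : ℕ) : ℕ := (Cs.getD c []).length

@[simp] lemma colLen_nil (c : ℕ) : colLen [] c = 0 := by simp [colLen]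

@[simp] lemma colLen_cons_zero (C : List ℕ) (Cs : List (List ℕ)) :
    colLen (C :: Cs) 0 = C.length := by simp [colLen]

@[simp] lemma colLen_cons_succ (C : List ℕ) (Cs : List (List ℕ)) (c : ℕ) :
    colLen (C :: Cs) (c + 1) = colLen Cs c := by simp [colLen]

lemma colLen_zero_eq_headD (Cs : List (List ℕ)) : colLen Cs 0 = (Cs.headD []).length := by
  cases Cs <;> simp

theorem extractTableau_insertTableau {x : ℕ} {Cs : List (List ℕ)} (h : IsTab Cs) :
    extractTableau (newColumn x Cs) (insertTableau x Cs) = (x, Cs) := by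
  induction Cs generalizing x with
  | nil => simp [newColumn, insertTableau, extractTableau]
  | cons C Cs ih =>
    obtain ⟨⟨hne, hC, hpos⟩, hR, hT⟩ := h
    rcases forall_lt_or_exists_split x C with hlt | ⟨A, y, B, rfl, hA, hxy⟩
    · rw [insertTableau_of_forall_lt hlt, newColumn_of_forall_lt hlt]
      simp [extractTableau, hne]
    · rw [insertTableau_append hA hxy, newColumn_append hA hxy, extractTableau, ih hT]
      simp only [List.pairwise_append, List.pairwise_cons] at hC
      rw [ejectColumn_append (fun a ha => (hA a ha).le.trans hxy) hxy hC.2.1.1]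

theorem insertTableau_extractTableau {c : ℕ} {Cs : List (List ℕ)} (h : IsTab Cs)
    (hc : colLen Cs (c + 1) < colLen Cs c) :
    IsTab (extractTableau c Cs).2 ∧ 0 < (extractTableau c Cs).1 ∧
      insertTableau (extractTableau c Cs).1 (extractTableau c Cs).2 = Cs ∧
      newColumn (extractTableau c Cs).1 (extractTableau c Cs).2 = c := by
  induction Cs generalizing c with
  | nil => simp at hc
  | cons C Cs ih =>
    obtain ⟨⟨hne, hC, hpos⟩, hR, hT⟩ := h
    cases c with
    | zero =>
      obtain ⟨D, x, rfl⟩ := List.eq_nil_or_concat C |>.resolve_left hne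
      have hlt : ∀ a ∈ D, a < x := by
        rw [List.concat_eq_append, List.pairwise_append] at hC
        simpa using hC.2.2
      have hx : 0 < x := hpos x (by simp)
      have hC' : D.Pairwise (· < ·) := by
        rw [List.concat_eq_append, List.pairwise_append] at hC
        exact hC.1
      simp only [zero_add, colLen_cons_succ, colLen_zero_eq_headD] at hc
      by_cases hD : D = []
      · subst hD
        have : Cs = [] := by
          cases Cs with
          | nil => rfl
          | cons E Es =>
            simp at hc
            exact (hT.1.1 hc).elim
        subst this
        simp [extractTableau, IsTab, insertTableau, newColumn, hx]
      · simp only [extractTableau, List.concat_eq_append, List.dropLast_concat, hD, if_false,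
          List.getLastD_concat]
        rw [insertTableau_of_forall_lt hlt, newColumn_of_forall_lt hlt]
        refine ⟨⟨⟨hD, hC', fun a ha => hpos a (by simp [ha])⟩, ?_, hT⟩, hx, rfl, rfl⟩
        rw [List.concat_eq_append] at hR
        generalize Cs.headD [] = E at hR hc
        clear hlt hC hpos hne hC' hD
        induction D generalizing E with
        | nil =>
          have : E = [] := List.eq_nil_of_length_eq_zero (by simpa using hc)
          simp [this]
        | cons d D ihD =>
          cases E with
          | nil => simp
          | cons e E => exact ⟨hR.1, ihD E hR.2 (by simpa using hc)⟩
    | succ c =>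
      obtain ⟨h1, h2, h3, h4⟩ := ih hT (by simpa using hc)
      simp only [extractTableau]
      set y := (extractTableau c Cs).1
      set Es := (extractTableau c Cs).2
      have hhead : Cs.headD [] = (insertColumn y (Es.headD [])).1 := by
        rw [← headD_insertTableau, h3]
      obtain ⟨e, E, hE, hey⟩ := exists_head_insertColumn_le y (Es.headD [])
      cases C with
      | nil => exact (hne rfl).elim
      | cons a C =>
        have hay : a ≤ y := by
          rw [hhead, hE] at hR
          exact hR.1.trans hey
        obtain ⟨A, x, B, hABC, hA, hxy, hB⟩ := exists_split_of_exists_le hC hay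
        rw [hABC] at hR hC hpos ⊢
        rw [ejectColumn_append (fun a ha => (hA a ha).le.trans hxy) hxy hB,
          insertTableau_append hA hxy, newColumn_append hA hxy, h3, h4]
        refine ⟨⟨⟨by simp, ?_, ?_⟩, ?_, h1⟩, hpos x (by simp), rfl, rfl⟩
        · exact pairwise_append_replace hC (fun a ha => (hA a ha).trans_le hxy) hB
        · intro b hb
          simp only [List.mem_append, List.mem_cons] at hb hpos
          rcases hb with hb | rfl | hb
          · exact hpos b (Or.inl hb)
          · exact h2
          · exact hpos b (Or.inr (Or.inr hb))
        · refine rowLE_of_insertColumn ?_ hA hxy hB (hhead ▸ hR)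
          cases hEs : Es with
          | nil => simp
          | cons D Ds =>
            rw [hEs] at h1
            exact h1.1.2.1

/-- If `x' ≤ x`, then inserting `x` and then `x'` creates the second new box strictly to the right
of the first one. -/
theorem newColumn_lt {x x' : ℕ} {Cs : List (List ℕ)} (h : IsTab Cs) (hx : x' ≤ x) :
    newColumn x Cs < newColumn x' (insertTableau x Cs) := by
  induction Cs generalizing x x' with
  | nil => simp [newColumn, insertTableau, insertColumn, hx]
  | cons C Cs ih =>
    obtain ⟨⟨hne, hC, hpos⟩, hR, hT⟩ := h
    rcases forall_lt_or_exists_split x C with hlt | ⟨A, y, B, rfl, hA, hxy⟩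
    · rw [insertTableau_of_forall_lt hlt, newColumn_of_forall_lt hlt]
      rcases forall_lt_or_exists_split x' (C ++ [x]) with h' | ⟨A', y', B', hs, hA', hxy'⟩
      · have := h' x (by simp)
        omega
      · rw [hs, newColumn_append hA' hxy']
        omega
    · rw [insertTableau_append hA hxy, newColumn_append hA hxy]
      have hxx : ¬ x < x' := by omega
      rcases forall_lt_or_exists_split x' A with h' | ⟨A', y', B', rfl, hA', hxy'⟩
      · rw [newColumn_append h' hx]
        exact Nat.succ_lt_succ (ih hT hxy)
      · rw [List.append_assoc, List.cons_append, newColumn_append hA' hxy']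
        exact Nat.succ_lt_succ (ih hT ((hA y' (by simp)).le.trans hxy))

/-- If `x < x'`, then inserting `x` and then `x'` creates the second new box weakly to the left of
the first one. -/
theorem newColumn_le {x x' : ℕ} {Cs : List (List ℕ)} (h : IsTab Cs) (hx : x < x') :
    newColumn x' (insertTableau x Cs) ≤ newColumn x Cs := by
  induction Cs generalizing x x' with
  | nil => simp [newColumn, insertTableau, insertColumn, not_le.2 hx]
  | cons C Cs ih =>
    obtain ⟨⟨hne, hC, hpos⟩, hR, hT⟩ := h
    rcases forall_lt_or_exists_split x C with hlt | ⟨A, y, B, rfl, hA, hxy⟩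
    · rw [insertTableau_of_forall_lt hlt, newColumn_of_forall_lt hlt, newColumn_of_forall_lt]
      intro a ha
      rcases List.mem_append.1 ha with ha | ha
      · exact (hlt a ha).trans hx
      · simp at ha; omega
    · rw [insertTableau_append hA hxy, newColumn_append hA hxy]
      simp only [List.pairwise_append, List.pairwise_cons] at hC
      rcases forall_lt_or_exists_split x' B with h' | ⟨A', y', B', rfl, hA', hxy'⟩
      · rw [newColumn_of_forall_lt]
        · omega
        · simp only [List.mem_append, List.mem_cons]
          rintro a (ha | rfl | ha)
          · exact (hA a ha).trans hx
          · exact hx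
          · exact h' a ha
      · have hs : A ++ x :: (A' ++ y' :: B') = (A ++ x :: A') ++ y' :: B' := by simp
        rw [hs, newColumn_append _ hxy']
        · exact Nat.succ_le_succ (ih hT (hC.2.1.1 y' (by simp)))
        · simp only [List.mem_append, List.mem_cons]
          rintro a (ha | rfl | ha)
          · exact (hA a ha).trans hx
          · exact hx
          · exact hA' a ha

lemma colLen_insertTableau {x : ℕ} {Cs : List (List ℕ)} (c : ℕ) :
    colLen (insertTableau x Cs) c = colLen Cs c + if c = newColumn x Cs then 1 else 0 := by
  induction Cs generalizing x c with
  | nil => cases c <;> simp [insertTableau, newColumn]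
  | cons C Cs ih =>
    rcases forall_lt_or_exists_split x C with hlt | ⟨A, y, B, rfl, hA, hxy⟩
    · rw [insertTableau_of_forall_lt hlt, newColumn_of_forall_lt hlt]
      cases c <;> simp
    · rw [insertTableau_append hA hxy, newColumn_append hA hxy]
      cases c <;> simp [ih]

lemma perm_flatten_insertTableau (x : ℕ) (Cs : List (List ℕ)) :
    (insertTableau x Cs).flatten.Perm (x :: Cs.flatten) := by
  induction Cs generalizing x with
  | nil => simp [insertTableau]
  | cons C Cs ih =>
    rcases forall_lt_or_exists_split x C with hlt | ⟨A, y, B, rfl, hA, hxy⟩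
    · rw [insertTableau_of_forall_lt hlt, List.flatten_cons, List.flatten_cons, List.append_assoc]
      exact List.perm_middle
    · rw [insertTableau_append hA hxy, List.flatten_cons, List.flatten_cons]
      refine ((ih y).append_left _).trans ?_
      rw [← Multiset.coe_eq_coe]
      simp only [← Multiset.coe_add, ← Multiset.cons_coe, ← Multiset.singleton_add]
      abel

/-! ### Fillings of the quadrant -/

/-- A finite column strict filling of the quadrant by nonnegative integers: the nonzero entries
fill the boxes of a Young diagram, and they increase strictly down the columns and weakly along
the rows. -/
structure IsColumnStrict (T : ℕ → ℕ → ℕ) : Prop where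
  col : ∀ r c, T (r + 1) c ≠ 0 → T r c ≠ 0 ∧ T r c < T (r + 1) c
  row : ∀ r c, T r (c + 1) ≠ 0 → T r c ≠ 0 ∧ T r c ≤ T r (c + 1)
  finite : {p : ℕ × ℕ | T p.1 p.2 ≠ 0}.Finite

@[simp] lemma filling_nil (r c : ℕ) : filling [] r c = 0 := by simp [filling]

@[simp] lemma filling_cons_zero (C : List ℕ) (Cs : List (List ℕ)) (r : ℕ) :
    filling (C :: Cs) r 0 = C.getD r 0 := by simp [filling]

@[simp] lemma filling_cons_succ (C : List ℕ) (Cs : List (List ℕ)) (r c : ℕ) :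
    filling (C :: Cs) r (c + 1) = filling Cs r c := by simp [filling]

lemma filling_zero_eq_headD (Cs : List (List ℕ)) (r : ℕ) :
    filling Cs r 0 = (Cs.headD []).getD r 0 := by
  cases Cs <;> simp

lemma getD_ne_zero_iff {C : List ℕ} (h : ∀ a ∈ C, 0 < a) (r : ℕ) :
    C.getD r 0 ≠ 0 ↔ r < C.length := by
  constructor
  · intro h'
    by_contra hr
    exact h' (List.getD_eq_default _ _ (not_lt.1 hr))
  · intro hr
    rw [List.getD_eq_getElem _ _ hr]
    exact (h _ (List.getElem_mem hr)).ne'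

lemma IsTab.filling_ne_zero_iff {Cs : List (List ℕ)} (h : IsTab Cs) (r c : ℕ) :
    filling Cs r c ≠ 0 ↔ r < colLen Cs c := by
  induction Cs generalizing c with
  | nil => simp
  | cons C Cs ih =>
    cases c with
    | zero => simpa using getD_ne_zero_iff h.1.2.2 r
    | succ c => simpa using ih h.2.2 c

lemma rowLE_getD {C D : List ℕ} (h : RowLE C D) {r : ℕ} (hr : r < D.length) :
    r < C.length ∧ C.getD r 0 ≤ D.getD r 0 := by
  induction C generalizing D r with
  | nil => cases D <;> simp_all [RowLE]
  | cons a C ih =>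
    cases D with
    | nil => simp at hr
    | cons d D =>
      cases r with
      | zero => simpa using h.1
      | succ r => simpa using ih h.2 (by simpa using hr)

lemma rowLE_of_getD {C D : List ℕ} (h : ∀ r < D.length, r < C.length ∧ C.getD r 0 ≤ D.getD r 0) :
    RowLE C D := by
  induction C generalizing D with
  | nil =>
    cases D with
    | nil => simp
    | cons d D => simpa using h 0
  | cons a C ih =>
    cases D with
    | nil => simp
    | cons d D =>
      refine ⟨by simpa using h 0, ih fun r hr => ?_⟩
      simpa using h (r + 1) (by simpa using hr)

lemma IsTab.isColumnStrict {Cs : List (List ℕ)} (h : IsTab Cs) :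
    IsColumnStrict (filling Cs) := by
  induction Cs with
  | nil => exact ⟨by simp, by simp, by simp⟩
  | cons C Cs ih =>
    obtain ⟨⟨hne, hC, hpos⟩, hR, hT⟩ := h
    have ih := ih hT
    refine ⟨?_, ?_, ?_⟩
    · intro r c hrc
      cases c with
      | zero =>
        simp only [filling_cons_zero, getD_ne_zero_iff hpos] at hrc ⊢
        refine ⟨by omega, ?_⟩
        rw [List.getD_eq_getElem _ _ hrc, List.getD_eq_getElem _ _ (by omega)]
        exact List.pairwise_iff_getElem.1 hC _ _ _ _ (by omega)
      | succ c => simpa using ih.col r c (by simpa using hrc)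
    · intro r c hrc
      cases c with
      | zero =>
        have h1 : r < (Cs.headD []).length := by
          simpa [hT.filling_ne_zero_iff, colLen_zero_eq_headD] using hrc
        have h2 := rowLE_getD hR h1
        rw [filling_cons_zero, getD_ne_zero_iff hpos, filling_cons_succ, filling_zero_eq_headD]
        exact h2
      | succ c => simpa using ih.row r c (by simpa using hrc)
    · refine ((Set.finite_lt_nat C.length).image (fun r => (r, 0)) |>.union
        (ih.finite.image fun p => (p.1, p.2 + 1))).subset ?_
      rintro ⟨r, c⟩ hrc
      cases c with
      | zero =>
        left
        have hrc' : C.getD r 0 ≠ 0 := by simpa using hrc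
        exact ⟨r, (getD_ne_zero_iff hpos r).1 hrc', rfl⟩
      | succ c =>
        right
        exact ⟨(r, c), by simpa using hrc, rfl⟩

lemma filling_injOn {Cs Ds : List (List ℕ)} (hC : IsTab Cs) (hD : IsTab Ds)
    (h : ∀ r c, filling Cs r c = filling Ds r c) : Cs = Ds := by
  induction Cs generalizing Ds with
  | nil =>
    cases Ds with
    | nil => rfl
    | cons D Ds =>
      have h1 := (hD.filling_ne_zero_iff 0 0).2 (by
        simpa [List.length_pos_iff] using hD.1.1)
      exact (h1 (by simp [← h])).elim
  | cons C Cs ih =>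
    cases Ds with
    | nil =>
      have h1 := (hC.filling_ne_zero_iff 0 0).2 (by
        simpa [List.length_pos_iff] using hC.1.1)
      exact (h1 (by simp [h])).elim
    | cons D Ds =>
      have h1 : ∀ r, C.getD r 0 = D.getD r 0 := fun r => by simpa using h r 0
      have h2 : ∀ r, r < C.length ↔ r < D.length := fun r => by
        rw [← getD_ne_zero_iff hC.1.2.2, ← getD_ne_zero_iff hD.1.2.2, h1]
      have h3 : C.length = D.length := by
        have := h2 C.length
        have := h2 D.length
        omega
      have h4 : C = D := List.ext_getElem h3 fun r hr hr' => by
        have := h1 r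
        rwa [List.getD_eq_getElem _ _ hr, List.getD_eq_getElem _ _ hr'] at this
      rw [h4, ih hC.2.2 hD.2.2 fun r c => by simpa using h r (c + 1)]

lemma IsColumnStrict.ne_zero_of_le_row {T : ℕ → ℕ → ℕ} (h : IsColumnStrict T) {r r' c : ℕ}
    (hr : r ≤ r') (h' : T r' c ≠ 0) : T r c ≠ 0 := by
  induction r', hr using Nat.le_induction with
  | base => exact h'
  | succ k _ ih => exact ih (h.col k c h').1

lemma IsColumnStrict.ne_zero_of_le_col {T : ℕ → ℕ → ℕ} (h : IsColumnStrict T) {r c c' : ℕ}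
    (hc : c ≤ c') (h' : T r c' ≠ 0) : T r c ≠ 0 := by
  induction c', hc using Nat.le_induction with
  | base => exact h'
  | succ k _ ih => exact ih (h.row r k h').1

lemma IsColumnStrict.lt_of_lt_row {T : ℕ → ℕ → ℕ} (h : IsColumnStrict T) {r r' c : ℕ}
    (hr : r < r') (h' : T r' c ≠ 0) : T r c < T r' c := by
  induction r', (show r + 1 ≤ r' from hr) using Nat.le_induction with
  | base => exact (h.col r c h').2
  | succ k hk ih => exact (ih hk (h.col k c h').1).trans (h.col k c h').2

lemma IsColumnStrict.le_of_le_col {T : ℕ → ℕ → ℕ} (h : IsColumnStrict T) {r c c' : ℕ}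
    (hc : c ≤ c') (h' : T r c' ≠ 0) : T r c ≤ T r c' := by
  induction c', hc using Nat.le_induction with
  | base => exact le_rfl
  | succ k _ ih => exact (ih (h.row r k h').1).trans (h.row r k h').2

/-- Every column strict filling comes from a list of columns. -/
lemma IsColumnStrict.exists_isTab {T : ℕ → ℕ → ℕ} (h : IsColumnStrict T) :
    ∃ Cs, IsTab Cs ∧ filling Cs = T := by
  obtain ⟨w, hw⟩ : ∃ w, ∀ r c, w ≤ c → T r c = 0 := by
    obtain ⟨w, hw⟩ := (h.finite.image Prod.snd).bddAbove
    refine ⟨w + 1, fun r c hc => ?_⟩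
    by_contra hne
    have : c ≤ w := hw ⟨(r, c), hne, rfl⟩
    omega
  induction w generalizing T with
  | zero => exact ⟨[], trivial, by funext r c; simp [hw]⟩
  | succ w ih =>
    by_cases h0 : T 0 0 = 0
    · refine ⟨[], trivial, ?_⟩
      funext r c
      rw [filling_nil]
      by_contra hne
      exact h.ne_zero_of_le_row (Nat.zero_le r) (h.ne_zero_of_le_col (Nat.zero_le c) (Ne.symm hne))
        h0
    have h' : IsColumnStrict fun r c => T r (c + 1) := by
      refine ⟨fun r c => h.col r (c + 1), fun r c => h.row r (c + 1), ?_⟩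
      refine (h.finite.preimage (f := fun p : ℕ × ℕ => (p.1, p.2 + 1)) ?_)
      rintro ⟨a, b⟩ - ⟨c, d⟩ - heq
      simpa using heq
    obtain ⟨Cs, hCs, hT⟩ := ih h' fun r c hc => hw r (c + 1) (by omega)
    obtain ⟨m, hm⟩ : ∃ m, ∀ r, T r 0 ≠ 0 ↔ r < m := by
      have hex : ∃ r, T r 0 = 0 := by
        obtain ⟨m, hm⟩ := (h.finite.image Prod.fst).bddAbove
        refine ⟨m + 1, ?_⟩
        by_contra hne
        have : m + 1 ≤ m := hm ⟨(m + 1, 0), hne, rfl⟩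
        omega
      classical
      refine ⟨Nat.find hex, fun r => ⟨fun hr => ?_, fun hr => Nat.find_min hex hr⟩⟩
      by_contra hlt
      exact h.ne_zero_of_le_row (not_lt.1 hlt) hr (Nat.find_spec hex)
    set C := (List.range m).map fun r => T r 0 with hCdef
    have hgetD : ∀ r, C.getD r 0 = T r 0 := by
      intro r
      by_cases hr : r < m
      · rw [List.getD_eq_getElem _ _ (by simpa [C] using hr)]
        simp [C]
      · rw [List.getD_eq_default _ _ (by simpa [C] using hr)]
        by_contra hne
        exact hr ((hm r).1 (Ne.symm hne))
    have hlen : C.length = m := by simp [C]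
    refine ⟨C :: Cs, ⟨⟨?_, ?_, ?_⟩, ?_, hCs⟩, ?_⟩
    · rw [← List.length_pos_iff, hlen]
      exact (hm 0).1 h0
    · rw [List.pairwise_iff_getElem]
      intro i j hi hj hij
      simp only [C, List.getElem_map, List.getElem_range]
      exact h.lt_of_lt_row hij ((hm j).2 (hlen ▸ hj))
    · simp only [C, List.mem_map, List.mem_range]
      rintro _ ⟨r, hr, rfl⟩
      exact Nat.pos_of_ne_zero ((hm r).2 hr)
    · refine rowLE_of_getD fun r hr => ?_
      rw [hgetD, ← filling_zero_eq_headD, hT, hlen, ← hm]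
      refine h.row r 0 ?_
      rw [← colLen_zero_eq_headD, ← hCs.filling_ne_zero_iff, hT] at hr
      exact hr
    · funext r c
      cases c with
      | zero => simpa using hgetD r
      | succ c => rw [filling_cons_succ, hT]

/-! ### The RSK correspondence for words -/

/-- The order of the columns `(i, j)` of a two-line array. -/
def ArrayLE (a b : ℕ × ℕ) : Prop := a.1 < b.1 ∨ a.1 = b.1 ∧ b.2 ≤ a.2

/-- A two-line array: a weakly ordered list of pairs of positive integers. -/
def IsArray (w : List (ℕ × ℕ)) : Prop :=
  w.Pairwise ArrayLE ∧ ∀ a ∈ w, 0 < a.1 ∧ 0 < a.2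

/-- A pair of column strict tableaux of the same shape, the first one as a list of columns and the
second one as a filling. -/
structure IsTabPair (P : List (List ℕ)) (Q : ℕ → ℕ → ℕ) : Prop where
  tab : IsTab P
  strict : IsColumnStrict Q
  shape : ∀ r c, Q r c ≠ 0 ↔ r < colLen P c

/-- The box of a filling that RSK has added last: the rightmost one among those with the largest
entry. -/
def IsLastBox (Q : ℕ → ℕ → ℕ) (r c : ℕ) : Prop :=
  Q r c ≠ 0 ∧ ∀ r' c', Q r' c' < Q r c ∨ (Q r' c' = Q r c ∧ c' ≤ c)

/-- The filling `Q` with the entry in row `r₀` and column `c₀` replaced by `i`. -/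
def setBox (Q : ℕ → ℕ → ℕ) (r₀ c₀ i : ℕ) : ℕ → ℕ → ℕ :=
  fun r c => if r = r₀ ∧ c = c₀ then i else Q r c

lemma setBox_zero_ne_zero {Q : ℕ → ℕ → ℕ} {r₀ c₀ r c : ℕ} :
    setBox Q r₀ c₀ 0 r c ≠ 0 ↔ ¬ (r = r₀ ∧ c = c₀) ∧ Q r c ≠ 0 := by
  simp only [setBox]
  split_ifs with h <;> simp [h]

lemma IsLastBox.unique {Q : ℕ → ℕ → ℕ} (hQ : IsColumnStrict Q) {r c r' c' : ℕ}
    (h : IsLastBox Q r c) (h' : IsLastBox Q r' c') : r = r' ∧ c = c' := by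
  have h1 := h.2 r' c'
  have h2 := h'.2 r c
  have hc : c = c' := by omega
  subst hc
  refine ⟨?_, rfl⟩
  by_contra hne
  rcases lt_or_gt_of_ne hne with h3 | h3
  · have := hQ.lt_of_lt_row h3 h'.1
    omega
  · have := hQ.lt_of_lt_row h3 h.1
    omega

lemma IsColumnStrict.exists_isLastBox {Q : ℕ → ℕ → ℕ} (hQ : IsColumnStrict Q)
    (h : ∃ r c, Q r c ≠ 0) : ∃ r c, IsLastBox Q r c := by
  obtain ⟨r, c, hrc⟩ := h
  obtain ⟨p, hp, hmax⟩ := Set.exists_max_image _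
    (fun p : ℕ × ℕ => toLex (Q p.1 p.2, p.2)) hQ.finite ⟨(r, c), hrc⟩
  refine ⟨p.1, p.2, hp, fun r' c' => ?_⟩
  by_cases h0 : Q r' c' = 0
  · left
    rw [h0]
    exact Nat.pos_of_ne_zero hp
  · simpa [Prod.Lex.toLex_le_toLex] using hmax (r', c') h0

lemma filling_new_box_iff {P : List (List ℕ)} (hP : IsTab P) {x : ℕ} (hx : 0 < x) (r c : ℕ) :
    (filling P r c = 0 ∧ filling (insertTableau x P) r c ≠ 0) ↔
      (r = colLen P (newColumn x P) ∧ c = newColumn x P) := by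
  have h1 := hP.filling_ne_zero_iff r c
  rw [(hP.insertTableau hx).filling_ne_zero_iff, colLen_insertTableau]
  split_ifs with hc
  · subst hc
    omega
  · simp only [hc, and_false, iff_false]
    omega

lemma rskSteps_concat (w : List (ℕ × ℕ)) (a : ℕ × ℕ) (hP : IsTab (rskSteps w).1) (ha : 0 < a.2) :
    rskSteps (w ++ [a]) = (insertTableau a.2 (rskSteps w).1,
      setBox (rskSteps w).2 (colLen (rskSteps w).1 (newColumn a.2 (rskSteps w).1))
        (newColumn a.2 (rskSteps w).1) a.1) := by
  have h : rskSteps (w ++ [a]) = (insertTableau a.2 (rskSteps w).1, fun r c =>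
      if filling (rskSteps w).1 r c = 0 ∧ filling (insertTableau a.2 (rskSteps w).1) r c ≠ 0
      then a.1 else (rskSteps w).2 r c) := by
    rw [rskSteps, List.foldl_append]
    rfl
  rw [h]
  simp only [filling_new_box_iff hP ha]
  rfl

/-- One step of RSK keeps the pair of tableaux valid, if the new entry of `Q` is at least as large
as the old ones, and the new box is strictly to the right of those with the same entry. -/
lemma IsTabPair.insert {P : List (List ℕ)} {Q : ℕ → ℕ → ℕ} (h : IsTabPair P Q) {i x : ℕ}
    (hi : 0 < i) (hx : 0 < x) (hQ : ∀ r c, Q r c ≤ i)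
    (hQ' : ∀ r c, Q r c = i → c < newColumn x P) :
    IsTabPair (insertTableau x P) (setBox Q (colLen P (newColumn x P)) (newColumn x P) i) ∧
      IsLastBox (setBox Q (colLen P (newColumn x P)) (newColumn x P) i)
        (colLen P (newColumn x P)) (newColumn x P) := by
  have hins := h.tab.insertTableau hx
  have hlen := colLen_insertTableau (x := x) (Cs := P)
  set c₀ := newColumn x P
  set r₀ := colLen P c₀ with hr₀
  have hbox : ∀ r c, Q r c ≠ 0 → ¬ (r = r₀ ∧ c = c₀) := by
    rintro r c hrc ⟨rfl, rfl⟩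
    exact absurd ((h.shape _ _).1 hrc) (lt_irrefl _)
  refine ⟨⟨hins, ⟨fun r c hrc => ?_, fun r c hrc => ?_, ?_⟩, fun r c => ?_⟩, ?_, fun r c => ?_⟩
  · by_cases hb : r + 1 = r₀ ∧ c = c₀
    · obtain ⟨hr, rfl⟩ := hb
      have hne : Q r c₀ ≠ 0 := (h.shape _ _).2 (by omega)
      have h2 : Q r c₀ ≠ i := fun he => lt_irrefl _ (hQ' r c₀ he)
      have h3 := hQ r c₀
      have h4 : setBox Q r₀ c₀ i r c₀ = Q r c₀ := if_neg (hbox r c₀ hne)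
      have h5 : setBox Q r₀ c₀ i (r + 1) c₀ = i := if_pos ⟨hr, rfl⟩
      rw [h4, h5]
      omega
    · simp only [setBox, hb, if_false] at hrc ⊢
      have h2 := h.strict.col r c hrc
      rw [if_neg (hbox r c h2.1)]
      exact h2
  · by_cases hb : r = r₀ ∧ c + 1 = c₀
    · have hne : Q r c ≠ 0 := by
        rw [h.shape]
        have h1 : filling (insertTableau x P) r (c + 1) ≠ 0 := by
          rw [hins.filling_ne_zero_iff, hlen, if_pos hb.2, hb.2, hb.1]
          omega
        have h2 := (hins.isColumnStrict.row r c h1).1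
        rw [hins.filling_ne_zero_iff, hlen, if_neg (by omega)] at h2
        exact h2
      have h3 := hQ r c
      have h4 : setBox Q r₀ c₀ i r c = Q r c := if_neg (hbox r c hne)
      have h5 : setBox Q r₀ c₀ i r (c + 1) = i := if_pos hb
      rw [h4, h5]
      exact ⟨hne, h3⟩
    · simp only [setBox, hb, if_false] at hrc ⊢
      have h2 := h.strict.row r c hrc
      rw [if_neg (hbox r c h2.1)]
      exact h2
  · refine (h.strict.finite.insert (r₀, c₀)).subset ?_
    rintro ⟨r, c⟩ hrc
    by_cases hb : r = r₀ ∧ c = c₀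
    · left
      exact Prod.ext hb.1 hb.2
    · right
      simpa [setBox, hb] using hrc
  · rw [hlen]
    by_cases hb : r = r₀ ∧ c = c₀
    · obtain ⟨rfl, rfl⟩ := hb
      simp [setBox]
      omega
    · have := h.shape r c
      simp only [setBox, hb, if_false]
      split_ifs with hc
      · subst hc
        omega
      · simpa using this
  · simp [setBox]; omega
  · simp only [setBox, and_self, if_true]
    split_ifs with hb
    · exact Or.inr ⟨rfl, hb.2.le⟩
    · rcases (hQ r c).lt_or_eq with h1 | h1
      · exact Or.inl h1
      · exact Or.inr ⟨h1, (hQ' r c h1).le⟩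

/-- The last box of `Q` is a corner, and removing it (with the reverse insertion in `P`) leaves a
valid pair. -/
lemma IsTabPair.extract {P : List (List ℕ)} {Q : ℕ → ℕ → ℕ} (h : IsTabPair P Q) {r c : ℕ}
    (hrc : IsLastBox Q r c) :
    ∃ x P', 0 < x ∧ IsTabPair P' (setBox Q r c 0) ∧ insertTableau x P' = P ∧
      newColumn x P' = c ∧ colLen P' c = r := by
  have hr : r < colLen P c := (h.shape r c).1 hrc.1
  have hr' : colLen P c = r + 1 := by
    by_contra hne
    have h1 : Q (r + 1) c ≠ 0 := (h.shape _ _).2 (by omega)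
    have h2 := h.strict.col r c h1
    have h3 := hrc.2 (r + 1) c
    omega
  have hcorner : colLen P (c + 1) < colLen P c := by
    by_contra hle
    have h1 : Q r (c + 1) ≠ 0 := (h.shape _ _).2 (by omega)
    have h2 := h.strict.row r c h1
    have h3 := hrc.2 r (c + 1)
    omega
  obtain ⟨h1, h2, h3, h4⟩ := insertTableau_extractTableau h.tab hcorner
  set x := (extractTableau c P).1
  set P' := (extractTableau c P).2
  have hlen := colLen_insertTableau (x := x) (Cs := P')
  rw [h3, h4] at hlen
  have hc' : colLen P' c = r := by
    have := hlen c
    simp at this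
    omega
  refine ⟨x, P', h2, ⟨h1, ⟨fun a b hab => ?_, fun a b hab => ?_, ?_⟩, fun a b => ?_⟩, h3, h4, hc'⟩
  · rw [setBox_zero_ne_zero] at hab
    simp only [setBox]
    have h5 := h.strict.col a b hab.2
    have h6 : ¬ (a = r ∧ b = c) := by
      rintro ⟨rfl, rfl⟩
      have := (h.shape _ _).1 hab.2
      omega
    rw [if_neg hab.1, if_neg h6]
    exact h5
  · rw [setBox_zero_ne_zero] at hab
    simp only [setBox]
    have h5 := h.strict.row a b hab.2
    have h6 : ¬ (a = r ∧ b = c) := by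
      rintro ⟨rfl, rfl⟩
      have := (h.shape _ _).1 hab.2
      omega
    rw [if_neg hab.1, if_neg h6]
    exact h5
  · refine h.strict.finite.subset ?_
    rintro ⟨a, b⟩ hab
    exact (setBox_zero_ne_zero.1 hab).2
  · rw [setBox_zero_ne_zero, h.shape]
    have := hlen b
    by_cases hb : b = c
    · subst hb
      simp at this
      omega
    · simp only [hb, if_false] at this
      rw [this]
      simp [hb]

lemma setBox_setBox (Q : ℕ → ℕ → ℕ) (r c i : ℕ) :
    setBox (setBox Q r c i) r c (Q r c) = Q := by
  funext a b
  simp only [setBox]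
  split_ifs with h
  · rw [h.1, h.2]
  · rfl

lemma isTabPair_nil : IsTabPair [] fun _ _ => 0 :=
  ⟨trivial, ⟨by simp, by simp, by simp⟩, by simp⟩

lemma isArray_concat {w : List (ℕ × ℕ)} {a : ℕ × ℕ} (h : IsArray (w ++ [a])) :
    IsArray w ∧ (∀ b ∈ w, ArrayLE b a) ∧ 0 < a.1 ∧ 0 < a.2 := by
  obtain ⟨h1, h2⟩ := h
  rw [List.pairwise_append] at h1
  exact ⟨⟨h1.1, fun b hb => h2 b (by simp [hb])⟩, fun b hb => h1.2.2 b hb a (by simp),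
    h2 a (by simp)⟩

lemma isTab_rskSteps {w : List (ℕ × ℕ)} (hw : ∀ a ∈ w, 0 < a.2) : IsTab (rskSteps w).1 := by
  induction w using List.reverseRecOn with
  | nil => trivial
  | append_singleton w a ih =>
    have h1 := ih fun b hb => hw b (by simp [hb])
    have ha := hw a (by simp)
    rw [rskSteps_concat w a h1 ha]
    exact h1.insertTableau ha

/-- The two tableaux produced by RSK are valid, and the last box of `Q` is the one added last. -/
theorem rskSteps_valid {w : List (ℕ × ℕ)} (hw : IsArray w) :
    IsTabPair (rskSteps w).1 (rskSteps w).2 ∧ ∀ w' a, w = w' ++ [a] →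
      IsLastBox (rskSteps w).2 (colLen (rskSteps w').1 (newColumn a.2 (rskSteps w').1))
        (newColumn a.2 (rskSteps w').1) ∧
      (rskSteps w).2 (colLen (rskSteps w').1 (newColumn a.2 (rskSteps w').1))
        (newColumn a.2 (rskSteps w').1) = a.1 := by
  induction w using List.reverseRecOn with
  | nil => exact ⟨isTabPair_nil, by simp⟩
  | append_singleton w a ih =>
    obtain ⟨hw', hle, ha1, ha2⟩ := isArray_concat hw
    obtain ⟨hpair, hlast⟩ := ih hw'
    have hstep : (∀ r c, (rskSteps w).2 r c ≤ a.1) ∧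
        ∀ r c, (rskSteps w).2 r c = a.1 → c < newColumn a.2 (rskSteps w).1 := by
      rcases List.eq_nil_or_concat w with rfl | ⟨v, b, hvb⟩
      · refine ⟨fun r c => Nat.zero_le _, fun r c h0 => ?_⟩
        have : 0 = a.1 := h0
        omega
      · rw [List.concat_eq_append] at hvb
        subst hvb
        obtain ⟨h1, h2⟩ := hlast v b rfl
        obtain ⟨hv, -, hb1, hb2⟩ := isArray_concat hw'
        have hPv := isTab_rskSteps fun c hc => (hv.2 c hc).2
        have h3 := hle b (by simp)
        have h4 : ∀ r c, (rskSteps (v ++ [b])).2 r c < b.1 ∨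
            ((rskSteps (v ++ [b])).2 r c = b.1 ∧ c ≤ newColumn b.2 (rskSteps v).1) := by
          intro r c
          have := h1.2 r c
          rwa [h2] at this
        refine ⟨fun r c => ?_, fun r c hrc => ?_⟩
        · have := h4 r c
          rcases h3 with h3 | h3 <;> omega
        · have h5 := h4 r c
          rcases h3 with h3 | h3
          · omega
          · have h6 := newColumn_lt hPv h3.2
            rw [rskSteps_concat v b hPv hb2]
            simp only
            omega
    rw [rskSteps_concat w a hpair.tab ha2]
    obtain ⟨h1, h2⟩ := hpair.insert ha1 ha2 hstep.1 hstep.2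
    refine ⟨h1, fun w' a' heq => ?_⟩
    obtain ⟨rfl, h3⟩ := List.append_inj' heq rfl
    obtain rfl : a = a' := by simpa using h3
    exact ⟨h2, by simp [setBox]⟩

lemma insertTableau_ne_nil (x : ℕ) (P : List (List ℕ)) : insertTableau x P ≠ [] := by
  intro h
  have := perm_flatten_insertTableau x P
  simp [h] at this

/-- The last letter of the word is recovered from the last box of the recording tableau, by reverse
insertion. -/
theorem rskSteps_injective {w v : List (ℕ × ℕ)} (hw : IsArray w) (hv : IsArray v)
    (h : rskSteps w = rskSteps v) : w = v := by
  induction w using List.reverseRecOn generalizing v with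
  | nil =>
    rcases List.eq_nil_or_concat v with rfl | ⟨v', b, rfl⟩
    · rfl
    · rw [List.concat_eq_append] at h hv
      obtain ⟨hv', -, hb⟩ := isArray_concat hv
      rw [rskSteps_concat v' b (rskSteps_valid hv').1.tab hb.2] at h
      exact (insertTableau_ne_nil _ _ (congrArg Prod.fst h).symm).elim
  | append_singleton w a ih =>
    obtain ⟨hw', -, ha⟩ := isArray_concat hw
    have hPw := (rskSteps_valid hw').1
    rcases List.eq_nil_or_concat v with rfl | ⟨v, b, rfl⟩
    · rw [rskSteps_concat w a hPw.tab ha.2] at h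
      exact (insertTableau_ne_nil _ _ (congrArg Prod.fst h)).elim
    · rw [List.concat_eq_append] at h hv ⊢
      obtain ⟨hv', -, hb⟩ := isArray_concat hv
      have hPv := (rskSteps_valid hv').1
      have hvalid := rskSteps_valid hw
      obtain ⟨h1, h2⟩ := hvalid.2 w a rfl
      obtain ⟨h3, h4⟩ := (rskSteps_valid hv).2 v b rfl
      rw [← h] at h3 h4
      obtain ⟨hr, hc⟩ := h1.unique hvalid.1.strict h3
      have hab : a.1 = b.1 := by rw [← h2, ← h4, hr, hc]
      have hsplit := h
      rw [rskSteps_concat w a hPw.tab ha.2, rskSteps_concat v b hPv.tab hb.2,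
        Prod.mk.injEq] at hsplit
      have e1 := extractTableau_insertTableau (x := a.2) hPw.tab
      have e2 := extractTableau_insertTableau (x := b.2) hPv.tab
      rw [hsplit.1, hc, e2, Prod.mk.injEq] at e1
      have hQ : (rskSteps w).2 = (rskSteps v).2 := by
        funext r c
        have h5 := congrFun (congrFun hsplit.2 r) c
        rw [← hr, ← hc] at h5
        by_cases hb : r = colLen (rskSteps w).1 (newColumn a.2 (rskSteps w).1) ∧
          c = newColumn a.2 (rskSteps w).1
        · have h6 : (rskSteps w).2 r c = 0 := by
            by_contra hne
            have := (hPw.shape r c).1 hne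
            rw [hb.1, hb.2] at this
            exact lt_irrefl _ this
          have h7 : (rskSteps v).2 r c = 0 := by
            by_contra hne
            have := (hPv.shape r c).1 hne
            rw [hb.1, hb.2, e1.2] at this
            exact lt_irrefl _ this
          rw [h6, h7]
        · simpa only [setBox, hb, if_false] using h5
      rw [ih hw' hv' (Prod.ext e1.2.symm hQ), Prod.ext hab e1.1.symm]

/-- Every pair of tableaux of the same shape comes from a two-line array: remove the last box of the
second tableau, and eject the corresponding entry from the first one. -/
theorem rskSteps_surjective {P : List (List ℕ)} {Q : ℕ → ℕ → ℕ} (h : IsTabPair P Q) :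
    ∃ w, IsArray w ∧ rskSteps w = (P, Q) := by
  induction hN : P.flatten.length generalizing P Q with
  | zero =>
    have hP : P = [] := by
      cases P with
      | nil => rfl
      | cons C P =>
        simp at hN
        exact (h.tab.1.1 hN.1).elim
    subst hP
    refine ⟨[], ⟨List.Pairwise.nil, by simp⟩, ?_⟩
    have hQ : (fun _ _ => 0) = Q := by
      funext r c
      by_contra hne
      simpa using (h.shape r c).1 (Ne.symm hne)
    rw [← hQ]
    rfl
  | succ N ih =>
    have hne : ∃ r c, Q r c ≠ 0 := by
      cases P with
      | nil => simp at hN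
      | cons C P =>
        refine ⟨0, 0, (h.shape 0 0).2 ?_⟩
        simpa [List.length_pos_iff] using h.tab.1.1
    obtain ⟨r, c, hrc⟩ := h.strict.exists_isLastBox hne
    obtain ⟨x, P', hx, h', rfl, rfl, hr⟩ := h.extract hrc
    have hlen := (perm_flatten_insertTableau x P').length_eq
    obtain ⟨w, hw, hwP⟩ := ih h' (by simpa [hN] using hlen.symm)
    have hP' : (rskSteps w).1 = P' := by rw [hwP]
    have hQ' : (rskSteps w).2 = setBox Q r (newColumn x P') 0 := by rw [hwP]
    refine ⟨w ++ [(Q r (newColumn x P'), x)], ⟨?_, ?_⟩, ?_⟩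
    · rw [List.pairwise_append]
      refine ⟨hw.1, by simp, ?_⟩
      -- It suffices to compare with the last letter of `w`.
      rcases List.eq_nil_or_concat w with rfl | ⟨v, b, hvb⟩
      · simp
      rw [List.concat_eq_append] at hvb
      subst hvb
      obtain ⟨hv, hle, hb1, hb2⟩ := isArray_concat hw
      suffices hlast : ArrayLE b (Q r (newColumn x P'), x) by
        intro a ha a' ha'
        obtain rfl : a' = _ := by simpa using ha'
        rcases List.mem_append.1 ha with ha | ha
        · have := hle a ha
          unfold ArrayLE at this hlast ⊢
          omega
        · obtain rfl : a = b := by simpa using ha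
          exact hlast
      obtain ⟨h1, h2⟩ := (rskSteps_valid hw).2 v b rfl
      have hPv := (rskSteps_valid hv).1
      rw [hQ'] at h1 h2
      have h3 := hrc.2 (colLen (rskSteps v).1 (newColumn b.2 (rskSteps v).1))
        (newColumn b.2 (rskSteps v).1)
      have h4 := setBox_zero_ne_zero.1 h1.1
      simp only [setBox, h4.1, if_false] at h2
      rw [h2] at h3
      rcases h3 with h3 | h3
      · exact Or.inl h3
      · refine Or.inr ⟨h3.1, ?_⟩
        by_contra hlt
        -- otherwise the box of `x` is weakly to the left of that of `b`, hence in the same column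
        have h5 := newColumn_le hPv.tab (not_le.1 hlt)
        have h6 : (insertTableau b.2 (rskSteps v).1) = P' := by
          rw [← hP', rskSteps_concat v b hPv.tab hb2]
        simp only [h6] at h5
        have h7 : newColumn x P' = newColumn b.2 (rskSteps v).1 := by omega
        rw [← h7] at h2 h4
        refine h4.1 ⟨?_, rfl⟩
        by_contra hne
        rcases lt_or_gt_of_ne hne with h8 | h8
        · have := h.strict.lt_of_lt_row h8 hrc.1
          omega
        · have := h.strict.lt_of_lt_row h8 h4.2
          omega
    · intro a ha
      rcases List.mem_append.1 ha with ha | ha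
      · exact hw.2 a ha
      · obtain rfl : a = _ := by simpa using ha
        exact ⟨Nat.pos_of_ne_zero hrc.1, hx⟩
    · rw [rskSteps_concat w _ (by rw [hP']; exact h'.tab) hx, hP', hQ', hr, setBox_setBox]

lemma perm_flatten_rskSteps (w : List (ℕ × ℕ)) :
    (rskSteps w).1.flatten.Perm (w.map Prod.snd) := by
  induction w using List.reverseRecOn with
  | nil => exact List.Perm.nil
  | append_singleton w a ih =>
    have h : (rskSteps (w ++ [a])).1 = insertTableau a.2 (rskSteps w).1 := by
      rw [rskSteps, List.foldl_append]
      rfl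
    rw [h, List.map_append]
    refine (perm_flatten_insertTableau _ _).trans ((ih.cons _).trans ?_)
    exact (List.perm_append_singleton _ _).symm

/-- The number of entries equal to `k` in the first tableau. -/
lemma ncard_filling {P : List (List ℕ)} {k : ℕ} (hk : k ≠ 0) :
    {p : ℕ × ℕ | filling P p.1 p.2 = k}.Finite ∧
      {p : ℕ × ℕ | filling P p.1 p.2 = k}.ncard = P.flatten.count k := by
  have hcol : ∀ C : List ℕ, {r | C.getD r 0 = k}.Finite ∧
      {r | C.getD r 0 = k}.ncard = C.count k := by
    intro C
    induction C with
    | nil => simp [hk.symm]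
    | cons a C ih =>
      have hset : {r | (a :: C).getD r 0 = k} =
          (if a = k then {0} else ∅) ∪ Nat.succ '' {r | C.getD r 0 = k} := by
        ext r
        cases r with
        | zero => by_cases h : a = k <;> simp [h]
        | succ r => by_cases h : a = k <;> simp [h]
      have hfin := ih.1.image Nat.succ
      rw [hset]
      refine ⟨(by split_ifs <;> simp : Set.Finite _).union hfin, ?_⟩
      rw [Set.ncard_union_eq _ (by split_ifs <;> simp) hfin,
        Set.ncard_image_of_injective _ Nat.succ_injective, ih.2, List.count_cons]
      · by_cases h : a = k <;> simp [h, add_comm]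
      · by_cases h : a = k <;> simp [h]
  induction P with
  | nil => simp [hk.symm]
  | cons C P ih =>
    have hset : {p : ℕ × ℕ | filling (C :: P) p.1 p.2 = k} =
        (fun r => (r, 0)) '' {r | C.getD r 0 = k} ∪
          (fun p : ℕ × ℕ => (p.1, p.2 + 1)) '' {p | filling P p.1 p.2 = k} := by
      ext ⟨r, c⟩
      cases c with
      | zero => simp
      | succ c => simp
    have h1 := (hcol C).1.image fun r => (r, 0)
    have h2 := ih.1.image fun p : ℕ × ℕ => (p.1, p.2 + 1)
    rw [hset]
    refine ⟨h1.union h2, ?_⟩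
    rw [Set.ncard_union_eq _ h1 h2, Set.ncard_image_of_injective, Set.ncard_image_of_injective,
      (hcol C).2, ih.2, List.flatten_cons, List.count_append]
    · rintro ⟨a, b⟩ ⟨c, d⟩ h
      simpa using h
    · intro a b h
      simpa using h
    · rw [Set.disjoint_left]
      rintro _ ⟨r, -, rfl⟩ ⟨p, -, h⟩
      simp at h

/-- The number of entries equal to `k` in the recording tableau. -/
lemma ncard_rskSteps_snd {w : List (ℕ × ℕ)} (hw : IsArray w) {k : ℕ} (hk : k ≠ 0) :
    {p : ℕ × ℕ | (rskSteps w).2 p.1 p.2 = k}.Finite ∧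
      {p : ℕ × ℕ | (rskSteps w).2 p.1 p.2 = k}.ncard = (w.map Prod.fst).count k := by
  induction w using List.reverseRecOn with
  | nil => simp [rskSteps, hk.symm]
  | append_singleton w a ih =>
    obtain ⟨hw', -, ha⟩ := isArray_concat hw
    have hP := (rskSteps_valid hw').1
    obtain ⟨h1, h2⟩ := ih hw'
    rw [rskSteps_concat w a hP.tab ha.2]
    set c₀ := newColumn a.2 (rskSteps w).1
    set r₀ := colLen (rskSteps w).1 c₀ with hr₀
    have hbox : ∀ r c, (rskSteps w).2 r c ≠ 0 → ¬ (r = r₀ ∧ c = c₀) := by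
      rintro r c hrc ⟨rfl, rfl⟩
      exact absurd ((hP.shape _ _).1 hrc) (lt_irrefl _)
    have hset : {p : ℕ × ℕ | setBox (rskSteps w).2 r₀ c₀ a.1 p.1 p.2 = k} =
        (if a.1 = k then {(r₀, c₀)} else ∅) ∪ {p | (rskSteps w).2 p.1 p.2 = k} := by
      ext ⟨r, c⟩
      by_cases hb : r = r₀ ∧ c = c₀
      · have h0 : (rskSteps w).2 r c = 0 := by
          by_contra hne
          exact hbox r c hne hb
        obtain ⟨rfl, rfl⟩ := hb
        by_cases h : a.1 = k <;> simp [setBox, h, h0, hk.symm]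
      · have hQ : setBox (rskSteps w).2 r₀ c₀ a.1 r c = (rskSteps w).2 r c := if_neg hb
        simp only [Set.mem_ofPred_eq, Set.mem_union, hQ]
        by_cases h : a.1 = k <;> simp [h]
        tauto
    simp only [hset]
    refine ⟨(by split_ifs <;> simp : Set.Finite _).union h1, ?_⟩
    rw [Set.ncard_union_eq _ (by split_ifs <;> simp) h1, h2, List.map_append, List.count_append]
    · by_cases h : a.1 = k <;> simp [h, add_comm]
    · by_cases h : a.1 = k
      · simp only [h, if_true, Set.disjoint_singleton_left]
        intro h3
        have h3 : (rskSteps w).2 r₀ c₀ = k := h3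
        exact hbox r₀ c₀ (h3 ▸ hk) ⟨rfl, rfl⟩
      · simp [h]

/-! ### The RSK correspondence for matrices -/

lemma ArrayLE.antisymm {a b : ℕ × ℕ} (h : ArrayLE a b) (h' : ArrayLE b a) : a = b := by
  unfold ArrayLE at h h'
  exact Prod.ext (by omega) (by omega)

lemma isArray_twoLineArray {l : ℕ} (b : Matrix (Fin l) (Fin l) ℕ) : IsArray (twoLineArray b) := by
  refine ⟨?_, ?_⟩
  · unfold twoLineArray
    rw [List.pairwise_flatMap]
    refine ⟨fun i _ => ?_, ?_⟩
    · rw [List.pairwise_flatMap]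
      refine ⟨fun j _ => ?_, ?_⟩
      · exact List.pairwise_replicate.2 (Or.inr (Or.inr ⟨rfl, le_rfl⟩))
      · rw [List.pairwise_reverse]
        refine (List.pairwise_lt_finRange l).imp fun {j j'} hj x hx y hy => ?_
        rw [List.eq_of_mem_replicate hx, List.eq_of_mem_replicate hy]
        refine Or.inr ⟨rfl, ?_⟩
        simp only [Fin.lt_def] at hj
        simp
        omega
    · refine (List.pairwise_lt_finRange l).imp fun {i i'} hi x hx y hy => ?_
      simp only [List.mem_flatMap, List.mem_reverse, List.mem_replicate] at hx hy
      obtain ⟨j, -, -, rfl⟩ := hx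
      obtain ⟨j', -, -, rfl⟩ := hy
      left
      simp only [Fin.lt_def] at hi
      simpa using hi
  · intro a ha
    simp only [twoLineArray, List.mem_flatMap, List.mem_reverse, List.mem_replicate] at ha
    obtain ⟨i, -, j, -, -, rfl⟩ := ha
    exact ⟨Nat.succ_pos _, Nat.succ_pos _⟩

lemma count_map_twoLineArray {l : ℕ} {α : Type*} [BEq α] [LawfulBEq α]
    (b : Matrix (Fin l) (Fin l) ℕ)
    (g : ℕ × ℕ → α) (x : α) :
    ((twoLineArray b).map g).count x =
      ∑ i : Fin l, ∑ j : Fin l, if g ((i : ℕ) + 1, (j : ℕ) + 1) == x then b i j else 0 := by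
  have hsum : ∀ f : Fin l → ℕ, ((List.finRange l).map f).sum = ∑ i, f i := fun f => by
    rw [← List.ofFn_eq_map, List.sum_ofFn]
  rw [twoLineArray, List.map_flatMap, List.count_flatMap, hsum]
  refine Finset.sum_congr rfl fun i _ => ?_
  simp only [Function.comp_apply]
  rw [List.map_flatMap, List.count_flatMap, List.map_reverse, List.sum_reverse, hsum]
  refine Finset.sum_congr rfl fun j _ => ?_
  simp only [Function.comp_apply, List.map_replicate, List.count_replicate]

/-- The number of boxes with entry `k`. -/
noncomputable def boxCount (T : ℕ → ℕ → ℕ) (k : ℕ) : ℕ := {p : ℕ × ℕ | T p.1 p.2 = k}.ncard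

lemma boxCount_rskP {l : ℕ} (b : Matrix (Fin l) (Fin l) ℕ) (k : ℕ) :
    boxCount (rskP b) (k + 1) = ∑ j : Fin l, if (j : ℕ) = k then ∑ i, b i j else 0 := by
  rw [boxCount, rskP, (ncard_filling k.succ_ne_zero).2, (perm_flatten_rskSteps _).count_eq,
    count_map_twoLineArray, Finset.sum_comm]
  refine Finset.sum_congr rfl fun j _ => ?_
  by_cases h : (j : ℕ) = k <;> simp [h]

lemma boxCount_rskQ {l : ℕ} (b : Matrix (Fin l) (Fin l) ℕ) (k : ℕ) :
    boxCount (rskQ b) (k + 1) = ∑ i : Fin l, if (i : ℕ) = k then ∑ j, b i j else 0 := by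
  rw [boxCount, rskQ, (ncard_rskSteps_snd (isArray_twoLineArray b) k.succ_ne_zero).2,
    count_map_twoLineArray]
  refine Finset.sum_congr rfl fun i _ => ?_
  by_cases h : (i : ℕ) = k <;> simp [h]

lemma isColumnStrict_rskP {l : ℕ} (b : Matrix (Fin l) (Fin l) ℕ) : IsColumnStrict (rskP b) :=
  (rskSteps_valid (isArray_twoLineArray b)).1.tab.isColumnStrict

lemma isColumnStrict_rskQ {l : ℕ} (b : Matrix (Fin l) (Fin l) ℕ) : IsColumnStrict (rskQ b) :=
  (rskSteps_valid (isArray_twoLineArray b)).1.strict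

lemma rskQ_ne_zero_iff {l : ℕ} (b : Matrix (Fin l) (Fin l) ℕ) (r c : ℕ) :
    rskQ b r c ≠ 0 ↔ rskP b r c ≠ 0 := by
  have h := (rskSteps_valid (isArray_twoLineArray b)).1
  rw [rskP, h.tab.filling_ne_zero_iff]
  exact h.shape r c

theorem rsk_injective {l : ℕ} {b b' : Matrix (Fin l) (Fin l) ℕ} (hP : rskP b = rskP b')
    (hQ : rskQ b = rskQ b') : b = b' := by
  have h := isArray_twoLineArray b
  have h' := isArray_twoLineArray b'
  have hw : twoLineArray b = twoLineArray b' :=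
    rskSteps_injective h h' (Prod.ext (filling_injOn (rskSteps_valid h).1.tab
      (rskSteps_valid h').1.tab fun r c => congrFun (congrFun hP r) c) hQ)
  ext i j
  have hcount : ∀ b : Matrix (Fin l) (Fin l) ℕ,
      ((twoLineArray b).map id).count ((i : ℕ) + 1, (j : ℕ) + 1) = b i j := by
    intro b
    rw [count_map_twoLineArray, Finset.sum_eq_single i, Finset.sum_eq_single j]
    · simp
    · intro j' _ hj
      simp [Fin.val_eq_val, hj]
    · simp
    · intro i' _ hi
      simp [Fin.val_eq_val, hi]
    · simp
  rw [← hcount b, ← hcount b', hw]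

theorem rsk_surjective {l : ℕ} {P Q : ℕ → ℕ → ℕ} (hP : IsColumnStrict P) (hQ : IsColumnStrict Q)
    (hPQ : ∀ r c, Q r c ≠ 0 ↔ P r c ≠ 0) (hPl : ∀ r c, P r c ≤ l) (hQl : ∀ r c, Q r c ≤ l) :
    ∃ b : Matrix (Fin l) (Fin l) ℕ, rskP b = P ∧ rskQ b = Q := by
  obtain ⟨Cs, hCs, rfl⟩ := hP.exists_isTab
  obtain ⟨w, hw, hwPQ⟩ := rskSteps_surjective (P := Cs) (Q := Q)
    ⟨hCs, hQ, fun r c => (hPQ r c).trans (hCs.filling_ne_zero_iff r c)⟩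
  have hw2 : ∀ a ∈ w, a.2 ≤ l := by
    intro a ha
    have h1 : a.2 ∈ (rskSteps w).1.flatten :=
      (perm_flatten_rskSteps w).mem_iff.2 (List.mem_map_of_mem ha)
    have h2 := (ncard_filling (P := (rskSteps w).1) (hw.2 a ha).2.ne').2
    have h3 := List.count_pos_iff.2 h1
    rw [← h2, hwPQ] at h3
    obtain ⟨p, hp⟩ := Set.nonempty_of_ncard_ne_zero h3.ne'
    have h4 : filling Cs p.1 p.2 = a.2 := hp
    rw [← h4]
    exact hPl _ _
  have hw1 : ∀ a ∈ w, a.1 ≤ l := by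
    intro a ha
    have h1 : a.1 ∈ w.map Prod.fst := List.mem_map_of_mem ha
    have h2 := (ncard_rskSteps_snd hw (hw.2 a ha).1.ne').2
    have h3 := List.count_pos_iff.2 h1
    rw [← h2, hwPQ] at h3
    obtain ⟨p, hp⟩ := Set.nonempty_of_ncard_ne_zero h3.ne'
    have h4 : Q p.1 p.2 = a.1 := hp
    rw [← h4]
    exact hQl _ _
  let b : Matrix (Fin l) (Fin l) ℕ := fun i j => w.count ((i : ℕ) + 1, (j : ℕ) + 1)
  have hb : twoLineArray b = w := by
    refine List.Perm.eq_of_pairwise (le := ArrayLE) (fun _ _ _ _ h1 h2 => h1.antisymm h2)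
      (isArray_twoLineArray b).1 hw.1 ?_
    rw [List.perm_iff_count]
    rintro ⟨x, y⟩
    have h1 := count_map_twoLineArray b id (x, y)
    rw [List.map_id] at h1
    rw [h1]
    by_cases hxy : (x, y) ∈ w
    · have h2 := hw.2 _ hxy
      have h3 := hw1 _ hxy
      have h4 := hw2 _ hxy
      simp only at h2 h3 h4
      rw [Finset.sum_eq_single (⟨x - 1, by omega⟩ : Fin l),
        Finset.sum_eq_single (⟨y - 1, by omega⟩ : Fin l)]
      · simp [b, show x - 1 + 1 = x by omega, show y - 1 + 1 = y by omega]
      · intro j _ hj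
        rw [if_neg]
        intro he
        simp only [id, beq_iff_eq, Prod.mk.injEq] at he
        exact hj (Fin.ext (by simp; omega))
      · simp
      · intro i _ hi
        refine Finset.sum_eq_zero fun j _ => if_neg fun he => ?_
        simp only [id, beq_iff_eq, Prod.mk.injEq] at he
        exact hi (Fin.ext (by simp; omega))
      · simp
    · rw [List.count_eq_zero_of_not_mem hxy]
      refine Finset.sum_eq_zero fun i _ => Finset.sum_eq_zero fun j _ => ?_
      split_ifs with he
      · simp only [id, beq_iff_eq] at he
        simp only [b, he]
        exact List.count_eq_zero_of_not_mem hxy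
      · rfl
  refine ⟨b, ?_, ?_⟩
  · rw [rskP, hb, hwPQ]
  · rw [rskQ, hb, hwPQ]

/-! ### Monic polynomials with nonzero constant term as products of elements of `Φ` -/

section Polynomials

variable {F : Type*} [Field F]

open UniqueFactorizationMonoid

lemma Phi.degree_pos (f : Phi F) : 0 < f.degree := f.2.2.1.natDegree_pos

lemma multiplicity_eq_count [DecidableEq F] (f : Phi F) {p : F[X]} (hp : p ≠ 0) :
    multiplicity f.1 p = (normalizedFactors p).count f.1 := by
  rw [multiplicity_eq_count_normalizedFactors f.2.2.1 hp, f.2.1.normalize_eq_self]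

lemma mem_normalizedFactors_iff_exists_phi [DecidableEq F] {p : F[X]} (h0 : p.eval 0 ≠ 0)
    {g : F[X]} (hg : g ∈ normalizedFactors p) : ∃ f : Phi F, f.1 = g := by
  have hp : p ≠ 0 := by
    rintro rfl
    simp at h0
  have hirr := irreducible_of_normalized_factor g hg
  have hm : g.Monic := by
    rw [← normalize_normalized_factor g hg]
    exact Polynomial.monic_normalize hirr.ne_zero
  refine ⟨⟨g, hm, hirr, fun hg0 => h0 ?_⟩, rfl⟩
  exact Polynomial.eval_eq_zero_of_dvd_of_eval_eq_zero (dvd_of_mem_normalizedFactors hg) hg0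

lemma prod_normalizedFactors_of_monic [DecidableEq F] {p : F[X]} (hp : p.Monic) :
    (normalizedFactors p).prod = p := by
  rw [prod_normalizedFactors_eq hp.ne_zero, hp.normalize_eq_self]

lemma eq_of_forall_multiplicity_eq {p q : F[X]} (hp : p.Monic) (hq : q.Monic)
    (hp0 : p.eval 0 ≠ 0) (hq0 : q.eval 0 ≠ 0)
    (h : ∀ f : Phi F, multiplicity f.1 p = multiplicity f.1 q) : p = q := by
  classical
  rw [← prod_normalizedFactors_of_monic hp, ← prod_normalizedFactors_of_monic hq]
  congr 1
  ext g
  by_cases hg : ∃ f : Phi F, f.1 = g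
  · obtain ⟨f, rfl⟩ := hg
    rw [← multiplicity_eq_count f hp.ne_zero, ← multiplicity_eq_count f hq.ne_zero, h]
  · rw [Multiset.count_eq_zero_of_notMem fun hg' =>
        hg (mem_normalizedFactors_iff_exists_phi hp0 hg'),
      Multiset.count_eq_zero_of_notMem fun hg' =>
        hg (mem_normalizedFactors_iff_exists_phi hq0 hg')]

lemma finite_support_multiplicity {p : F[X]} (hp : p ≠ 0) :
    {f : Phi F | multiplicity f.1 p ≠ 0}.Finite := by
  classical
  refine Set.Finite.of_finite_image ((normalizedFactors p).toFinset.finite_toSet.subset ?_)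
    (f := Subtype.val) Subtype.val_injective.injOn
  rintro _ ⟨f, hf, rfl⟩
  have hf : multiplicity f.1 p ≠ 0 := hf
  rw [multiplicity_eq_count f hp] at hf
  exact Multiset.mem_toFinset.2 (Multiset.count_ne_zero.1 hf)

lemma natDegree_eq_finsum {p : F[X]} (hp : p.Monic) (h0 : p.eval 0 ≠ 0) :
    p.natDegree = ∑ᶠ f : Phi F, f.degree * multiplicity f.1 p := by
  classical
  have hfin := finite_support_multiplicity hp.ne_zero
  conv_lhs => rw [← prod_normalizedFactors_of_monic hp]
  rw [Polynomial.natDegree_multiset_prod_of_monic]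
  · rw [Finset.sum_multiset_map_count, finsum_eq_sum_of_support_subset _ (s := hfin.toFinset)]
    · symm
      refine Finset.sum_bij (fun f _ => f.1) ?_ (fun _ _ _ _ h => Subtype.ext h) ?_ ?_
      · intro f hf
        have hf : multiplicity f.1 p ≠ 0 := by simpa using hf
        rw [multiplicity_eq_count f hp.ne_zero] at hf
        exact Multiset.mem_toFinset.2 (Multiset.count_ne_zero.1 hf)
      · intro g hg
        rw [Multiset.mem_toFinset] at hg
        obtain ⟨f, rfl⟩ := mem_normalizedFactors_iff_exists_phi h0 hg
        refine ⟨f, ?_, rfl⟩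
        simp only [Set.Finite.mem_toFinset]
        change multiplicity f.1 p ≠ 0
        rw [multiplicity_eq_count f hp.ne_zero]
        exact Multiset.count_ne_zero.2 hg
      · intro f _
        rw [multiplicity_eq_count f hp.ne_zero, smul_eq_mul, mul_comm]
        rfl
    · intro f hf
      simp only [Set.Finite.coe_toFinset]
      exact fun h => hf (by simp [h])
  · intro g hg
    obtain ⟨f, rfl⟩ := mem_normalizedFactors_iff_exists_phi h0 hg
    exact f.2.1

lemma exists_monic_multiplicity (b : Phi F → ℕ) (hb : {f | b f ≠ 0}.Finite) :
    ∃ p : F[X], p.Monic ∧ p.eval 0 ≠ 0 ∧ ∀ f : Phi F, multiplicity f.1 p = b f := by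
  classical
  set p : F[X] := ∏ f ∈ hb.toFinset, f.1 ^ b f with hpdef
  have hm : p.Monic := Polynomial.monic_prod_of_monic _ _ fun f _ => f.2.1.pow _
  refine ⟨p, hm, ?_, fun f => ?_⟩
  · rw [hpdef, Polynomial.eval_prod]
    refine Finset.prod_ne_zero_iff.2 fun f _ => ?_
    rw [Polynomial.eval_pow]
    exact pow_ne_zero _ f.2.2.2
  · rw [multiplicity_eq_count f hm.ne_zero, hpdef, Finset.prod_eq_multiset_prod,
      normalizedFactors_multiset_prod, Multiset.map_map]
    · change Multiset.count f.1 (∑ g ∈ hb.toFinset, normalizedFactors (g.1 ^ b g)) = b f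
      rw [Multiset.count_sum']
      have hterm : ∀ g : Phi F, Multiset.count f.1 (normalizedFactors (g.1 ^ b g)) =
          if g = f then b g else 0 := by
        intro g
        rw [normalizedFactors_pow, normalizedFactors_irreducible g.2.2.1,
          g.2.1.normalize_eq_self, Multiset.count_nsmul, Multiset.count_singleton]
        by_cases hgf : g = f
        · simp [hgf]
        · have : f.1 ≠ g.1 := fun h => hgf (Subtype.ext h.symm)
          simp [hgf, this]
      simp only [hterm, Finset.sum_ite_eq', Set.Finite.mem_toFinset]
      by_cases h0 : b f = 0
      · simp [h0]
      · exact if_pos h0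
    · intro h
      obtain ⟨g, -, hg⟩ := Multiset.mem_map.1 h
      exact pow_ne_zero _ g.2.2.1.ne_zero hg

end Polynomials

/-! ### Pairs of tableaux as families of fillings -/

lemma ColumnStrictTableau.ne_zero_iff {ν : YoungDiagram} (T : ColumnStrictTableau ν) (r c : ℕ) :
    T.1 r c ≠ 0 ↔ (r, c) ∈ ν := by
  refine ⟨fun h => ?_, fun h => (T.2 (r, c) h).ne'⟩
  by_contra hn
  exact h (T.1.zeros hn)

lemma ColumnStrictTableau.isColumnStrict {ν : YoungDiagram} (T : ColumnStrictTableau ν) :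
    IsColumnStrict fun r c => T.1 r c := by
  refine ⟨fun r c h => ?_, fun r c h => ?_, ?_⟩
  · rw [T.ne_zero_iff] at h
    exact ⟨(T.ne_zero_iff r c).2 (ν.up_left_mem r.le_succ le_rfl h),
      T.1.col_strict r.lt_succ_self h⟩
  · rw [T.ne_zero_iff] at h
    exact ⟨(T.ne_zero_iff r c).2 (ν.up_left_mem le_rfl c.le_succ h),
      T.1.row_weak c.lt_succ_self h⟩
  · refine ν.cells.finite_toSet.subset fun p hp => ?_
    exact (T.ne_zero_iff p.1 p.2).1 hp

lemma ColumnStrictTableau.count_eq_boxCount {ν : YoungDiagram} (T : ColumnStrictTableau ν)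
    {k : ℕ} (hk : k ≠ 0) : T.count k = boxCount (fun r c => T.1 r c) k := by
  rw [ColumnStrictTableau.count, boxCount, ← Set.ncard_coe_finset]
  congr 1
  ext p
  simp only [Finset.coe_filter, Set.mem_ofPred_eq, YoungDiagram.mem_cells, and_iff_right_iff_imp]
  intro hp
  exact (T.ne_zero_iff p.1 p.2).1 (hp ▸ hk)

/-- The Young diagram formed by the nonzero entries of a column strict filling. -/
noncomputable def IsColumnStrict.shape {T : ℕ → ℕ → ℕ} (h : IsColumnStrict T) : YoungDiagram where
  cells := h.finite.toFinset
  isLowerSet := by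
    rintro ⟨r, c⟩ ⟨r', c'⟩ hle hrc
    simp only [Set.Finite.coe_toFinset] at hrc ⊢
    exact h.ne_zero_of_le_row hle.1 (h.ne_zero_of_le_col hle.2 hrc)

lemma IsColumnStrict.mem_shape {T : ℕ → ℕ → ℕ} (h : IsColumnStrict T) {r c : ℕ} :
    (r, c) ∈ h.shape ↔ T r c ≠ 0 := by
  rw [← YoungDiagram.mem_cells]
  simp [IsColumnStrict.shape]

/-- A column strict filling as a column strict tableau. -/
def ColumnStrictTableau.ofFilling {ν : YoungDiagram} {T : ℕ → ℕ → ℕ} (h : IsColumnStrict T)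
    (hν : ∀ r c, (r, c) ∈ ν ↔ T r c ≠ 0) : ColumnStrictTableau ν :=
  ⟨⟨T, fun {i j1 j2} hj hm => h.le_of_le_col hj.le ((hν _ _).1 hm),
    fun {i1 i2 j} hi hm => h.lt_of_lt_row hi ((hν _ _).1 hm),
    fun {i j} hm => by simpa [hν] using hm⟩,
    fun c hc => Nat.pos_of_ne_zero ((hν c.1 c.2).1 hc)⟩

section Pairs

variable {S : Type*} {d : S → ℕ} {n : ℕ} {μ : Composition n}

lemma boxCount_eq_zero {T : ℕ → ℕ → ℕ} (h : ∀ r c, T r c = 0) (k : ℕ) :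
    boxCount T (k + 1) = 0 := by
  simp [boxCount, h]

lemma part_eq_bot_iff {lam : SPartition S} (P : STableau lam) (s : S) :
    lam.part s = ⊥ ↔ ∀ r c, (P s).1 r c = 0 := by
  have h := (P s).ne_zero_iff
  constructor
  · intro hs r c
    by_contra hne
    have := (h r c).1 hne
    rw [hs] at this
    exact YoungDiagram.notMem_bot _ this
  · intro hs
    ext ⟨r, c⟩
    rw [YoungDiagram.mem_cells, ← h r c]
    simp [hs]

lemma wt_eq_finsum {lam : SPartition S} (P : STableau lam) (k : ℕ) :
    P.wt d (k + 1) = ∑ᶠ s, d s * boxCount (fun r c => (P s).1 r c) (k + 1) := by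
  rw [finsum_eq_sum_of_support_subset _ (s := lam.finite_support.toFinset)]
  · exact Finset.sum_congr rfl fun s _ => by rw [(P s).count_eq_boxCount k.succ_ne_zero]
  · intro s hs
    simp only [Set.Finite.coe_toFinset]
    intro hbot
    exact hs (by simp only [boxCount_eq_zero ((part_eq_bot_iff P s).1 hbot), mul_zero])

/-- The pairs of tableaux of the same shape and of weight `μ`. -/
abbrev PairsOfWeight (d : S → ℕ) (μ : Composition n) :=
  Σ lam : SPartition S, TableauxOfWeight d μ lam × TableauxOfWeight d μ lam

lemma PairsOfWeight.ext {t t' : PairsOfWeight d μ}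
    (hP : ∀ s r c, (t.2.1.1 s).1 r c = (t'.2.1.1 s).1 r c)
    (hQ : ∀ s r c, (t.2.2.1 s).1 r c = (t'.2.2.1 s).1 r c) : t = t' := by
  obtain ⟨lam, P, Q⟩ := t
  obtain ⟨lam', P', Q'⟩ := t'
  have hlam : lam = lam' := by
    obtain ⟨p, hp⟩ := lam
    obtain ⟨p', hp'⟩ := lam'
    have : p = p' := by
      funext s
      ext ⟨r, c⟩
      rw [YoungDiagram.mem_cells, YoungDiagram.mem_cells, ← (P.1 s).ne_zero_iff,
        ← (P'.1 s).ne_zero_iff]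
      exact not_congr (by rw [hP s r c])
    subst this
    rfl
  subst hlam
  have h1 : P = P' := Subtype.ext <| funext fun s => Subtype.ext <|
    SemistandardYoungTableau.ext fun r c => hP s r c
  have h2 : Q = Q' := Subtype.ext <| funext fun s => Subtype.ext <|
    SemistandardYoungTableau.ext fun r c => hQ s r c
  rw [h1, h2]

lemma PairsOfWeight.exists_of_fillings {P Q : S → ℕ → ℕ → ℕ} (hP : ∀ s, IsColumnStrict (P s))
    (hQ : ∀ s, IsColumnStrict (Q s)) (hPQ : ∀ s r c, Q s r c ≠ 0 ↔ P s r c ≠ 0)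
    (hfin : {s | ∃ r c, P s r c ≠ 0}.Finite)
    (hwP : ∀ k, ∑ᶠ s, d s * boxCount (P s) (k + 1) = μ.blocks.getD k 0)
    (hwQ : ∀ k, ∑ᶠ s, d s * boxCount (Q s) (k + 1) = μ.blocks.getD k 0) :
    ∃ t : PairsOfWeight d μ, ∀ s r c,
      (t.2.1.1 s).1 r c = P s r c ∧ (t.2.2.1 s).1 r c = Q s r c := by
  let lam : SPartition S := ⟨fun s => (hP s).shape, hfin.subset fun s hs => by
    by_contra hne
    refine hs ?_
    ext ⟨r, c⟩
    rw [YoungDiagram.mem_cells, (hP s).mem_shape]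
    have : P s r c = 0 := by
      by_contra h
      exact hne ⟨r, c, h⟩
    simp [this]⟩
  let TP : STableau lam := fun s => .ofFilling (hP s) fun r c => (hP s).mem_shape
  let TQ : STableau lam := fun s =>
    .ofFilling (hQ s) fun r c => (hP s).mem_shape.trans (hPQ s r c).symm
  exact ⟨⟨lam, ⟨TP, fun k => (wt_eq_finsum TP k).trans (hwP k)⟩,
    ⟨TQ, fun k => (wt_eq_finsum TQ k).trans (hwQ k)⟩⟩, fun s r c => ⟨rfl, rfl⟩⟩

end Pairs

/-! ### The bijection from `M_μ` to pairs of tableaux -/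

section Correspondence

variable {F : Type u} [Field F] {n : ℕ} {μ : Composition n}

lemma getD_blocks_eq_sum (k : ℕ) :
    μ.blocks.getD k 0 = ∑ i : Fin μ.length, if (i : ℕ) = k then μ.blocksFun i else 0 := by
  by_cases hk : k < μ.length
  · rw [Finset.sum_eq_single (⟨k, hk⟩ : Fin μ.length)]
    · rw [List.getD_eq_getElem _ _ (by simpa using hk)]
      simp [Composition.blocksFun]
    · intro i _ hi
      exact if_neg fun h => hi (Fin.ext h)
    · simp
  · rw [List.getD_eq_default _ _ (by simpa using hk)]
    refine (Finset.sum_eq_zero fun i _ => if_neg fun h => ?_).symm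
    omega

/-- If `e ↦ c e f` gives the exponents of `f` in the polynomials `p e`, then the total degree of
the `p e` is the sum over `f` of the total exponents, weighted by the degree. -/
lemma sum_natDegree_eq_finsum {ι : Type*} [Fintype ι] {p : ι → F[X]}
    (hp : ∀ e, (p e).Monic ∧ (p e).eval 0 ≠ 0) :
    ∑ e, (p e).natDegree = ∑ᶠ f : Phi F, f.degree * ∑ e, multiplicity f.1 (p e) := by
  simp only [Finset.mul_sum]
  rw [finsum_sum_comm]
  · exact Finset.sum_congr rfl fun e _ => natDegree_eq_finsum (hp e).1 (hp e).2
  · intro e _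
    refine (finite_support_multiplicity (hp e).1.ne_zero).subset fun f hf h => hf ?_
    simp [h]

lemma finsum_degree_mul_boxCount {B : Phi F → ℕ → ℕ → ℕ} {c : Phi F → Fin μ.length → ℕ}
    (hB : ∀ f k, boxCount (B f) (k + 1) = ∑ i : Fin μ.length, if (i : ℕ) = k then c f i else 0)
    (hc : ∀ i, {f | c f i ≠ 0}.Finite) (k : ℕ) :
    ∑ᶠ f : Phi F, f.degree * boxCount (B f) (k + 1) =
      ∑ i : Fin μ.length, if (i : ℕ) = k then ∑ᶠ f : Phi F, f.degree * c f i else 0 := by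
  simp only [hB, Finset.mul_sum]
  rw [finsum_sum_comm]
  · refine Finset.sum_congr rfl fun i _ => ?_
    split_ifs <;> simp
  · intro i _
    refine (hc i).subset fun f hf h => hf ?_
    simp [h]

lemma exists_tableauPair (a : Mset F μ) :
    ∃ t : TableauPairs F μ, ∀ (f : Phi F) (r c : ℕ),
      (t.2.1.1 f).1 r c = rskP (exponentMatrix a.1 f) r c ∧
      (t.2.2.1 f).1 r c = rskQ (exponentMatrix a.1 f) r c := by
  obtain ⟨a, hrow, hcol, hm⟩ := a
  have hfin : ∀ i j, {f : Phi F | exponentMatrix a f i j ≠ 0}.Finite := fun i j =>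
    finite_support_multiplicity (hm i j).1.ne_zero
  refine PairsOfWeight.exists_of_fillings (fun f => isColumnStrict_rskP _)
    (fun f => isColumnStrict_rskQ _) (fun f => rskQ_ne_zero_iff _) ?_ ?_ ?_
  · refine (Set.finite_iUnion fun i => Set.finite_iUnion fun j => hfin i j).subset ?_
    rintro f ⟨r, c, hrc⟩
    by_contra hne
    have h0 : exponentMatrix a f = 0 := by
      ext i j
      by_contra h
      exact hne (Set.mem_iUnion.2 ⟨i, Set.mem_iUnion.2 ⟨j, h⟩⟩)
    have h1 : twoLineArray (0 : Matrix (Fin μ.length) (Fin μ.length) ℕ) = [] := by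
      simp [twoLineArray]
    rw [h0, rskP, h1] at hrc
    simp [rskSteps] at hrc
  · intro k
    rw [finsum_degree_mul_boxCount (fun f => boxCount_rskP (exponentMatrix a f)),
      getD_blocks_eq_sum]
    · refine Finset.sum_congr rfl fun j _ => ?_
      rw [← hcol j, sum_natDegree_eq_finsum fun i => hm i j]
      rfl
    · intro j
      refine (Set.finite_iUnion fun i => hfin i j).subset fun f hf => ?_
      obtain ⟨i, -, hi⟩ := Finset.exists_ne_zero_of_sum_ne_zero hf
      exact Set.mem_iUnion.2 ⟨i, hi⟩
  · intro k
    rw [finsum_degree_mul_boxCount (fun f => boxCount_rskQ (exponentMatrix a f)),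
      getD_blocks_eq_sum]
    · refine Finset.sum_congr rfl fun i _ => ?_
      rw [← hrow i, sum_natDegree_eq_finsum fun j => hm i j]
      rfl
    · intro i
      refine (Set.finite_iUnion fun j => hfin i j).subset fun f hf => ?_
      obtain ⟨j, -, hj⟩ := Finset.exists_ne_zero_of_sum_ne_zero hf
      exact Set.mem_iUnion.2 ⟨j, hj⟩

lemma entry_ne_of_length_le {lam : SPartition (Phi F)} (P : TableauxOfWeight Phi.degree μ lam)
    {f : Phi F} {k : ℕ} (hk : μ.length ≤ k) (r c : ℕ) : (P.1 f).1 r c ≠ k + 1 := by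
  intro h
  have h0 := P.2 k
  rw [wt_eq_finsum, List.getD_eq_default _ _ (by simpa using hk)] at h0
  have hsupp : (Function.support fun s : Phi F =>
      s.degree * boxCount (fun r c => (P.1 s).1 r c) (k + 1)).Finite := by
    refine lam.finite_support.subset fun s hs hbot => hs ?_
    simp only [boxCount_eq_zero ((part_eq_bot_iff P.1 s).1 hbot), mul_zero]
  rw [finsum_eq_sum _ hsupp, Finset.sum_eq_zero_iff] at h0
  have h1 : boxCount (fun r c => (P.1 f).1 r c) (k + 1) ≠ 0 := by
    rw [boxCount]
    refine Set.ncard_ne_zero_of_mem (a := (r, c)) h ?_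
    refine (P.1 f).isColumnStrict.finite.subset fun p hp => ?_
    have hp : (P.1 f).1 p.1 p.2 = k + 1 := hp
    simp [hp]
  have h2 : f.degree * boxCount (fun r c => (P.1 f).1 r c) (k + 1) ≠ 0 :=
    mul_ne_zero f.degree_pos.ne' h1
  exact h2 (h0 f (by simpa using h2))

/-- The map `a ↦ (P(a), Q(a))` is a bijection from `M_μ` to the pairs of `Φ`-column strict tableaux
of the same shape and of weight `μ`. -/
theorem exists_equiv_tableauPairs (F : Type u) [Field F] {n : ℕ} (μ : Composition n) :
    ∃ C : Mset F μ ≃ TableauPairs F μ, ∀ (a : Mset F μ) (f : Phi F) (r c : ℕ),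
      ((C a).2.1.1 f).1 r c = rskP (exponentMatrix a.1 f) r c ∧
      ((C a).2.2.1 f).1 r c = rskQ (exponentMatrix a.1 f) r c := by
  choose C hC using exists_tableauPair (F := F) (μ := μ)
  refine ⟨Equiv.ofBijective C ⟨fun a a' h => ?_, fun t => ?_⟩, hC⟩
  · have hexp : ∀ f, exponentMatrix a.1 f = exponentMatrix a'.1 f := fun f =>
      rsk_injective (funext fun r => funext fun c => by rw [← (hC a f r c).1, h, (hC a' f r c).1])
        (funext fun r => funext fun c => by rw [← (hC a f r c).2, h, (hC a' f r c).2])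
    refine Subtype.ext (Matrix.ext fun i j => ?_)
    exact eq_of_forall_multiplicity_eq (a.2.2.2 i j).1 (a'.2.2.2 i j).1 (a.2.2.2 i j).2
      (a'.2.2.2 i j).2 fun f => congrFun (congrFun (hexp f) i) j
  · have hle : ∀ (P : TableauxOfWeight Phi.degree μ t.1) f r c, (P.1 f).1 r c ≤ μ.length := by
      intro P f r c
      by_contra hlt
      obtain ⟨k, hk⟩ := Nat.exists_eq_add_of_lt (not_le.1 hlt)
      exact entry_ne_of_length_le P (Nat.le_add_right μ.length k) r c hk
    have hex : ∀ f, ∃ b : Matrix (Fin μ.length) (Fin μ.length) ℕ,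
        rskP b = (fun r c => (t.2.1.1 f).1 r c) ∧ rskQ b = fun r c => (t.2.2.1 f).1 r c := fun f =>
      rsk_surjective (t.2.1.1 f).isColumnStrict (t.2.2.1 f).isColumnStrict
        (fun r c => ((t.2.2.1 f).ne_zero_iff r c).trans ((t.2.1.1 f).ne_zero_iff r c).symm)
        (hle t.2.1 f) (hle t.2.2 f)
    choose b hbP hbQ using hex
    have hrow : ∀ f k, boxCount (fun r c => (t.2.2.1 f).1 r c) (k + 1) =
        ∑ i : Fin μ.length, if (i : ℕ) = k then ∑ j, b f i j else 0 := fun f k => by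
      rw [← hbQ, boxCount_rskQ]
    have hcol : ∀ f k, boxCount (fun r c => (t.2.1.1 f).1 r c) (k + 1) =
        ∑ j : Fin μ.length, if (j : ℕ) = k then ∑ i, b f i j else 0 := fun f k => by
      rw [← hbP, boxCount_rskP]
    have hsum : ∀ f j, t.1.part f = ⊥ → ∑ i, b f i j = 0 := by
      intro f j hf
      have h1 := hcol f j
      rw [boxCount_eq_zero ((part_eq_bot_iff t.2.1.1 f).1 hf), Finset.sum_eq_single j] at h1
      · simpa using h1.symm
      · intro j' _ hj'
        exact if_neg fun h => hj' (Fin.ext h)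
      · simp
    have hfin : ∀ i j, {f | b f i j ≠ 0}.Finite := fun i j =>
      t.1.finite_support.subset fun f hf hbot =>
        hf (Finset.sum_eq_zero_iff.1 (hsum f j hbot) i (Finset.mem_univ _))
    choose a ha1 ha0 hab using fun i j => exists_monic_multiplicity (fun f => b f i j) (hfin i j)
    have hexp : ∀ f, exponentMatrix (Matrix.of a) f = b f := fun f =>
      Matrix.ext fun i j => hab i j f
    have haM : Matrix.of a ∈ Mset F μ := by
      refine ⟨fun i => ?_, fun j => ?_, fun i j => ⟨ha1 i j, ha0 i j⟩⟩
      · have h1 := t.2.2.2 i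
        rw [wt_eq_finsum, finsum_degree_mul_boxCount hrow, getD_blocks_eq_sum,
          Finset.sum_eq_single i, Finset.sum_eq_single i] at h1
        · simp only [if_true] at h1
          rw [← h1]
          simp only [Matrix.of_apply]
          rw [sum_natDegree_eq_finsum fun j => ⟨ha1 i j, ha0 i j⟩]
          simp only [hab]
        · exact fun i' _ hi' => if_neg fun h => hi' (Fin.ext h)
        · simp
        · exact fun i' _ hi' => if_neg fun h => hi' (Fin.ext h)
        · simp
        · intro i
          refine (Set.finite_iUnion fun j => hfin i j).subset fun f hf => ?_
          obtain ⟨j, -, hj⟩ := Finset.exists_ne_zero_of_sum_ne_zero hf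
          exact Set.mem_iUnion.2 ⟨j, hj⟩
      · have h1 := t.2.1.2 j
        rw [wt_eq_finsum, finsum_degree_mul_boxCount hcol, getD_blocks_eq_sum,
          Finset.sum_eq_single j, Finset.sum_eq_single j] at h1
        · simp only [if_true] at h1
          rw [← h1]
          simp only [Matrix.of_apply]
          rw [sum_natDegree_eq_finsum fun i => ⟨ha1 i j, ha0 i j⟩]
          simp only [hab]
        · exact fun i' _ hi' => if_neg fun h => hi' (Fin.ext h)
        · simp
        · exact fun i' _ hi' => if_neg fun h => hi' (Fin.ext h)
        · simp
        · intro j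
          refine (Set.finite_iUnion fun i => hfin i j).subset fun f hf => ?_
          obtain ⟨i, -, hi⟩ := Finset.exists_ne_zero_of_sum_ne_zero hf
          exact Set.mem_iUnion.2 ⟨i, hi⟩
    refine ⟨⟨Matrix.of a, haM⟩, PairsOfWeight.ext (fun f r c => ?_) fun f r c => ?_⟩
    · rw [(hC _ f r c).1, hexp, hbP]
    · rw [(hC _ f r c).2, hexp, hbQ]

end Correspondence

/-! ### The permutation of the matrix `v_(f)` -/

section Local

variable {F : Type*} [Field F]

lemma lowerExp_le (f : F[X]) (c : ℕ) : lowerExp f c ≤ c := by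
  classical exact Nat.findGreatest_le (P := fun m => f.coeff m ≠ 0) c

lemma coeff_lowerExp_ne_zero {f : F[X]} (h0 : f.eval 0 ≠ 0) (c : ℕ) :
    f.coeff (lowerExp f c) ≠ 0 := by
  classical
  have h : f.coeff 0 ≠ 0 := by rwa [Polynomial.coeff_zero_eq_eval_zero]
  exact Nat.findGreatest_spec (P := fun m => f.coeff m ≠ 0) (Nat.zero_le c) h

lemma coeff_eq_zero_of_lowerExp_lt {f : F[X]} {c m : ℕ} (h1 : lowerExp f c < m) (h2 : m ≤ c) :
    f.coeff m = 0 := by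
  classical
  by_contra h
  exact Nat.findGreatest_is_greatest (P := fun m => f.coeff m ≠ 0) h1 h2 h

lemma upperExp_mem {f : F[X]} (hf : f.Monic) {c : ℕ} (hc : c < f.natDegree) :
    c < upperExp f c ∧ f.coeff (upperExp f c) ≠ 0 :=
  Nat.sInf_mem (s := {m | c < m ∧ f.coeff m ≠ 0}) ⟨f.natDegree, hc, by simp [hf.coeff_natDegree]⟩

lemma upperExp_le {f : F[X]} {c m : ℕ} (h1 : c < m) (h2 : f.coeff m ≠ 0) : upperExp f c ≤ m :=
  Nat.sInf_le ⟨h1, h2⟩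

lemma upperExp_le_natDegree {f : F[X]} (hf : f.Monic) {c : ℕ} (hc : c < f.natDegree) :
    upperExp f c ≤ f.natDegree := upperExp_le hc (by simp [hf.coeff_natDegree])

lemma lowerExp_eq {f : F[X]} {c m : ℕ} (hm : f.coeff m ≠ 0) (hmc : m ≤ c)
    (h : ∀ k, m < k → k ≤ c → f.coeff k = 0) : lowerExp f c = m := by
  classical
  exact Nat.findGreatest_eq_iff.2 ⟨hmc, fun _ => hm, fun k hk hkc => not_not.2 (h k hk hkc)⟩

lemma upperExp_eq {f : F[X]} {c m : ℕ} (hm : f.coeff m ≠ 0) (hmc : c < m)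
    (h : ∀ k, c < k → k < m → f.coeff k = 0) : upperExp f c = m := by
  have hmem : upperExp f c ∈ {m | c < m ∧ f.coeff m ≠ 0} := Nat.sInf_mem ⟨m, hmc, hm⟩
  refine le_antisymm (upperExp_le hmc hm) ?_
  by_contra hlt
  exact hmem.2 (h _ hmem.1 (not_le.1 hlt))

/-- The row of the nonzero entry of `v_(f)` in column `c`. -/
noncomputable def vRow (f : F[X]) (c : ℕ) : ℕ := f.natDegree + c - lowerExp f c - upperExp f c

lemma vRow_add {f : F[X]} (hf : f.Monic) {c : ℕ} (hc : c < f.natDegree) :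
    vRow f c + lowerExp f c + upperExp f c = f.natDegree + c := by
  have h1 := lowerExp_le f c
  have h2 := upperExp_le_natDegree hf hc
  unfold vRow
  omega

lemma vRow_lt {f : F[X]} (hf : f.Monic) {c : ℕ} (hc : c < f.natDegree) :
    vRow f c < f.natDegree := by
  have h1 := vRow_add hf hc
  have h2 := (upperExp_mem hf hc).1
  omega

lemma vPoly_eq {f : F[X]} (hf : f.Monic) {r c : ℕ} (hc : c < f.natDegree) :
    vPoly f r c = if r = vRow f c then f.coeff (lowerExp f c) else 0 := by
  have h1 := vRow_add hf hc
  have h2 := vRow_lt hf hc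
  unfold vPoly
  congr 1
  simp only [eq_iff_iff]
  constructor <;> intro h <;> omega

/-- Two columns of `v_(f)` either belong to the same summand of the direct sum, and then the
nonzero entries are on a line of slope `1`, or the right one has its nonzero entry above the one of
the left one. -/
lemma vRow_dichotomy {f : F[X]} (hf : f.Monic) {m m' : ℕ} (hm : m < m')
    (hm' : m' < f.natDegree) :
    (lowerExp f m' = lowerExp f m ∧ vRow f m' = vRow f m + (m' - m)) ∨ vRow f m' < vRow f m := by
  have e := vRow_add hf (hm.trans hm')
  have e' := vRow_add hf hm'
  have h1 := lowerExp_le f m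
  have h1' := lowerExp_le f m'
  obtain ⟨h2, h3⟩ := upperExp_mem hf (hm.trans hm')
  obtain ⟨h2', h3'⟩ := upperExp_mem hf hm'
  by_cases hle : upperExp f m ≤ m'
  · right
    have : upperExp f m ≤ lowerExp f m' := by
      by_contra hlt
      exact h3 (coeff_eq_zero_of_lowerExp_lt (not_le.1 hlt) hle)
    omega
  · left
    have hz : ∀ k, m < k → k < upperExp f m → f.coeff k = 0 := by
      intro k hk hk'
      by_contra hne
      exact absurd (upperExp_le hk hne) (not_le.2 hk')
    have hu : upperExp f m' = upperExp f m :=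
      upperExp_eq h3 (not_le.1 hle) fun k hk hk' => hz k (hm.trans hk) hk'
    have hl : lowerExp f m' = lowerExp f m := by
      have hlm : lowerExp f m' ≤ m ∨ f.coeff (lowerExp f m') = 0 := by
        by_cases h : lowerExp f m' ≤ m
        · exact Or.inl h
        · exact Or.inr (hz _ (not_le.1 h) (by omega))
      classical
      by_cases h : f.coeff (lowerExp f m) = 0
      · -- no exponent is `≤ m`, so both sides are the junk value `0`
        have h0 : lowerExp f m = 0 := by
          by_contra hne
          exact Nat.findGreatest_of_ne_zero (P := fun m => f.coeff m ≠ 0) rfl hne h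
        by_contra hne
        have h4 : f.coeff (lowerExp f m') ≠ 0 :=
          Nat.findGreatest_of_ne_zero (P := fun m => f.coeff m ≠ 0) (m := lowerExp f m') (n := m')
            rfl (by omega)
        rcases hlm with h5 | h5
        · exact h4 (coeff_eq_zero_of_lowerExp_lt (c := m) (by omega) h5)
        · exact h4 h5
      · exact lowerExp_eq h (by omega) fun k hk hk' => by
          by_cases hkm : k ≤ m
          · exact coeff_eq_zero_of_lowerExp_lt hk hkm
          · exact hz k (by omega) (by omega)
    exact ⟨hl, by omega⟩

lemma vRow_injOn {f : F[X]} (hf : f.Monic) {m m' : ℕ} (hm : m < f.natDegree)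
    (hm' : m' < f.natDegree) (h : vRow f m = vRow f m') : m = m' := by
  rcases lt_trichotomy m m' with hlt | heq | hlt
  · have := vRow_dichotomy hf hlt hm'
    omega
  · exact heq
  · have := vRow_dichotomy hf hlt hm
    omega

/-- The exponents of `f` can be read off from the positions of the nonzero entries of `v_(f)`. -/
lemma coeff_succ_ne_zero_iff {f : F[X]} (hf : f.Monic) (h0 : f.eval 0 ≠ 0) {m : ℕ}
    (hm : m + 1 < f.natDegree) : f.coeff (m + 1) ≠ 0 ↔ vRow f (m + 1) ≠ vRow f m + 1 := by
  constructor
  · intro h h1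
    rcases vRow_dichotomy hf m.lt_add_one hm with h2 | h2
    · have h3 : lowerExp f (m + 1) = m + 1 :=
        lowerExp_eq h le_rfl fun k hk hk' => absurd hk (not_lt.2 hk')
      have := lowerExp_le f m
      have := h2.1
      omega
    · omega
  · intro h h1
    have hlow : lowerExp f (m + 1) = lowerExp f m :=
      lowerExp_eq (coeff_lowerExp_ne_zero h0 m) ((lowerExp_le f m).trans m.le_succ)
        fun k hk hk' => by
          rcases hk'.lt_or_eq with hk' | rfl
          · exact coeff_eq_zero_of_lowerExp_lt hk (by omega)
          · exact h1
    have hup : upperExp f (m + 1) = upperExp f m := by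
      obtain ⟨h2, h3⟩ := upperExp_mem hf (m.lt_succ_self.trans hm)
      refine upperExp_eq h3 (lt_of_le_of_ne h2 fun h => h3 (h ▸ h1))
        fun k hk hk' => ?_
      by_contra hne
      exact absurd (upperExp_le (m.lt_succ_self.trans hk) hne) (not_le.2 hk')
    have e := vRow_add hf (m.lt_succ_self.trans hm)
    have e' := vRow_add hf hm
    omega

/-- The matrix `v_(f)` determines `f`. -/
lemma eq_of_vRow_eq {f g : F[X]} (hf : f.Monic) (hg : g.Monic) (hf0 : f.eval 0 ≠ 0)
    (hg0 : g.eval 0 ≠ 0) (hd : f.natDegree = g.natDegree)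
    (h : ∀ m < f.natDegree, vRow f m = vRow g m ∧
      f.coeff (lowerExp f m) = g.coeff (lowerExp g m)) : f = g := by
  have hlow : ∀ {f : F[X]} {m : ℕ}, f.coeff m ≠ 0 → lowerExp f m = m := fun h =>
    lowerExp_eq h le_rfl fun k hk hk' => absurd hk (not_lt.2 hk')
  ext m
  rcases lt_trichotomy m f.natDegree with hm | rfl | hm
  · have hiff : f.coeff m ≠ 0 ↔ g.coeff m ≠ 0 := by
      cases m with
      | zero =>
        rw [Polynomial.coeff_zero_eq_eval_zero, Polynomial.coeff_zero_eq_eval_zero]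
        simp [hf0, hg0]
      | succ m =>
        rw [coeff_succ_ne_zero_iff hf hf0 hm, coeff_succ_ne_zero_iff hg hg0 (hd ▸ hm), (h _ hm).1,
          (h m (by omega)).1]
    by_cases hfm : f.coeff m = 0
    · rw [hfm]
      by_contra hne
      exact hiff.2 (Ne.symm hne) hfm
    · have h1 := (h m hm).2
      rwa [hlow hfm, hlow (hiff.1 hfm)] at h1
  · rw [hf.coeff_natDegree, hd, hg.coeff_natDegree]
  · rw [Polynomial.coeff_eq_zero_of_natDegree_lt hm,
      Polynomial.coeff_eq_zero_of_natDegree_lt (hd ▸ hm)]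

/-- A permutation `σ` of `{0, …, d - 1}` each of whose ascents at consecutive places is by `1`, with
nonzero coefficients that are constant along the ascents, is the one of `v_(f)` for some `f`: the
maximal runs of consecutive ascents start at the exponents of `f`. The run from `L` to `U - 1` takes
the values from `d - U` on, because the values below `σ L` are those of the places `≥ U`. -/
lemma exists_vRow_eq {d : ℕ} {σ : ℕ → ℕ} {e : ℕ → F} (hσ : ∀ m < d, σ m < d)
    (hinj : ∀ m < d, ∀ m' < d, σ m = σ m' → m = m')
    (hstep : ∀ m, m + 1 < d → σ (m + 1) < σ m ∨ σ (m + 1) = σ m + 1 ∧ e (m + 1) = e m)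
    (he : ∀ m < d, e m ≠ 0) :
    ∃ f : F[X], f.Monic ∧ f.eval 0 ≠ 0 ∧ f.natDegree = d ∧
      ∀ m < d, vRow f m = σ m ∧ f.coeff (lowerExp f m) = e m := by
  classical
  -- the first places of the maximal runs
  let start : ℕ → Prop := fun m => m = 0 ∨ σ m ≠ σ (m - 1) + 1
  let f : F[X] := X ^ d + ∑ m ∈ Finset.range d, C (if start m then e m else 0) * X ^ m
  have hdeg : (∑ m ∈ Finset.range d, C (if start m then e m else 0) * X ^ m).degree <
      (d : WithBot ℕ) := by
    rw [Polynomial.degree_lt_iff_coeff_zero]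
    intro k hk
    rw [Polynomial.finsetSum_coeff]
    refine Finset.sum_eq_zero fun m hm => ?_
    rw [Polynomial.coeff_C_mul_X_pow, if_neg]
    rintro rfl
    exact absurd (Finset.mem_range.1 hm) (not_lt.2 hk)
  have hf : f.Monic := Polynomial.monic_X_pow_add hdeg
  have hfd : f.natDegree = d := by
    refine Polynomial.natDegree_eq_of_degree_eq_some ?_
    rw [Polynomial.degree_add_eq_left_of_degree_lt] <;> rw [Polynomial.degree_X_pow]
    exact hdeg
  have hcoeff : ∀ m < d, f.coeff m = if start m then e m else 0 := by
    intro m hm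
    simp only [f, Polynomial.coeff_add, Polynomial.coeff_X_pow, hm.ne, if_false, zero_add,
      Polynomial.finsetSum_coeff, Polynomial.coeff_C_mul_X_pow]
    rw [Finset.sum_eq_single m]
    · simp
    · intro k _ hk
      rw [if_neg (Ne.symm hk)]
    · intro h
      exact absurd (Finset.mem_range.2 hm) h
  have hcoeff0 : ∀ m < d, f.coeff m ≠ 0 ↔ start m := by
    intro m hm
    rw [hcoeff m hm]
    split_ifs with h <;> simp [h, he m hm]
  have hf0 : f.eval 0 ≠ 0 := by
    rw [← Polynomial.coeff_zero_eq_eval_zero]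
    rcases Nat.eq_zero_or_pos d with h | h
    · have := hf.coeff_natDegree
      rw [hfd, h] at this
      simp [this]
    · exact (hcoeff0 0 h).2 (Or.inl rfl)
  refine ⟨f, hf, hf0, hfd, fun m hm => ?_⟩
  have hmd : m < f.natDegree := hfd.symm ▸ hm
  set L := lowerExp f m with hL
  set U := upperExp f m with hU
  have hLm : L ≤ m := lowerExp_le f m
  obtain ⟨hmU, hUc⟩ := upperExp_mem hf hmd
  have hUd : U ≤ d := hfd ▸ upperExp_le_natDegree hf hmd
  have hLs : start L := (hcoeff0 L (by omega)).1 (coeff_lowerExp_ne_zero hf0 m)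
  have hnot : ∀ k, L < k → k < U → σ k = σ (k - 1) + 1 := by
    intro k hk hkU
    by_contra hne
    have hk0 : f.coeff k ≠ 0 := (hcoeff0 k (by omega)).2 (Or.inr hne)
    rcases le_or_gt k m with h | h
    · exact hk0 (coeff_eq_zero_of_lowerExp_lt hk h)
    · exact absurd (upperExp_le h hk0) (not_le.2 hkU)
  have hrun : ∀ k, L ≤ k → k < U → σ k = σ L + (k - L) ∧ e k = e L := by
    intro k hk
    induction k, hk using Nat.le_induction with
    | base => simp
    | succ k hk ih =>
      intro hkU
      obtain ⟨h1, h2⟩ := ih (by omega)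
      have h3 := hnot (k + 1) (by omega) hkU
      rw [Nat.add_sub_cancel] at h3
      have h4 := hstep k (by omega)
      refine ⟨by omega, ?_⟩
      rcases h4 with h4 | h4
      · omega
      · rw [h4.2, h2]
  have hright : ∀ k, U ≤ k → k < d → σ k < σ L := by
    intro k hk
    induction k, hk using Nat.le_induction with
    | base =>
      intro hUd
      have h1 : start U := (hcoeff0 U hUd).1 hUc
      have h2 : σ U ≠ σ (U - 1) + 1 := by
        rcases h1 with h1 | h1
        · omega
        · exact h1
      have h3 := hstep (U - 1) (by omega)
      rw [show U - 1 + 1 = U by omega] at h3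
      have h4 := (hrun (U - 1) (by omega) (by omega)).1
      by_contra hge
      have h5 := (hrun (L + (σ U - σ L)) (by omega) (by omega)).1
      have := hinj U hUd (L + (σ U - σ L)) (by omega) (by omega)
      omega
    | succ k hk ih =>
      intro hkd
      have h1 := ih (by omega)
      have h2 := hstep k hkd
      have h3 : σ (k + 1) ≠ σ L := fun h => by
        have := hinj _ hkd _ (by omega) h
        omega
      omega
  have hleft : ∀ k, k < L → σ L < σ (L - 1 - k) := by
    intro k
    induction k with
    | zero =>
      intro hL0
      have h1 : σ L ≠ σ (L - 1) + 1 := by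
        rcases hLs with h1 | h1
        · omega
        · exact h1
      have h2 := hstep (L - 1) (by omega)
      rw [show L - 1 + 1 = L by omega] at h2
      simp only [Nat.sub_zero]
      omega
    | succ k ih =>
      intro hk
      have h1 := ih (by omega)
      have h2 := hstep (L - 1 - (k + 1)) (by omega)
      rw [show L - 1 - (k + 1) + 1 = L - 1 - k by omega] at h2
      have h3 : σ (L - 1 - (k + 1)) ≠ σ L := fun h => by
        have := hinj _ (by omega) _ (by omega) h
        omega
      omega
  have hset : (Finset.range d).filter (fun k => σ k < σ L) = Finset.Ico U d := by
    ext k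
    simp only [Finset.mem_filter, Finset.mem_range, Finset.mem_Ico]
    constructor
    · rintro ⟨hk, hkL⟩
      refine ⟨?_, hk⟩
      by_contra hlt
      rcases lt_or_ge k L with h | h
      · have := hleft (L - 1 - k) (by omega)
        rw [show L - 1 - (L - 1 - k) = k by omega] at this
        omega
      · have := (hrun k h (by omega)).1
        omega
    · rintro ⟨h1, h2⟩
      exact ⟨h2, hright k h1 h2⟩
  have hbij : (Finset.range d).image σ = Finset.range d := by
    refine Finset.eq_of_subset_of_card_le ?_ ?_
    · intro x hx
      obtain ⟨k, hk, rfl⟩ := Finset.mem_image.1 hx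
      exact Finset.mem_range.2 (hσ k (Finset.mem_range.1 hk))
    · rw [Finset.card_image_of_injOn]
      intro a ha b hb hab
      exact hinj a (Finset.mem_range.1 ha) b (Finset.mem_range.1 hb) hab
  have hcard : ((Finset.range d).filter fun k => σ k < σ L).card = σ L := by
    have h1 : ((Finset.range d).filter fun k => σ k < σ L).image σ = Finset.range (σ L) := by
      have h0 := Finset.filter_image (s := Finset.range d) (f := σ) (p := fun x => x < σ L)
      rw [hbij] at h0
      rw [← h0]
      ext x
      have := hσ L (by omega)
      simp only [Finset.mem_filter, Finset.mem_range]
      omega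
    conv_rhs => rw [← Finset.card_range (σ L), ← h1]
    rw [Finset.card_image_of_injOn]
    intro a ha b hb hab
    simp only [Finset.coe_filter, Finset.mem_range, Set.mem_ofPred_eq] at ha hb
    exact hinj a ha.1 b hb.1 hab
  rw [hset, Nat.card_Ico] at hcard
  have h1 := vRow_add hf hmd
  obtain ⟨h2, h3⟩ := hrun m hLm hmU
  refine ⟨by omega, ?_⟩
  rw [hcoeff L (by omega), if_pos hLs, h3]

end Local

/-! ### Blocks of a composition -/

section Blocks

variable {n : ℕ} (μ : Composition n)

/-- The position, counted from `0`, of an index inside its block. -/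
def posIn (s : Fin n) : ℕ := μ.invEmbedding s

lemma sizeUpTo_add_posIn (s : Fin n) : μ.sizeUpTo (μ.index s) + posIn μ s = s := by
  have := μ.sizeUpTo_index_le s
  rw [posIn, μ.coe_invEmbedding]
  omega

lemma posIn_lt (s : Fin n) : posIn μ s < μ.blocksFun (μ.index s) := (μ.invEmbedding s).2

variable {μ}

lemma eq_of_index_eq {s t : Fin n} (h : μ.index s = μ.index t) (h' : posIn μ s = posIn μ t) :
    s = t := by
  have h1 := sizeUpTo_add_posIn μ s
  have h2 := sizeUpTo_add_posIn μ t
  rw [h, h'] at h1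
  exact Fin.ext (h1.symm.trans h2)

lemma exists_index_posIn (j : Fin μ.length) {c : ℕ} (hc : c < μ.blocksFun j) :
    ∃ s, μ.index s = j ∧ posIn μ s = c :=
  ⟨μ.embedding j ⟨c, hc⟩, μ.index_embedding _ _, μ.invEmbedding_comp _ _⟩

lemma index_mono {s t : Fin n} (h : s ≤ t) : μ.index s ≤ μ.index t := by
  by_contra hlt
  have h1 := μ.lt_sizeUpTo_index_succ t
  have h2 := μ.sizeUpTo_index_le s
  have h3 : μ.sizeUpTo (μ.index t).succ ≤ μ.sizeUpTo (μ.index s) :=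
    μ.monotone_sizeUpTo (Nat.succ_le_of_lt (not_le.1 hlt))
  have h4 : (s : ℕ) ≤ t := h
  omega

lemma posIn_lt_iff {s t : Fin n} (h : μ.index s = μ.index t) :
    posIn μ s < posIn μ t ↔ s < t := by
  have h1 := sizeUpTo_add_posIn μ s
  have h2 := sizeUpTo_add_posIn μ t
  rw [h] at h1
  rw [Fin.lt_def]
  omega

variable (μ) in
/-- `j = i + 1` and `i ∉ B_μ`: the positions of the matrix on which `ψ_μ` depends. -/
def IsSimplePair (i j : Fin n) : Prop := (j : ℕ) = i + 1 ∧ (i : ℕ) + 1 ∉ partialSums μ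

lemma isSimplePair_iff {i j : Fin n} :
    IsSimplePair μ i j ↔ μ.index i = μ.index j ∧ posIn μ j = posIn μ i + 1 := by
  have h1 := sizeUpTo_add_posIn μ i
  have h2 := sizeUpTo_add_posIn μ j
  constructor
  · rintro ⟨hj, hB⟩
    have heq : μ.index i = μ.index j := by
      by_contra hne
      have hlt : μ.index i < μ.index j :=
        lt_of_le_of_ne (index_mono (by rw [Fin.le_def]; omega)) hne
      have h3 := μ.lt_sizeUpTo_index_succ i
      have h4 : μ.sizeUpTo (μ.index i).succ ≤ μ.sizeUpTo (μ.index j) :=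
        μ.monotone_sizeUpTo (Nat.succ_le_of_lt hlt)
      have h5 := μ.sizeUpTo_index_le j
      exact hB ⟨μ.index i, show (i : ℕ) + 1 = μ.sizeUpTo (μ.index i).succ by omega⟩
    rw [heq] at h1
    exact ⟨heq, by omega⟩
  · rintro ⟨heq, hpos⟩
    rw [heq] at h1
    refine ⟨by omega, ?_⟩
    rintro ⟨k, hk⟩
    have h3 := μ.lt_sizeUpTo_index_succ j
    have h4 := posIn_lt μ j
    rcases le_or_gt (μ.index j) k with h | h
    · have h5 : μ.sizeUpTo (μ.index j).succ ≤ μ.sizeUpTo (k + 1) :=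
        μ.monotone_sizeUpTo (Nat.succ_le_succ h)
      omega
    · have h5 : μ.sizeUpTo (k + 1) ≤ μ.sizeUpTo (μ.index j) :=
        μ.monotone_sizeUpTo (Nat.succ_le_of_lt h)
      omega

/-- The start of the `i`-th one of successive intervals of lengths `d`, the last one first. -/
def offset {l : ℕ} (d : Fin l → ℕ) (i : Fin l) : ℕ := ∑ k ∈ Finset.Ioi i, d k

lemma offset_add {l : ℕ} (d : Fin l → ℕ) (i : Fin l) :
    offset d i + d i = ∑ k ∈ Finset.Ici i, d k := by
  rw [offset, ← Finset.Ioi_insert i, Finset.sum_insert (by simp), add_comm]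

lemma offset_add_le_offset {l : ℕ} (d : Fin l → ℕ) {i i' : Fin l} (h : i < i') :
    offset d i' + d i' ≤ offset d i := by
  rw [offset_add]
  refine Finset.sum_le_sum_of_subset fun k hk => ?_
  simp only [Finset.mem_Ici, Finset.mem_Ioi] at hk ⊢
  exact h.trans_le hk

lemma offset_add_le_sum {l : ℕ} (d : Fin l → ℕ) (i : Fin l) : offset d i + d i ≤ ∑ k, d k := by
  rw [offset_add]
  exact Finset.sum_le_sum_of_subset (Finset.subset_univ _)

lemma offset_unique {l : ℕ} {d : Fin l → ℕ} {i i' : Fin l} {m m' : ℕ} (hm : m < d i)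
    (hm' : m' < d i') (h : offset d i + m = offset d i' + m') : i = i' ∧ m = m' := by
  have : i = i' := by
    rcases lt_trichotomy i i' with hlt | heq | hlt
    · have := offset_add_le_offset d hlt
      omega
    · exact heq
    · have := offset_add_le_offset d hlt
      omega
  subst this
  exact ⟨rfl, by omega⟩

lemma exists_offset {l : ℕ} {d : Fin l → ℕ} {c : ℕ} (hc : c < ∑ k, d k) :
    ∃ i, ∃ m < d i, c = offset d i + m := by
  have hne : (Finset.univ.filter fun i : Fin l => c < offset d i + d i).Nonempty := by
    cases l with
    | zero => simp at hc
    | succ l =>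
      refine ⟨0, ?_⟩
      simp only [Finset.mem_filter, Finset.mem_univ, true_and, offset_add]
      rwa [show Finset.Ici (0 : Fin (l + 1)) = Finset.univ by ext; simp]
  obtain ⟨i, hi, hmax⟩ := Finset.exists_max_image _ id hne
  simp only [Finset.mem_filter, Finset.mem_univ, true_and] at hi hmax
  have hle : offset d i ≤ c := by
    by_contra hlt
    by_cases hil : (i : ℕ) + 1 < l
    · have h1 := hmax ⟨i + 1, hil⟩ (by
        rw [offset_add, show Finset.Ici (⟨i + 1, hil⟩ : Fin l) = Finset.Ioi i by
          ext k
          rw [Finset.mem_Ici, Finset.mem_Ioi, Fin.le_def, Fin.lt_def, Nat.succ_le_iff]]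
        exact not_le.1 hlt)
      exact absurd (Fin.le_def.1 h1) (not_le.2 (Nat.lt_succ_self _))
    · have h0 : offset d i = 0 := by
        rw [offset, show Finset.Ioi i = ∅ by
          ext k
          rw [Finset.mem_Ioi, Fin.lt_def]
          have := k.2
          simp
          omega]
        rfl
      omega
  exact ⟨i, c - offset d i, by omega, by omega⟩

end Blocks

/-! ### The matrices `v_a` as monomial matrices -/

section Monomial

variable {F : Type u} [Field F] {n : ℕ} {μ : Composition n}

/-- The matrix whose only nonzero entry in column `s` is `c s`, in row `w s`. -/
def monomialMatrix (w : Equiv.Perm (Fin n)) (c : Fin n → F) : Matrix (Fin n) (Fin n) F :=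
  fun p s => if p = w s then c s else 0

/-- The condition on a monomial matrix `v` that `ψ_μ(u) = ψ_μ(v u v⁻¹)` imposes through the
elementary matrices `u = 1 + t E_{ij}` for which `v u v⁻¹ = 1 + t (c i / c j) E_{w i, w j}` is also
upper triangular. -/
def IsCompatible (μ : Composition n) (w : Equiv.Perm (Fin n)) (c : Fin n → F) : Prop :=
  ∀ i j, i < j → w i < w j →
    (IsSimplePair μ i j ↔ IsSimplePair μ (w i) (w j)) ∧ (IsSimplePair μ i j → c i = c j)

/-- The monomial matrix given by `w` and `c` is the one that the rule for `v_a` prescribes: column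
`s` is the `m`-th column of the group of columns of `a_{ij}`, where `j` is the block of `s` and `i`
the block of `w s`, and its nonzero entry is the one of `v_(a_{ij})` in column `m`. -/
def Describes (μ : Composition n) (a : Matrix (Fin μ.length) (Fin μ.length) F[X])
    (w : Equiv.Perm (Fin n)) (c : Fin n → F) : Prop :=
  ∀ s, ∃ m < (a (μ.index (w s)) (μ.index s)).natDegree,
    posIn μ s = offset (fun k => (a k (μ.index s)).natDegree) (μ.index (w s)) + m ∧
    posIn μ (w s) = offset (fun k => (a (μ.index (w s)) k).natDegree) (μ.index s) +
      vRow (a (μ.index (w s)) (μ.index s)) m ∧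
    c s = (a (μ.index (w s)) (μ.index s)).coeff
      (lowerExp (a (μ.index (w s)) (μ.index s)) m)

variable {a b : Matrix (Fin μ.length) (Fin μ.length) F[X]} {w : Equiv.Perm (Fin n)}
  {c : Fin n → F}

lemma exists_describes (ha : a ∈ Mset F μ) :
    ∃ (w : Equiv.Perm (Fin n)) (c : Fin n → F), Describes μ a w c ∧ ∀ s, c s ≠ 0 := by
  obtain ⟨hrow, hcol, hm⟩ := ha
  have hex : ∀ s, ∃ p, ∃ m < (a (μ.index p) (μ.index s)).natDegree,
      posIn μ s = offset (fun k => (a k (μ.index s)).natDegree) (μ.index p) + m ∧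
      posIn μ p = offset (fun k => (a (μ.index p) k).natDegree) (μ.index s) +
        vRow (a (μ.index p) (μ.index s)) m := by
    intro s
    obtain ⟨i, m, hmd, hs⟩ := exists_offset (d := fun k => (a k (μ.index s)).natDegree)
      (c := posIn μ s) (by rw [hcol]; exact posIn_lt μ s)
    have h1 := vRow_lt (hm i (μ.index s)).1 hmd
    have h2 := offset_add_le_sum (fun k => (a i k).natDegree) (μ.index s)
    rw [hrow] at h2
    obtain ⟨p, rfl, hp⟩ := exists_index_posIn i (c := offset (fun k => (a i k).natDegree)
      (μ.index s) + vRow (a i (μ.index s)) m) (by omega)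
    exact ⟨p, m, hmd, hs, hp⟩
  choose w m hmd hs hp using hex
  have hinj : Function.Injective w := by
    intro s t hst
    have h1 := hp s
    have h2 := hp t
    have h3 := vRow_lt (hm _ _).1 (hmd s)
    have h4 := vRow_lt (hm _ _).1 (hmd t)
    rw [hst] at h1 h3
    obtain ⟨hj, hv⟩ := offset_unique (d := fun k => (a (μ.index (w t)) k).natDegree) h3 h4
      (h1.symm.trans h2)
    have h5 := hmd s
    have h6 := hs s
    rw [hst, hj] at h5 h6
    rw [hj] at hv
    have h7 := vRow_injOn (hm _ _).1 h5 (hmd t) hv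
    exact eq_of_index_eq hj (by rw [h6, h7, ← hs t])
  refine ⟨Equiv.ofBijective w (Finite.injective_iff_bijective.1 hinj), fun s =>
    (a (μ.index (w s)) (μ.index s)).coeff (lowerExp (a (μ.index (w s)) (μ.index s)) (m s)),
    fun s => ⟨m s, hmd s, hs s, hp s, rfl⟩, fun s => coeff_lowerExp_ne_zero (hm _ _).2 _⟩

lemma Describes.vMatrix_eq (ha : a ∈ Mset F μ) (h : Describes μ a w c) :
    vMatrix μ a = monomialMatrix w c := by
  obtain ⟨hrow, hcol, hm⟩ := ha
  ext p s
  obtain ⟨m, hmd, hs, hp, hc⟩ := h s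
  unfold monomialMatrix
  simp only [vMatrix]
  change (if offset (fun k => (a (μ.index p) k).natDegree) (μ.index s) ≤ posIn μ p ∧
    offset (fun k => (a k (μ.index s)).natDegree) (μ.index p) ≤ posIn μ s then
    vPoly (a (μ.index p) (μ.index s))
      (posIn μ p - offset (fun k => (a (μ.index p) k).natDegree) (μ.index s))
      (posIn μ s - offset (fun k => (a k (μ.index s)).natDegree) (μ.index p)) else 0) = _
  split_ifs with h1 h2 h2
  · rw [h2, hs, hp, Nat.add_sub_cancel_left, Nat.add_sub_cancel_left, vPoly_eq (hm _ _).1 hmd,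
      if_pos rfl, hc]
  · by_cases hlt : posIn μ s - offset (fun k => (a k (μ.index s)).natDegree) (μ.index p) <
        (a (μ.index p) (μ.index s)).natDegree
    · obtain ⟨hi, hmm⟩ := offset_unique (d := fun k => (a k (μ.index s)).natDegree) hlt hmd (by
        rw [← hs]
        omega)
      rw [vPoly_eq (hm _ _).1 hlt, if_neg]
      intro hr
      refine h2 (eq_of_index_eq hi ?_)
      rw [hmm] at hr
      rw [hp]
      rw [hi] at hr h1
      omega
    · rw [vPoly, if_neg]
      exact fun h => hlt h.2.1
  · refine (h1 ?_).elim
    rw [h2]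
    omega
  · rfl

/-- Adjacent columns of a block with an ascent of `w` belong to the same summand of some
`v_(a_{ij})`, where `w` goes up by one and the coefficients agree. -/
lemma Describes.isCompatible (ha : a ∈ Mset F μ) (h : Describes μ a w c) :
    IsCompatible μ w c := by
  obtain ⟨hrow, hcol, hm⟩ := ha
  intro i j hij hwij
  obtain ⟨m, hmd, hs, hp, hc⟩ := h i
  obtain ⟨m', hmd', hs', hp', hc'⟩ := h j
  have hdir : IsSimplePair μ i j → IsSimplePair μ (w i) (w j) ∧ c i = c j := by
    intro hS
    obtain ⟨hb, hpos⟩ := isSimplePair_iff.1 hS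
    rw [hb] at hs hp hmd hc
    rcases (index_mono (μ := μ) hwij.le).lt_or_eq with hlt | heq
    · have := offset_add_le_offset (fun k => (a k (μ.index j)).natDegree) hlt
      omega
    · rw [heq] at hs hp hmd hc
      have hmm : m' = m + 1 := by omega
      subst hmm
      rcases vRow_dichotomy (hm _ _).1 m.lt_add_one hmd' with h1 | h1
      · exact ⟨isSimplePair_iff.2 ⟨heq, by omega⟩, by rw [hc, hc', h1.1]⟩
      · have := (posIn_lt_iff heq).2 hwij
        omega
  refine ⟨⟨fun hS => (hdir hS).1, fun hS => ?_⟩, fun hS => (hdir hS).2⟩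
  obtain ⟨hb, hpos⟩ := isSimplePair_iff.1 hS
  have hv := vRow_lt (hm _ _).1 hmd
  have hv' := vRow_lt (hm _ _).1 hmd'
  rw [hb] at hs hp hmd hv
  rcases (index_mono (μ := μ) hij.le).lt_or_eq with hlt | heq
  · have := offset_add_le_offset (fun k => (a (μ.index (w j)) k).natDegree) hlt
    omega
  · rw [heq] at hs hp hmd
    have h1 := (posIn_lt_iff heq).2 hij
    have h2 := vRow_dichotomy (hm _ _).1 (show m < m' by omega) hmd'
    exact isSimplePair_iff.2 ⟨heq, by omega⟩

variable (μ) in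
/-- The number of columns of the `j`-th block whose nonzero entries lie in the `i`-th block of
rows. -/
def blockCount (w : Equiv.Perm (Fin n)) (i j : Fin μ.length) : ℕ :=
  (Finset.univ.filter fun s => μ.index s = j ∧ μ.index (w s) = i).card

lemma card_index_eq (j : Fin μ.length) :
    (Finset.univ.filter fun s => μ.index s = j).card = μ.blocksFun j := by
  have h : ((Finset.univ.filter fun s => μ.index s = j).image (posIn μ)) =
      Finset.range (μ.blocksFun j) := by
    ext c
    simp only [Finset.mem_image, Finset.mem_filter, Finset.mem_univ, true_and, Finset.mem_range]
    constructor
    · rintro ⟨s, rfl, rfl⟩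
      exact posIn_lt μ s
    · exact exists_index_posIn j
  rw [← Finset.card_range (μ.blocksFun j), ← h, Finset.card_image_of_injOn]
  intro s hs t ht hst
  simp only [Finset.coe_filter, Finset.mem_univ, true_and, Set.mem_ofPred_eq] at hs ht
  exact eq_of_index_eq (hs.trans ht.symm) hst

lemma sum_blockCount_left (w : Equiv.Perm (Fin n)) (j : Fin μ.length) :
    ∑ i, blockCount μ w i j = μ.blocksFun j := by
  rw [← card_index_eq j, Finset.card_eq_sum_card_fiberwise (f := fun s => μ.index (w s))
    (t := Finset.univ) (by simp)]
  simp only [Finset.filter_filter]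
  rfl

lemma blockCount_symm (w : Equiv.Perm (Fin n)) (i j : Fin μ.length) :
    blockCount μ w.symm j i = blockCount μ w i j := by
  refine Finset.card_bij (fun p _ => w.symm p) ?_ (fun _ _ _ _ h => w.symm.injective h) ?_
  · intro p hp
    simpa [and_comm] using hp
  · intro s hs
    exact ⟨w s, by simpa [and_comm] using hs, by simp⟩

lemma sum_blockCount_right (w : Equiv.Perm (Fin n)) (i : Fin μ.length) :
    ∑ j, blockCount μ w i j = μ.blocksFun i := by
  simp only [← blockCount_symm w]
  exact sum_blockCount_left w.symm i

/-- In the columns of a block, from left to right, the nonzero entries move to earlier blocks of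
rows. -/
lemma index_antitone (hw : ∀ i j, i < j → w i < w j → IsSimplePair μ i j →
    IsSimplePair μ (w i) (w j)) {s t : Fin n} (hst : s ≤ t) (h : μ.index s = μ.index t) :
    μ.index (w t) ≤ μ.index (w s) := by
  obtain ⟨k, hk⟩ : ∃ k, posIn μ t = posIn μ s + k := by
    have h1 := sizeUpTo_add_posIn μ s
    have h2 := sizeUpTo_add_posIn μ t
    rw [h] at h1
    exact ⟨t - s, by rw [Fin.le_def] at hst; omega⟩
  clear hst
  induction k generalizing t with
  | zero => rw [eq_of_index_eq h hk.symm]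
  | succ k ih =>
    obtain ⟨t', ht', hp⟩ := exists_index_posIn (μ.index t) (c := posIn μ s + k) (by
      have := posIn_lt μ t
      omega)
    refine le_trans ?_ (ih (h.trans ht'.symm) hp)
    have hlt : t' < t := (posIn_lt_iff ht').1 (by omega)
    rcases lt_or_ge (w t') (w t) with h1 | h1
    · exact (isSimplePair_iff.1 (hw t' t hlt h1 (isSimplePair_iff.2 ⟨ht', by omega⟩))).1.ge
    · exact index_mono h1

/-- In every block, the columns whose nonzero entries lie in a given block of rows are consecutive,
and these groups of columns are ordered as in `v_a`: the columns to the left of the group of `s` are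
those that lead to later blocks of rows. -/
lemma exists_posIn_eq_offset (hw : ∀ i j, i < j → w i < w j → IsSimplePair μ i j →
    IsSimplePair μ (w i) (w j)) (s : Fin n) :
    ∃ m < blockCount μ w (μ.index (w s)) (μ.index s),
      posIn μ s = offset (fun k => blockCount μ w k (μ.index s)) (μ.index (w s)) + m := by
  -- the number of columns of the block of `s` that lead to the row blocks in `I`
  have hcount : ∀ I : Finset (Fin μ.length), ∑ k ∈ I, blockCount μ w k (μ.index s) =
      (Finset.univ.filter fun t => μ.index t = μ.index s ∧ μ.index (w t) ∈ I).card := by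
    intro I
    rw [Finset.card_eq_sum_card_fiberwise (f := fun t => μ.index (w t)) (t := I)
      (fun t ht => by
        simp only [Finset.coe_filter, Finset.mem_univ, true_and, Set.mem_ofPred_eq] at ht
        exact ht.2)]
    refine Finset.sum_congr rfl fun k hk => ?_
    rw [blockCount, Finset.filter_filter]
    congr 1
    ext t
    simp only [Finset.mem_filter, Finset.mem_univ, true_and]
    constructor
    · rintro ⟨h1, rfl⟩
      exact ⟨⟨h1, hk⟩, rfl⟩
    · rintro ⟨⟨h1, -⟩, h2⟩
      exact ⟨h1, h2⟩
  have hposcard : ∀ m ≤ μ.blocksFun (μ.index s),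
      (Finset.univ.filter fun t => μ.index t = μ.index s ∧ posIn μ t < m).card = m := by
    intro m hm
    have h : ((Finset.univ.filter fun t => μ.index t = μ.index s ∧ posIn μ t < m).image
        (posIn μ)) = Finset.range m := by
      ext c
      simp only [Finset.mem_image, Finset.mem_filter, Finset.mem_univ, true_and,
        Finset.mem_range]
      constructor
      · rintro ⟨t, ht, rfl⟩
        exact ht.2
      · intro hc
        obtain ⟨t, ht, rfl⟩ := exists_index_posIn (μ.index s) (hc.trans_le hm)
        exact ⟨t, ⟨ht, hc⟩, rfl⟩
    conv_rhs => rw [← Finset.card_range m, ← h]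
    rw [Finset.card_image_of_injOn]
    intro t ht t' ht' htt
    simp only [Finset.coe_filter, Finset.mem_univ, true_and, Set.mem_ofPred_eq] at ht ht'
    exact eq_of_index_eq (ht.1.trans ht'.1.symm) htt
  have hs := posIn_lt μ s
  have h1 : offset (fun k => blockCount μ w k (μ.index s)) (μ.index (w s)) ≤ posIn μ s := by
    rw [offset, hcount, ← hposcard (posIn μ s) hs.le]
    refine Finset.card_le_card fun t ht => ?_
    simp only [Finset.mem_filter, Finset.mem_univ, true_and, Finset.mem_Ioi] at ht ⊢
    refine ⟨ht.1, (posIn_lt_iff ht.1).2 ?_⟩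
    by_contra hle
    exact absurd (index_antitone hw (not_lt.1 hle) ht.1.symm) (not_le.2 ht.2)
  have h2 : posIn μ s + 1 ≤ offset (fun k => blockCount μ w k (μ.index s)) (μ.index (w s)) +
      blockCount μ w (μ.index (w s)) (μ.index s) := by
    rw [offset_add (fun k => blockCount μ w k (μ.index s)), hcount,
      ← hposcard (posIn μ s + 1) hs]
    refine Finset.card_le_card fun t ht => ?_
    simp only [Finset.mem_filter, Finset.mem_univ, true_and, Finset.mem_Ici] at ht ⊢
    refine ⟨ht.1, index_antitone hw ?_ ht.1⟩
    by_contra hlt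
    have := (posIn_lt_iff ht.1.symm).2 (not_le.1 hlt)
    omega
  exact ⟨posIn μ s - offset (fun k => blockCount μ w k (μ.index s)) (μ.index (w s)),
    by omega, by omega⟩

/-- Every compatible monomial matrix is of the form `v_a`. By `exists_posIn_eq_offset`, applied to
`w` and to its inverse, the columns of block `j` with nonzero entries in row block `i` are
consecutive, and so are these rows; `exists_vRow_eq` applies to the resulting square submatrix. -/
lemma IsCompatible.exists_describes (h : IsCompatible μ w c) (hc : ∀ s, c s ≠ 0) :
    ∃ a ∈ Mset F μ, Describes μ a w c := by
  have hcol := exists_posIn_eq_offset (μ := μ) (w := w) fun i j hij hwij =>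
    (h i j hij hwij).1.1
  have hrow : ∀ s, ∃ r < blockCount μ w (μ.index (w s)) (μ.index s),
      posIn μ (w s) = offset (fun k => blockCount μ w (μ.index (w s)) k) (μ.index s) + r := by
    intro s
    have h1 := exists_posIn_eq_offset (μ := μ) (w := w.symm) (fun i j hij hwij hS =>
      ((h _ _ hwij (by simpa using hij)).1.2 (by simpa using hS))) (w s)
    simpa only [blockCount_symm, Equiv.symm_apply_apply] using h1
  have hex : ∀ i j, ∃ f : F[X], f.Monic ∧ f.eval 0 ≠ 0 ∧ f.natDegree = blockCount μ w i j ∧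
      ∀ s m, μ.index s = j → μ.index (w s) = i → m < blockCount μ w i j →
        posIn μ s = offset (fun k => blockCount μ w k j) i + m →
        posIn μ (w s) = offset (fun k => blockCount μ w i k) j + vRow f m ∧
          c s = f.coeff (lowerExp f m) := by
    intro i j
    -- `S m` is the `m`-th column of the group
    have hS : ∀ m : ℕ, ∃ s, m < blockCount μ w i j → μ.index s = j ∧ μ.index (w s) = i ∧
        posIn μ s = offset (fun k => blockCount μ w k j) i + m := by
      intro m
      by_cases hm : m < blockCount μ w i j
      · have h1 := offset_add_le_sum (fun k => blockCount μ w k j) i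
        rw [sum_blockCount_left] at h1
        obtain ⟨s, hs, hp⟩ := exists_index_posIn j
          (c := offset (fun k => blockCount μ w k j) i + m) (by omega)
        obtain ⟨m', hm', hp'⟩ := hcol s
        rw [hs] at hm' hp'
        obtain ⟨hi, -⟩ := offset_unique (d := fun k => blockCount μ w k j) hm' hm
          (hp'.symm.trans hp)
        exact ⟨s, fun _ => ⟨hs, hi, hp⟩⟩
      · have hne : Nonempty (Fin n) := by
          have h2 := μ.one_le_blocksFun i
          obtain ⟨s, -, -⟩ := exists_index_posIn i (c := 0) h2
          exact ⟨s⟩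
        exact ⟨hne.some, fun hm' => absurd hm' hm⟩
    choose S hS using hS
    have hSrow : ∀ m < blockCount μ w i j, ∃ r < blockCount μ w i j,
        posIn μ (w (S m)) = offset (fun k => blockCount μ w i k) j + r := by
      intro m hm
      obtain ⟨h1, h2, h3⟩ := hS m hm
      simpa only [h1, h2] using hrow (S m)
    obtain ⟨f, hf, hf0, hfd, hfv⟩ : ∃ f : F[X], f.Monic ∧ f.eval 0 ≠ 0 ∧
        f.natDegree = blockCount μ w i j ∧ ∀ m < blockCount μ w i j,
          vRow f m = posIn μ (w (S m)) - offset (fun k => blockCount μ w i k) j ∧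
            f.coeff (lowerExp f m) = c (S m) := by
      refine exists_vRow_eq
        (σ := fun m => posIn μ (w (S m)) - offset (fun k => blockCount μ w i k) j)
        (e := fun m => c (S m)) ?_ ?_ ?_ fun m _ => hc _
      · intro m hm
        obtain ⟨r, hr, hr'⟩ := hSrow m hm
        omega
      · intro m hm m' hm' heq
        obtain ⟨r, hr, hr'⟩ := hSrow m hm
        obtain ⟨q, hq, hq'⟩ := hSrow m' hm'
        obtain ⟨h1, h2, h3⟩ := hS m hm
        obtain ⟨h1', h2', h3'⟩ := hS m' hm'
        have h4 : S m = S m' :=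
          w.injective (eq_of_index_eq (h2.trans h2'.symm) (by omega))
        rw [h4] at h3
        omega
      · intro m hm
        obtain ⟨r, hr, hr'⟩ := hSrow m (by omega)
        obtain ⟨q, hq, hq'⟩ := hSrow (m + 1) hm
        obtain ⟨h1, h2, h3⟩ := hS m (by omega)
        obtain ⟨h1', h2', h3'⟩ := hS (m + 1) hm
        have hSS : IsSimplePair μ (S m) (S (m + 1)) :=
          isSimplePair_iff.2 ⟨h1.trans h1'.symm, by omega⟩
        have hlt : S m < S (m + 1) := (posIn_lt_iff (h1.trans h1'.symm)).1 (by omega)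
        rcases lt_trichotomy (w (S m)) (w (S (m + 1))) with h4 | h4 | h4
        · right
          have h5 := h _ _ hlt h4
          have h6 := (isSimplePair_iff.1 (h5.1.1 hSS)).2
          exact ⟨by omega, (h5.2 hSS).symm⟩
        · exact absurd (w.injective h4) hlt.ne
        · left
          have := (posIn_lt_iff (h2'.trans h2.symm)).2 h4
          omega
    refine ⟨f, hf, hf0, hfd, fun s m hj hi hm hp => ?_⟩
    obtain ⟨h1, h2, h3⟩ := hS m hm
    obtain rfl : s = S m := eq_of_index_eq (hj.trans h1.symm) (hp.trans h3.symm)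
    obtain ⟨h4, h5⟩ := hfv m hm
    obtain ⟨r, -, hr⟩ := hSrow m hm
    exact ⟨by rw [h4]; omega, h5.symm⟩
  choose f hf hf0 hfd hfv using hex
  refine ⟨Matrix.of f, ⟨fun i => ?_, fun j => ?_, fun i j => ⟨hf i j, hf0 i j⟩⟩, fun s => ?_⟩
  · simp only [Matrix.of_apply, hfd]
    exact sum_blockCount_right w i
  · simp only [Matrix.of_apply, hfd]
    exact sum_blockCount_left w j
  · obtain ⟨m, hm, hs⟩ := hcol s
    obtain ⟨h1, h2⟩ := hfv _ _ s m rfl rfl hm hs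
    simp only [Matrix.of_apply, hfd]
    exact ⟨m, hm, hs, h1, h2⟩

lemma Describes.index_eq (h : Describes μ a w c) {s : Fin n} {i : Fin μ.length} {m : ℕ}
    (hm : m < (a i (μ.index s)).natDegree)
    (hs : posIn μ s = offset (fun k => (a k (μ.index s)).natDegree) i + m) :
    μ.index (w s) = i := by
  obtain ⟨m', hm', hs', -, -⟩ := h s
  exact (offset_unique (d := fun k => (a k (μ.index s)).natDegree) hm' hm
    (hs'.symm.trans hs)).1

lemma Describes.natDegree_eq (ha : a ∈ Mset F μ) (h : Describes μ a w c) (i j : Fin μ.length) :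
    (a i j).natDegree = blockCount μ w i j := by
  have himg : ((Finset.univ.filter fun s => μ.index s = j ∧ μ.index (w s) = i).image
      (posIn μ)) = (Finset.range (a i j).natDegree).image
        fun m => offset (fun k => (a k j).natDegree) i + m := by
    ext x
    simp only [Finset.mem_image, Finset.mem_filter, Finset.mem_univ, true_and, Finset.mem_range]
    constructor
    · rintro ⟨s, ⟨rfl, rfl⟩, rfl⟩
      obtain ⟨m, hm, hs, -, -⟩ := h s
      exact ⟨m, hm, hs.symm⟩
    · rintro ⟨m, hm, rfl⟩
      have h1 := offset_add_le_sum (fun k => (a k j).natDegree) i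
      rw [ha.2.1] at h1
      obtain ⟨s, rfl, hs⟩ := exists_index_posIn j
        (c := offset (fun k => (a k j).natDegree) i + m) (by omega)
      exact ⟨s, ⟨rfl, h.index_eq hm hs⟩, hs⟩
  have hcard := congrArg Finset.card himg
  rw [Finset.card_image_of_injOn, Finset.card_image_of_injective _ (add_right_injective _),
    Finset.card_range] at hcard
  · exact hcard.symm
  · intro s hs t ht hst
    simp only [Finset.coe_filter, Finset.mem_univ, true_and, Set.mem_ofPred_eq] at hs ht
    exact eq_of_index_eq (hs.1.trans ht.1.symm) hst

/-- The matrix `a` is determined by `v_a`: the degrees are the sizes of the square submatrices, and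
these determine the polynomials. -/
lemma Describes.unique (ha : a ∈ Mset F μ) (hb : b ∈ Mset F μ) (h : Describes μ a w c)
    (h' : Describes μ b w c) : a = b := by
  have hd : ∀ i j, (a i j).natDegree = (b i j).natDegree := fun i j => by
    rw [h.natDegree_eq ha, h'.natDegree_eq hb]
  ext1 i j
  refine eq_of_vRow_eq (ha.2.2 i j).1 (hb.2.2 i j).1 (ha.2.2 i j).2 (hb.2.2 i j).2 (hd i j)
    fun m hm => ?_
  have h1 := offset_add_le_sum (fun k => (a k j).natDegree) i
  rw [ha.2.1] at h1
  obtain ⟨s, rfl, hs⟩ := exists_index_posIn j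
    (c := offset (fun k => (a k j).natDegree) i + m) (by omega)
  obtain rfl := h.index_eq hm hs
  obtain ⟨m1, hm1, hs1, hp1, hc1⟩ := h s
  obtain ⟨m2, hm2, hs2, hp2, hc2⟩ := h' s
  simp only [← hd] at hs2 hp2
  obtain rfl : m1 = m := by omega
  obtain rfl : m2 = m1 := by omega
  exact ⟨by omega, by rw [← hc1, hc2]⟩

end Monomial

/-! ### The set `N_μ` and the bijection `a ↦ v_a` -/

section NSet

variable {F : Type u} [Field F] {n : ℕ} {μ : Composition n} {ψ : AddChar F ℂ}

lemma monomialMatrix_mul_inv (w : Equiv.Perm (Fin n)) {c : Fin n → F} (hc : ∀ s, c s ≠ 0) :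
    monomialMatrix w c * monomialMatrix w.symm (fun p => (c (w.symm p))⁻¹) = 1 := by
  ext p q
  rw [Matrix.mul_apply, Finset.sum_eq_single (w.symm q)]
  · by_cases h : p = q
    · subst h
      simp [monomialMatrix, hc]
    · simp [monomialMatrix, h]
  · intro s _ hs
    simp [monomialMatrix, hs]
  · simp

/-- The invertible monomial matrix given by a permutation and nonzero coefficients. -/
noncomputable def monomialGL (w : Equiv.Perm (Fin n)) (c : Fin n → F) (hc : ∀ s, c s ≠ 0) :
    GL (Fin n) F :=
  ⟨monomialMatrix w c, monomialMatrix w.symm (fun p => (c (w.symm p))⁻¹),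
    monomialMatrix_mul_inv w hc, mul_eq_one_comm.1 (monomialMatrix_mul_inv w hc)⟩

lemma monomialMatrix_isMonomial (w : Equiv.Perm (Fin n)) {c : Fin n → F} (hc : ∀ s, c s ≠ 0) :
    IsMonomial (monomialMatrix w c) := by
  refine ⟨fun p => ⟨w.symm p, by simp [monomialMatrix, hc], fun s hs => ?_⟩,
    fun s => ⟨w s, by simp [monomialMatrix, hc], fun p hp => ?_⟩⟩
  · by_contra hne
    refine hs (if_neg fun h => hne ?_)
    rw [h, Equiv.symm_apply_apply]
  · by_contra hne
    exact hp (if_neg hne)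

lemma IsMonomial.exists_monomialMatrix {v : Matrix (Fin n) (Fin n) F} (h : IsMonomial v) :
    ∃ (w : Equiv.Perm (Fin n)) (c : Fin n → F), (∀ s, c s ≠ 0) ∧ v = monomialMatrix w c := by
  choose w hw hw' using h.2
  have hinj : Function.Injective w := by
    intro s t hst
    obtain ⟨j, -, hj⟩ := h.1 (w s)
    rw [hj s (hw s), hj t (by simp only [hst]; exact hw t)]
  refine ⟨Equiv.ofBijective w (Finite.injective_iff_bijective.1 hinj), fun s => v (w s) s, hw, ?_⟩
  ext p s
  simp only [monomialMatrix, Equiv.ofBijective_apply]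
  split_ifs with hp
  · rw [hp]
  · by_contra hne
    exact hp (hw' s p hne)

lemma superdiagSum_eq (g : Matrix (Fin n) (Fin n) F) :
    superdiagSum μ g = open Classical in
      ∑ i : Fin n, ∑ j : Fin n, if IsSimplePair μ i j then g i j else 0 := by
  classical
  unfold superdiagSum
  exact Finset.sum_congr rfl fun i _ => Finset.sum_congr rfl fun j _ => if_congr Iff.rfl rfl rfl

lemma conj_apply_mul {w : Equiv.Perm (Fin n)} {c : Fin n → F} {v u : GL (Fin n) F}
    (hv : v.1 = monomialMatrix w c) (i j : Fin n) :
    (v * u * v⁻¹).1 (w i) (w j) * c j = c i * u.1 i j := by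
  have h : (v * u * v⁻¹).1 * v.1 = v.1 * u.1 := by
    rw [← Units.val_mul, ← Units.val_mul, inv_mul_cancel_right]
  have h1 := congrFun (congrFun h (w i)) j
  rw [Matrix.mul_apply, Matrix.mul_apply, Finset.sum_eq_single (w j),
    Finset.sum_eq_single i] at h1
  · simpa [hv, monomialMatrix] using h1
  · intro k _ hk
    have : ¬ w i = w k := fun h => hk (w.injective h).symm
    simp [hv, monomialMatrix, this]
  · simp
  · intro p _ hp
    simp [hv, monomialMatrix, hp]
  · simp

lemma superdiagSum_conj {w : Equiv.Perm (Fin n)} {c : Fin n → F} (hc : ∀ s, c s ≠ 0)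
    {v u : GL (Fin n) F} (hv : v.1 = monomialMatrix w c) :
    superdiagSum μ (v * u * v⁻¹).1 = open Classical in
      ∑ i : Fin n, ∑ j : Fin n,
        if IsSimplePair μ (w i) (w j) then c i * u.1 i j / c j else 0 := by
  classical
  rw [superdiagSum_eq, ← Equiv.sum_comp w]
  refine Finset.sum_congr rfl fun i _ => ?_
  rw [← Equiv.sum_comp w]
  refine Finset.sum_congr rfl fun j _ => ?_
  rw [← conj_apply_mul hv, mul_div_cancel_right₀ _ (hc j)]

lemma IsSimplePair.lt {i j : Fin n} (h : IsSimplePair μ i j) : i < j := by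
  have := h.1
  rw [Fin.lt_def]
  omega

/-- The elementary matrix `1 + t E_{ij}` with `i ≠ j`, as an element of the general linear group. -/
noncomputable def transvectionGL (i j : Fin n) (hij : i ≠ j) (t : F) : GL (Fin n) F :=
  ⟨Matrix.transvection i j t, Matrix.transvection i j (-t),
    by rw [Matrix.transvection_mul_transvection_same _ _ hij]; simp,
    by rw [Matrix.transvection_mul_transvection_same _ _ hij]; simp⟩

lemma transvectionGL_apply (i j : Fin n) (hij : i ≠ j) (t : F) (a b : Fin n) :
    (transvectionGL i j hij t).1 a b =
      (if a = b then 1 else 0) + if i = a ∧ j = b then t else 0 := by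
  simp [transvectionGL, Matrix.transvection, Matrix.one_apply, Matrix.single_apply]

lemma transvectionGL_mem {i j : Fin n} (hij : i < j) (t : F) :
    transvectionGL i j hij.ne t ∈ unipotentSubgroup F n := by
  refine ⟨fun a b hab => ?_, fun a => ?_⟩
  · have hab : b < a := hab
    rw [transvectionGL_apply, if_neg hab.ne', if_neg, add_zero]
    rintro ⟨rfl, rfl⟩
    exact absurd hab hij.asymm
  · rw [transvectionGL_apply, if_pos rfl, if_neg, add_zero]
    rintro ⟨rfl, rfl⟩
    exact lt_irrefl _ hij

lemma conj_transvectionGL_mem {w : Equiv.Perm (Fin n)} {c : Fin n → F} (hc : ∀ s, c s ≠ 0)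
    {v : GL (Fin n) F} (hv : v.1 = monomialMatrix w c) {i j : Fin n} (hij : i < j)
    (hwij : w i < w j) (t : F) :
    v * transvectionGL i j hij.ne t * v⁻¹ ∈ unipotentSubgroup F n := by
  refine ⟨fun a b hab => ?_, fun a => ?_⟩
  · have hab : b < a := hab
    have h := conj_apply_mul (u := transvectionGL i j hij.ne t) hv (w.symm a) (w.symm b)
    rw [transvectionGL_apply, if_neg (fun h => hab.ne' (w.symm.injective h)), if_neg] at h
    · simpa [hc] using h
    · rintro ⟨rfl, rfl⟩
      simp only [Equiv.apply_symm_apply] at hwij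
      exact absurd hab hwij.asymm
  · have h := conj_apply_mul (u := transvectionGL i j hij.ne t) hv (w.symm a) (w.symm a)
    rw [transvectionGL_apply, if_pos rfl, if_neg] at h
    · simpa [mul_comm, hc] using h
    · rintro ⟨h1, h2⟩
      exact hij.ne (h1.trans h2.symm)

/-- A function of the entries that vanishes on the diagonal picks out the only off-diagonal entry of
an elementary matrix. -/
lemma sum_sum_transvectionGL {i j : Fin n} (hij : i ≠ j) (t : F) (k : Fin n → Fin n → F)
    (hk : ∀ a, k a a = 0) :
    ∑ a, ∑ b, k a b * (transvectionGL i j hij t).1 a b = k i j * t := by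
  rw [Finset.sum_eq_single i, Finset.sum_eq_single j]
  · simp [transvectionGL_apply, hij]
  · intro b _ hb
    rw [transvectionGL_apply, if_neg (c := i = i ∧ j = b) (fun h => hb h.2.symm)]
    split_ifs with h
    · subst h
      simp [hk]
    · simp
  · simp
  · intro a _ ha
    refine Finset.sum_eq_zero fun b _ => ?_
    rw [transvectionGL_apply, if_neg (c := i = a ∧ j = b) (fun h => ha h.1.symm)]
    split_ifs with h
    · subst h
      simp [hk]
    · simp
  · simp

lemma AddChar.eq_zero_of_forall_mul {x : F} (hψ : ψ ≠ 1) (h : ∀ t, ψ (x * t) = 1) : x = 0 := by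
  by_contra hx
  refine hψ (DFunLike.ext _ _ fun t => ?_)
  have := h (x⁻¹ * t)
  rwa [mul_inv_cancel_left₀ hx] at this

/-- `N_μ` consists of the monomial matrices that satisfy the combinatorial condition. -/
theorem mem_Nset_iff (hψ : ψ ≠ 1) {w : Equiv.Perm (Fin n)} {c : Fin n → F} (hc : ∀ s, c s ≠ 0)
    {v : GL (Fin n) F} (hv : v.1 = monomialMatrix w c) : v ∈ Nset ψ μ ↔ IsCompatible μ w c := by
  classical
  constructor
  · rintro ⟨-, hN⟩ i j hij hwij
    have h1 : ∀ t : F, ψ ((if IsSimplePair μ i j then 1 else 0) * t) =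
        ψ ((if IsSimplePair μ (w i) (w j) then c i / c j else 0) * t) := by
      intro t
      have h2 : ψ (superdiagSum μ _) = ψ (superdiagSum μ _) :=
        hN _ (transvectionGL_mem hij t) (conj_transvectionGL_mem hc hv hij hwij t)
      rw [superdiagSum_conj hc hv, superdiagSum_eq] at h2
      rw [← sum_sum_transvectionGL hij.ne t (fun a b => if IsSimplePair μ a b then 1 else 0)
          fun a => if_neg fun h => lt_irrefl _ h.lt,
        ← sum_sum_transvectionGL hij.ne t
          (fun a b => if IsSimplePair μ (w a) (w b) then c a / c b else 0)
          fun a => if_neg fun h => lt_irrefl _ h.lt]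
      convert h2 using 6 with a _ b _ a _ b _
      · simp
      · split_ifs <;> ring
    by_cases hS : IsSimplePair μ i j <;> by_cases hS' : IsSimplePair μ (w i) (w j) <;>
      simp only [hS, hS', if_true, if_false] at h1
    · refine ⟨by simp [hS, hS'], fun _ => ?_⟩
      have h2 : 1 - c i / c j = 0 := AddChar.eq_zero_of_forall_mul hψ fun t => by
        rw [sub_mul, AddChar.map_sub_eq_div, h1, div_self (ψ.val_isUnit _).ne_zero]
      rw [sub_eq_zero, eq_comm, div_eq_one_iff_eq (hc j)] at h2
      exact h2
    · exact absurd (AddChar.eq_zero_of_forall_mul hψ fun t => by rw [h1]; simp) one_ne_zero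
    · exact absurd (AddChar.eq_zero_of_forall_mul hψ fun t => by rw [← h1]; simp)
        (div_ne_zero (hc i) (hc j))
    · exact ⟨by simp [hS, hS'], fun h => absurd h hS⟩
  · intro h
    refine ⟨hv ▸ monomialMatrix_isMonomial w hc, fun u hu hvu => ?_⟩
    change ψ (superdiagSum μ u.1) = ψ (superdiagSum μ (v * u * v⁻¹).1)
    rw [superdiagSum_conj hc hv, superdiagSum_eq]
    congr 1
    refine Finset.sum_congr rfl fun i _ => Finset.sum_congr rfl fun j _ => ?_
    rcases lt_trichotomy i j with hij | hij | hij
    · rcases lt_trichotomy (w i) (w j) with hw | hw | hw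
      · obtain ⟨h1, h2⟩ := h i j hij hw
        by_cases hS : IsSimplePair μ i j
        · rw [if_pos hS, if_pos (h1.1 hS), h2 hS, mul_div_cancel_left₀ _ (hc j)]
        · rw [if_neg hS, if_neg fun hS' => hS (h1.2 hS')]
      · exact absurd (w.injective hw) hij.ne
      · have h1 := conj_apply_mul (u := u) hv i j
        have h2 : (v * u * v⁻¹).1 (w i) (w j) = 0 := hvu.1 hw
        rw [h2, zero_mul, eq_comm, mul_eq_zero, or_iff_right (hc i)] at h1
        simp [h1]
    · subst hij
      rw [if_neg fun hS => lt_irrefl _ hS.lt, if_neg fun hS => lt_irrefl _ hS.lt]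
    · have h1 : u.1 i j = 0 := hu.1 hij
      rw [if_neg fun hS => absurd hij hS.lt.asymm, h1]
      simp

/-- The map `a ↦ v_a` is a bijection from `M_μ` to `N_μ`. -/
theorem exists_equiv_Mset (hψ : ψ ≠ 1) (μ : Composition n) :
    ∃ A : Nset ψ μ ≃ Mset F μ, ∀ v : Nset ψ μ, vMatrix μ (A v).1 = v.1.1 := by
  have hex : ∀ a : Mset F μ, ∃ v : Nset ψ μ, vMatrix μ a.1 = v.1.1 := by
    rintro ⟨a, ha⟩
    obtain ⟨w, c, h, hc⟩ := exists_describes ha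
    exact ⟨⟨monomialGL w c hc, (mem_Nset_iff hψ hc rfl).2 (h.isCompatible ha)⟩, h.vMatrix_eq ha⟩
  choose V hV using hex
  have hbij : Function.Bijective V := by
    refine ⟨fun a b hab => ?_, fun v => ?_⟩
    · obtain ⟨w, c, h, hc⟩ := exists_describes a.2
      obtain ⟨w', c', h', hc'⟩ := exists_describes b.2
      have heq : monomialMatrix w c = monomialMatrix w' c' := by
        rw [← h.vMatrix_eq a.2, ← h'.vMatrix_eq b.2, hV, hV, hab]
      have hw : w = w' := by
        ext1 s
        by_contra hne
        have h1 := congrFun (congrFun heq (w s)) s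
        simp [monomialMatrix, hne, hc s] at h1
      subst hw
      have hcc : c = c' := by
        funext s
        have h1 := congrFun (congrFun heq (w s)) s
        simpa [monomialMatrix] using h1
      subst hcc
      exact Subtype.ext (h.unique a.2 b.2 h')
    · obtain ⟨w, c, hc, hv⟩ := v.2.1.exists_monomialMatrix
      obtain ⟨a, ha, h⟩ := ((mem_Nset_iff hψ hc hv).1 v.2).exists_describes hc
      refine ⟨⟨a, ha⟩, Subtype.ext (Units.ext ?_)⟩
      rw [← hV, h.vMatrix_eq ha, hv]
  refine ⟨(Equiv.ofBijective V hbij).symm, fun v => ?_⟩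
  rw [hV]
  exact congrArg (fun v : Nset ψ μ => v.1.1) ((Equiv.ofBijective V hbij).apply_symm_apply v)

end NSet

/-! ### The endomorphism algebra of a representation induced from a linear character -/

section Mackey

open Representation

/-- The one-dimensional representation given by a linear character. -/
noncomputable abbrev charRep {U : Type*} [Group U] (χ : U →* ℂ) : Representation ℂ U ℂ :=
  ((algebraMap ℂ (Module.End ℂ ℂ)) : ℂ →* Module.End ℂ ℂ).comp χ

variable {G : Type u} [Group G] {U : Subgroup G} (χ : U →* ℂ)

/-- The space of the representation induced from a linear character. -/
abbrev IndChar := IndV U.subtype (charRep χ)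

/-- The generators of the induced representation: the class of `h ⊗ 1`, for `h` in the group. -/
noncomputable def indGenerator (h : G) : IndChar χ := IndV.mk U.subtype (charRep χ) h 1

variable {χ}

lemma linearChar_mul_inv (u : U) : χ u * χ u⁻¹ = 1 := by
  rw [← map_mul, mul_inv_cancel, map_one]

lemma indGenerator_mul (u : U) (h : G) :
    χ u • indGenerator χ (u * h) = indGenerator χ h := by
  have h1 := Coinvariants.mk_self_apply
    (Representation.tprod ((leftRegular ℂ G).comp U.subtype) (charRep χ)) u
    (TensorProduct.tmul ℂ (MonoidAlgebra.single h (1 : ℂ)) 1)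
  refine Eq.trans ?_ h1
  simp only [indGenerator, LinearMap.coe_comp, Function.comp_apply, TensorProduct.mk_apply,
    ← map_smul, ← TensorProduct.tmul_smul]
  simp [ofMulAction_single]

lemma ind_indGenerator (g h : G) :
    ind U.subtype (charRep χ) g (indGenerator χ h) = indGenerator χ (h * g⁻¹) :=
  ind_mk _ _ _ _ _

lemma indChar_hom_ext {W : Type*} [AddCommGroup W] [Module ℂ W] {S T : IndChar χ →ₗ[ℂ] W}
    (h : ∀ g, S (indGenerator χ g) = T (indGenerator χ g)) : S = T :=
  IndV.hom_ext _ _ fun g => LinearMap.ext_ring (h g)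

/-- The universal property of the representation induced from a linear character, as a vector
space: it is spanned by the vectors `indGenerator χ h`, with the relations of `indGenerator_mul`. -/
lemma exists_indChar_hom {W : Type*} [AddCommGroup W] [Module ℂ W] (φ : G → W)
    (hφ : ∀ (u : U) h, χ u • φ (u * h) = φ h) :
    ∃ T : IndChar χ →ₗ[ℂ] W, ∀ h, T (indGenerator χ h) = φ h := by
  refine ⟨Coinvariants.lift _ (TensorProduct.lift
    ((Finsupp.lift (ℂ →ₗ[ℂ] W) ℂ G fun h => LinearMap.toSpanSingleton ℂ W (φ h)) ∘ₗ
      (MonoidAlgebra.coeffLinearEquiv ℂ).toLinearMap)) fun u => ?_, fun h => ?_⟩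
  · ext h
    simp only [LinearMap.coe_comp, Function.comp_apply, MonoidAlgebra.lsingle_apply]
    simp [ofMulAction_single, hφ]
  · simp [indGenerator]

open Classical in
variable (χ) in
/-- The extension by zero of a linear character of a subgroup. -/
noncomputable def extendChar (g : G) : ℂ := if h : g ∈ U then χ ⟨g, h⟩ else 0

lemma extendChar_mul_left (u : U) (g : G) : extendChar χ (u * g) = χ u * extendChar χ g := by
  unfold extendChar
  by_cases hg : g ∈ U
  · rw [dif_pos hg, dif_pos (mul_mem u.2 hg), ← map_mul]
    rfl
  · rw [dif_neg hg, dif_neg (fun h => hg ((Subgroup.mul_mem_cancel_left U u.2).1 h)), mul_zero]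

lemma extendChar_mul_right (u : U) (g : G) : extendChar χ (g * u) = χ u * extendChar χ g := by
  unfold extendChar
  by_cases hg : g ∈ U
  · rw [dif_pos hg, dif_pos (mul_mem hg u.2), mul_comm, ← map_mul]
    rfl
  · rw [dif_neg hg, dif_neg (fun h => hg ((Subgroup.mul_mem_cancel_right U u.2).1 h)), mul_zero]

lemma sum_extendChar [Fintype G] [Fintype U] {W : Type*} [AddCommGroup W] [Module ℂ W]
    (φ : G → W) : ∑ g, extendChar χ g • φ g = ∑ u : U, χ u • φ u := by
  classical
  rw [← Finset.sum_subset (Finset.subset_univ (Finset.univ.image ((↑) : U → G))),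
    Finset.sum_image (fun _ _ _ _ => Subtype.ext)]
  · refine Finset.sum_congr rfl fun u _ => ?_
    rw [extendChar, dif_pos u.2]
  · intro g _ hg
    have : g ∉ U := fun h => hg (Finset.mem_image.2 ⟨⟨g, h⟩, Finset.mem_univ _, rfl⟩)
    rw [extendChar, dif_neg this, zero_smul]

variable (χ) in
/-- The realisation of the induced representation on functions on the group. -/
lemma exists_toFunctions :
    ∃ K : IndChar χ →ₗ[ℂ] G → ℂ, ∀ h g, K (indGenerator χ h) g = extendChar χ (g * h⁻¹) := by
  obtain ⟨K, hK⟩ := exists_indChar_hom (χ := χ) (fun h g => extendChar χ (g * h⁻¹)) (by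
    intro u h
    ext g
    have := extendChar_mul_right (χ := χ) u⁻¹ (g * h⁻¹)
    simp only [Pi.smul_apply, mul_inv_rev, smul_eq_mul, ← mul_assoc]
    push_cast at this
    rw [this, ← mul_assoc, linearChar_mul_inv, one_mul])
  exact ⟨K, fun h g => by rw [hK]⟩

variable (χ) in
/-- The embedding of the induced representation into the functions on the group, on which the
group acts by right translations. Its image consists of the functions `f` with
`f (u * g) = χ u * f g`. -/
noncomputable def toFunctions : IndChar χ →ₗ[ℂ] G → ℂ := (exists_toFunctions χ).choose

lemma toFunctions_indGenerator (h g : G) :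
    toFunctions χ (indGenerator χ h) g = extendChar χ (g * h⁻¹) :=
  (exists_toFunctions χ).choose_spec h g

lemma toFunctions_mul (u : U) (x : IndChar χ) (g : G) :
    toFunctions χ x (u * g) = χ u * toFunctions χ x g := by
  have : (LinearMap.proj (u * g : G) ∘ₗ toFunctions χ : IndChar χ →ₗ[ℂ] ℂ) =
      χ u • (LinearMap.proj g ∘ₗ toFunctions χ) := by
    refine indChar_hom_ext fun h => ?_
    simp only [LinearMap.coe_comp, Function.comp_apply, LinearMap.smul_apply, LinearMap.proj_apply,
      toFunctions_indGenerator, smul_eq_mul]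
    rw [mul_assoc, extendChar_mul_left]
  simpa using LinearMap.congr_fun this x

lemma toFunctions_ind (k : G) (x : IndChar χ) (g : G) :
    toFunctions χ (ind U.subtype (charRep χ) k x) g = toFunctions χ x (g * k) := by
  have : (LinearMap.proj g ∘ₗ toFunctions χ ∘ₗ ind U.subtype (charRep χ) k :
      IndChar χ →ₗ[ℂ] ℂ) = LinearMap.proj (g * k) ∘ₗ toFunctions χ := by
    refine indChar_hom_ext fun h => ?_
    simp only [LinearMap.coe_comp, Function.comp_apply, LinearMap.proj_apply, ind_indGenerator,
      toFunctions_indGenerator]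
    rw [mul_inv_rev, inv_inv, mul_assoc]
  simpa using LinearMap.congr_fun this x

variable (χ) in
/-- The algebra of endomorphisms of the induced representation. -/
noncomputable abbrev IndEnd := Subalgebra.centralizer ℂ (Set.range (ind U.subtype (charRep χ)))

lemma IndEnd.comm (T : IndEnd χ) (g : G) (x : IndChar χ) :
    T.1 (ind U.subtype (charRep χ) g x) = ind U.subtype (charRep χ) g (T.1 x) :=
  (LinearMap.congr_fun (T.2 _ ⟨g, rfl⟩) x).symm

variable (χ) in
/-- The function on the group that corresponds to an endomorphism `T` of the induced
representation: the image under `T` of the generator. -/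
noncomputable def IndEnd.toFunctions : IndEnd χ →ₗ[ℂ] G → ℂ :=
  UnipotentHecke.toFunctions χ ∘ₗ LinearMap.applyₗ (indGenerator χ 1) ∘ₗ
    (IndEnd χ).val.toLinearMap

lemma IndEnd.toFunctions_apply (T : IndEnd χ) :
    IndEnd.toFunctions χ T = UnipotentHecke.toFunctions χ (T.1 (indGenerator χ 1)) := rfl

lemma IndEnd.toFunctions_mul_left (T : IndEnd χ) (u : U) (g : G) :
    IndEnd.toFunctions χ T (u * g) = χ u * IndEnd.toFunctions χ T g :=
  UnipotentHecke.toFunctions_mul _ _ _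

lemma IndEnd.toFunctions_mul_right (T : IndEnd χ) (u : U) (g : G) :
    IndEnd.toFunctions χ T (g * u) = χ u * IndEnd.toFunctions χ T g := by
  rw [IndEnd.toFunctions_apply, ← toFunctions_ind, ← IndEnd.comm, ind_indGenerator, one_mul]
  have h := indGenerator_mul (χ := χ) u⁻¹ 1
  rw [mul_one] at h
  have h2 : indGenerator χ ((u : G)⁻¹) = χ u • indGenerator χ 1 := by
    rw [← h, smul_smul, linearChar_mul_inv, one_smul]
    rfl
  rw [h2]
  simp

variable [Finite G]

/-- A vector is recovered from its function `f`, up to the factor `|U|`, as the combination of the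
generators with coefficients `f`. -/
lemma toFunctions_injective : Function.Injective (toFunctions χ) := by
  classical
  have := Fintype.ofFinite G
  have hinv : ((Fintype.linearCombination ℂ (indGenerator χ) ∘ₗ toFunctions χ :
      IndChar χ →ₗ[ℂ] IndChar χ)) = (Fintype.card U : ℂ) • LinearMap.id := by
    refine indChar_hom_ext fun h => ?_
    simp only [LinearMap.coe_comp, Function.comp_apply, LinearMap.smul_apply, LinearMap.id_apply,
      Fintype.linearCombination_apply, toFunctions_indGenerator]
    rw [← Equiv.sum_comp (Equiv.mulRight h)]
    simp only [Equiv.coe_mulRight, mul_inv_cancel_right,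
      sum_extendChar (fun g => indGenerator χ (g * h)),
      indGenerator_mul, Finset.sum_const, Finset.card_univ]
    exact (Nat.cast_smul_eq_nsmul ℂ _ _).symm
  intro x y hxy
  have h1 := LinearMap.congr_fun hinv x
  have h2 := LinearMap.congr_fun hinv y
  simp only [LinearMap.coe_comp, Function.comp_apply, hxy] at h1 h2
  rw [h1] at h2
  simpa using h2

instance : FiniteDimensional ℂ (IndChar χ) :=
  FiniteDimensional.of_injective (toFunctions χ) toFunctions_injective

/-- The functions with `f (u * g) = χ u * f g` are realised by vectors. -/
lemma exists_toFunctions_eq (f : G → ℂ) (hf : ∀ (u : U) g, f (u * g) = χ u * f g) :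
    ∃ x, toFunctions χ x = f := by
  classical
  have := Fintype.ofFinite G
  refine ⟨(Fintype.card U : ℂ)⁻¹ • Fintype.linearCombination ℂ (indGenerator χ) f, ?_⟩
  rw [map_smul, inv_smul_eq_iff₀ (by simp)]
  ext g
  simp only [Fintype.linearCombination_apply, map_sum, map_smul, Finset.sum_apply, Pi.smul_apply,
    toFunctions_indGenerator, smul_eq_mul]
  rw [← Equiv.sum_comp (Equiv.inv G), ← Equiv.sum_comp (Equiv.mulLeft g⁻¹)]
  simp only [Equiv.inv_apply, Equiv.coe_mulLeft, mul_inv_rev, inv_inv, mul_inv_cancel_left]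
  have h := sum_extendChar (χ := χ) (fun k : G => f (k⁻¹ * g))
  simp only [smul_eq_mul] at h
  simp only [mul_comm _ (extendChar χ _), h]
  have h2 : ∀ u : U, χ u * f (((u : G))⁻¹ * g) = f g := by
    intro u
    have := hf u⁻¹ g
    push_cast at this
    rw [this, ← mul_assoc, linearChar_mul_inv, one_mul]
  simp [h2]

/-- An endomorphism is determined by the image of the generator `indGenerator χ 1`, since the group
permutes the generators transitively. -/
lemma IndEnd.toFunctions_injective : Function.Injective (IndEnd.toFunctions χ) := by
  intro S T h
  have h1 : S.1 (indGenerator χ 1) = T.1 (indGenerator χ 1) :=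
    UnipotentHecke.toFunctions_injective h
  refine Subtype.ext (indChar_hom_ext fun g => ?_)
  have h2 : indGenerator χ g = ind U.subtype (charRep χ) g⁻¹ (indGenerator χ 1) := by
    rw [ind_indGenerator, inv_inv, one_mul]
  rw [h2, IndEnd.comm, IndEnd.comm, h1]

/-- The endomorphisms of the induced representation are the functions on the group that transform
by the character under translations from both sides. -/
lemma IndEnd.exists_toFunctions_eq (f : G → ℂ) (hl : ∀ (u : U) g, f (u * g) = χ u * f g)
    (hr : ∀ (u : U) g, f (g * u) = χ u * f g) : ∃ T, IndEnd.toFunctions χ T = f := by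
  obtain ⟨x, hx⟩ := UnipotentHecke.exists_toFunctions_eq f hl
  have hux : ∀ u : U, ind U.subtype (charRep χ) u x = χ u • x := by
    intro u
    apply UnipotentHecke.toFunctions_injective
    ext g
    rw [toFunctions_ind, hx, hr, map_smul, hx]
    rfl
  obtain ⟨T, hT⟩ := exists_indChar_hom (χ := χ) (fun h => ind U.subtype (charRep χ) h⁻¹ x) (by
    intro u h
    have h1 := hux u⁻¹
    push_cast at h1
    rw [mul_inv_rev, map_mul, Module.End.mul_apply, h1, map_smul, smul_smul, linearChar_mul_inv,
      one_smul])
  refine ⟨⟨T, ?_⟩, ?_⟩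
  · rintro _ ⟨g, rfl⟩
    refine indChar_hom_ext fun h => ?_
    rw [Module.End.mul_apply, Module.End.mul_apply, ind_indGenerator, hT, hT, mul_inv_rev, inv_inv,
      map_mul]
    rfl
  · rw [IndEnd.toFunctions_apply]
    change UnipotentHecke.toFunctions χ (T (indGenerator χ 1)) = f
    rw [hT, inv_one, map_one]
    exact hx

variable (χ) in
/-- The elements `v` of a set at which a function that transforms by `χ` from both sides may be
nonzero. -/
def intertwiningSet (N : Set G) : Set G :=
  {v | v ∈ N ∧ ∀ (u : G) (hu : u ∈ U) (hvu : v * u * v⁻¹ ∈ U),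
    χ ⟨u, hu⟩ = χ ⟨v * u * v⁻¹, hvu⟩}

/-- Mackey's theorem for a linear character: the dimension of the endomorphism algebra of the
induced representation is the number of double cosets that support a function which transforms by
the character from both sides. -/
theorem finrank_indEnd (N : Set G) (hN : ∀ g, ∃ v ∈ N, ∃ u₁ u₂ : U, g = u₁ * v * u₂)
    (hN' : ∀ v ∈ N, ∀ v' ∈ N, ∀ u₁ u₂ : U, v' = u₁ * v * u₂ → v = v') :
    FiniteDimensional ℂ (IndEnd χ) ∧
      Module.finrank ℂ (IndEnd χ) = Nat.card (intertwiningSet χ N) := by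
  classical
  have := Fintype.ofFinite (intertwiningSet χ N)
  let R : IndEnd χ →ₗ[ℂ] intertwiningSet χ N → ℂ :=
    LinearMap.funLeft ℂ ℂ (Subtype.val) ∘ₗ IndEnd.toFunctions χ
  have hinj : Function.Injective R := by
    rw [← LinearMap.ker_eq_bot, LinearMap.ker_eq_bot']
    intro T hT
    apply IndEnd.toFunctions_injective
    rw [map_zero]
    ext g
    obtain ⟨v, hv, u₁, u₂, rfl⟩ := hN g
    rw [IndEnd.toFunctions_mul_right, IndEnd.toFunctions_mul_left]
    suffices IndEnd.toFunctions χ T v = 0 by simp [this]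
    by_cases hv' : v ∈ intertwiningSet χ N
    · exact congrFun hT ⟨v, hv'⟩
    -- outside of the intertwining set, `v * u = (v * u * v⁻¹) * v` forces the value at `v` to be
    -- `0`
    · have : ∃ (u : G) (hu : u ∈ U) (hvu : v * u * v⁻¹ ∈ U),
          χ ⟨u, hu⟩ ≠ χ ⟨v * u * v⁻¹, hvu⟩ := by
        by_contra! h
        exact hv' ⟨hv, h⟩
      obtain ⟨u, hu, hvu, hne⟩ := this
      have h1 := IndEnd.toFunctions_mul_right T ⟨u, hu⟩ v
      have h2 := IndEnd.toFunctions_mul_left T ⟨_, hvu⟩ v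
      rw [show v * u * v⁻¹ * v = v * u by group] at h2
      have h3 := h1.symm.trans h2
      by_contra h0
      exact hne (mul_right_cancel₀ h0 h3)
  have hsurj : Function.Surjective R := by
    intro φ
    choose v hv u₁ u₂ hg using hN
    let f : G → ℂ := fun g =>
      if h : v g ∈ intertwiningSet χ N then χ (u₁ g) * χ (u₂ g) * φ ⟨v g, h⟩ else 0
    -- the value of `f` does not depend on the decomposition `g = w₁ x w₂`
    have hf : ∀ (x : G) (hx : x ∈ N) (w₁ w₂ : U),
        f (w₁ * x * w₂) = if h : x ∈ intertwiningSet χ N then χ w₁ * χ w₂ * φ ⟨x, h⟩ else 0 := by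
      intro x hx w₁ w₂
      obtain ⟨g, hgx⟩ : ∃ g, g = (w₁ * x * w₂ : G) := ⟨_, rfl⟩
      have h1 := hg g
      have hvx : x = v g := by
        refine hN' x hx _ (hv g) ((u₁ g)⁻¹ * w₁) (w₂ * (u₂ g)⁻¹) ?_
        rw [hgx] at h1
        rw [hgx]
        push_cast
        calc v (w₁ * x * w₂) = ((u₁ (w₁ * x * w₂) : G))⁻¹ * (w₁ * x * w₂) *
              (u₂ (w₁ * x * w₂) : G)⁻¹ := by
              rw [eq_mul_inv_iff_mul_eq, eq_inv_mul_iff_mul_eq, ← mul_assoc]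
              exact h1.symm
          _ = _ := by group
      rw [← hgx]
      by_cases hx' : x ∈ intertwiningSet χ N
      · have hx'' : v g ∈ intertwiningSet χ N := hvx ▸ hx'
        have h2 : (⟨v g, hx''⟩ : intertwiningSet χ N) = ⟨x, hx'⟩ := Subtype.ext hvx.symm
        simp only [f]
        rw [dif_pos hx'', dif_pos hx', h2]
        congr 1
        -- `u := w₂ (u₂ g)⁻¹` satisfies `x u x⁻¹ = w₁⁻¹ u₁ g`
        have h3 : x * (w₂ * (u₂ g)⁻¹ : G) * x⁻¹ = ((w₁⁻¹ * u₁ g : U) : G) := by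
          push_cast
          rw [mul_inv_eq_iff_eq_mul, ← mul_assoc, mul_inv_eq_iff_eq_mul]
          rw [mul_assoc, mul_assoc, eq_inv_mul_iff_mul_eq, ← mul_assoc, ← mul_assoc, ← hgx]
          rw [hvx]
          exact h1
        have h4 := hx'.2 (w₂ * (u₂ g)⁻¹ : G) (w₂ * (u₂ g)⁻¹).2 (h3 ▸ SetLike.coe_mem _)
        have h5 : (⟨x * (w₂ * (u₂ g)⁻¹ : G) * x⁻¹, h3 ▸ SetLike.coe_mem _⟩ : U) = w₁⁻¹ * u₁ g :=
          Subtype.ext h3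
        rw [h5] at h4
        change χ (w₂ * (u₂ g)⁻¹) = _ at h4
        rw [map_mul, map_mul] at h4
        have h6 := linearChar_mul_inv (χ := χ) (u₂ g)
        have h7 := linearChar_mul_inv (χ := χ) w₁
        calc χ (u₁ g) * χ (u₂ g) = (χ w₁ * χ w₁⁻¹) * (χ (u₁ g) * χ (u₂ g)) := by
              rw [h7, one_mul]
          _ = χ w₁ * χ (u₂ g) * (χ w₁⁻¹ * χ (u₁ g)) := by ring
          _ = χ w₁ * χ w₂ * (χ (u₂ g) * χ (u₂ g)⁻¹) := by rw [← h4]; ring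
          _ = _ := by rw [h6, mul_one]
      · simp only [f]
        rw [dif_neg (hvx ▸ hx'), dif_neg hx']
    obtain ⟨T, hT⟩ := IndEnd.exists_toFunctions_eq f (χ := χ) (by
        intro u g
        obtain h1 := hg g
        have h2 := hf _ (hv g) (u * u₁ g) (u₂ g)
        have h3 := hf _ (hv g) (u₁ g) (u₂ g)
        rw [← h1] at h3
        rw [Subgroup.coe_mul, mul_assoc (u : G), mul_assoc (u : G), ← h1] at h2
        rw [h2, h3]
        split_ifs
        · rw [map_mul]
          ring
        · rw [mul_zero]) (by
        intro u g
        obtain h1 := hg g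
        have h2 := hf _ (hv g) (u₁ g) (u₂ g * u)
        have h3 := hf _ (hv g) (u₁ g) (u₂ g)
        rw [← h1] at h3
        rw [Subgroup.coe_mul, ← mul_assoc, ← h1] at h2
        rw [h2, h3]
        split_ifs
        · rw [map_mul]
          ring
        · rw [mul_zero])
    refine ⟨T, ?_⟩
    ext x
    have h1 := hf x x.2.1 1 1
    rw [dif_pos x.2] at h1
    simp only [R, LinearMap.coe_comp, Function.comp_apply, LinearMap.funLeft_apply, hT]
    simpa using h1
  let e := LinearEquiv.ofBijective R ⟨hinj, hsurj⟩
  refine ⟨Module.Finite.equiv e.symm, ?_⟩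
  rw [e.finrank_eq, Module.finrank_fintype_fun_eq_card, Nat.card_eq_fintype_card]

end Mackey

/-! ### The Bruhat decomposition -/

section Bruhat

variable {F : Type u} [Field F] {n : ℕ}

lemma perm_eq_of_le {w w' : Equiv.Perm (Fin n)} (h : ∀ s, w s ≤ w' s) : w = w' := by
  have h1 : ∑ s, (w s : ℕ) = ∑ s, (w' s : ℕ) := by
    rw [Equiv.sum_comp w (fun s => (s : ℕ)), Equiv.sum_comp w' (fun s => (s : ℕ))]
  have h2 := (Finset.sum_eq_sum_iff_of_le fun s _ => Fin.le_def.1 (h s)).1 h1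
  exact Equiv.ext fun s => Fin.ext (h2 s (Finset.mem_univ s))

/-- Different monomial matrices lie in different double cosets of the unipotent subgroup. -/
lemma eq_of_unipotent_mul {v v' : GL (Fin n) F} (hv : IsMonomial v.1) (hv' : IsMonomial v'.1)
    (u₁ u₂ : unipotentSubgroup F n) (h : v' = u₁ * v * u₂) : v = v' := by
  obtain ⟨w, c, hc, hw⟩ := hv.exists_monomialMatrix
  obtain ⟨w', c', hc', hw'⟩ := hv'.exists_monomialMatrix
  obtain ⟨y, hy⟩ : ∃ y : unipotentSubgroup F n, y = u₁⁻¹ := ⟨_, rfl⟩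
  have h0 : (y : GL (Fin n) F).1 * v'.1 = v.1 * (u₂ : GL (Fin n) F).1 := by
    rw [← Units.val_mul, ← Units.val_mul, h, hy]
    congr 1
    push_cast
    group
  -- the entries of both sides in the column `s` and the row `w s`
  have h1 : ∀ s, (y : GL (Fin n) F).1 (w s) (w' s) * c' s = c s := by
    intro s
    have h2 := congrFun (congrFun h0 (w s)) s
    rw [Matrix.mul_apply, Matrix.mul_apply, Finset.sum_eq_single (w' s),
      Finset.sum_eq_single s] at h2
    · simpa [hw, hw', monomialMatrix, u₂.2.2] using h2
    · intro t _ ht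
      have : ¬ s = t := fun h => ht h.symm
      simp [hw, monomialMatrix, this]
    · simp
    · intro t _ ht
      simp [hw', monomialMatrix, ht]
    · simp
  have hww : w = w' := by
    refine perm_eq_of_le fun s => ?_
    by_contra! hlt
    have h2 := h1 s
    rw [y.2.1 hlt, zero_mul] at h2
    exact hc s h2.symm
  subst hww
  have hcc : c = c' := by
    ext s
    rw [← h1 s, y.2.2, one_mul]
  exact Units.ext (by rw [hw, hw', hcc])

/-- If `A` is strictly upper triangular of square zero, then `1 + A` is unipotent, with inverse
`1 - A`. -/
lemma exists_unipotent (A : Matrix (Fin n) (Fin n) F) (h0 : A * A = 0)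
    (hA : ∀ p q, q ≤ p → A p q = 0) :
    ∃ u : unipotentSubgroup F n, (u : GL (Fin n) F).1 = 1 + A := by
  refine ⟨⟨⟨1 + A, 1 - A, ?_, ?_⟩, ?_, ?_⟩, rfl⟩
  · rw [add_mul, mul_sub, mul_sub, h0]
    simp
  · rw [sub_mul, mul_add, mul_add, h0]
    simp
  · intro p q hqp
    have hqp : q < p := hqp
    simp [hA p q hqp.le, Matrix.one_apply_ne hqp.ne']
  · intro p
    simp [hA p p le_rfl]

/-- Multiples of a row can be added to the rows above it by left multiplication with an element
of `U`. -/
lemma exists_unipotent_col (p₀ : Fin n) (a : Fin n → F) (ha : ∀ p, p₀ ≤ p → a p = 0) :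
    ∃ u : unipotentSubgroup F n, ∀ (X : Matrix (Fin n) (Fin n) F) p s,
      ((u : GL (Fin n) F).1 * X) p s = X p s + a p * X p₀ s := by
  obtain ⟨u, hu⟩ := exists_unipotent (Matrix.of fun p q => if q = p₀ then a p else 0) (by
      ext p s
      rw [Matrix.mul_apply]
      simp [ha]) (by
      intro p q hqp
      rw [Matrix.of_apply]
      split_ifs with h
      · exact ha p (h ▸ hqp)
      · rfl)
  refine ⟨u, fun X p s => ?_⟩
  rw [hu, add_mul, one_mul, Matrix.add_apply, Matrix.mul_apply]
  simp

/-- Multiples of a column can be added to the columns to the right of it by right multiplication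
with an element of `U`. -/
lemma exists_unipotent_row (t : Fin n) (b : Fin n → F) (hb : ∀ s, s ≤ t → b s = 0) :
    ∃ u : unipotentSubgroup F n, ∀ (X : Matrix (Fin n) (Fin n) F) p s,
      (X * (u : GL (Fin n) F).1) p s = X p s + X p t * b s := by
  obtain ⟨u, hu⟩ := exists_unipotent (Matrix.of fun q s => if q = t then b s else 0) (by
      ext p s
      rw [Matrix.mul_apply]
      simp [hb]) (by
      intro q s hsq
      rw [Matrix.of_apply]
      split_ifs with h
      · exact hb s (h ▸ hsq)
      · rfl)
  refine ⟨u, fun X p s => ?_⟩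
  rw [hu, mul_add, mul_one, Matrix.add_apply, Matrix.mul_apply]
  simp

/-- In the column `t`, the entry in the row `r` is the only nonzero one, and it is also the only
nonzero entry of its row. -/
def IsPivot (h : Matrix (Fin n) (Fin n) F) (r t : Fin n) : Prop :=
  h r t ≠ 0 ∧ (∀ p, p ≠ r → h p t = 0) ∧ ∀ s, s ≠ t → h r s = 0

/-- Gaussian elimination that uses the lowest nonzero entry of each column as a pivot. -/
lemma exists_pivots (g : GL (Fin n) F) (k : ℕ) (hk : k ≤ n) :
    ∃ u₁ u₂ : unipotentSubgroup F n, ∀ t : Fin n, (t : ℕ) < k →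
      ∃ r, IsPivot (u₁ * g * u₂ : GL (Fin n) F).1 r t := by
  classical
  induction k with
  | zero => exact ⟨1, 1, fun t ht => absurd ht (Nat.not_lt_zero _)⟩
  | succ k ih =>
    obtain ⟨u₁, u₂, hu⟩ := ih (Nat.le_of_succ_le hk)
    set h : GL (Fin n) F := u₁ * g * u₂ with hh
    let t : Fin n := ⟨k, hk⟩
    have hne : (Finset.univ.filter fun p => h.1 p t ≠ 0).Nonempty := by
      by_contra hcon
      have h1 : ∀ p, h.1 p t = 0 := by
        intro p
        by_contra hp
        exact hcon ⟨p, by simpa using hp⟩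
      have h2 : (h⁻¹.1 * h.1) t t = 1 := by
        rw [← Units.val_mul, inv_mul_cancel]
        simp
      rw [Matrix.mul_apply] at h2
      simp [h1] at h2
    obtain ⟨p₀, hp₀, hmax⟩ : ∃ p₀, h.1 p₀ t ≠ 0 ∧ ∀ p, p₀ < p → h.1 p t = 0 := by
      refine ⟨_, (Finset.mem_filter.1 (Finset.max'_mem _ hne)).2, fun p hp => ?_⟩
      by_contra h1
      exact absurd (Finset.le_max' _ p (by simpa using h1)) (not_le.2 hp)
    -- the pivots of the earlier columns are not affected by the row and the column of the new one
    have hr : ∀ (t' r : Fin n), (t' : ℕ) < k → IsPivot h.1 r t' →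
        h.1 r t = 0 ∧ r ≠ p₀ ∧ h.1 p₀ t' = 0 := by
      intro t' r ht' hr
      have h1 : h.1 r t = 0 := hr.2.2 t (by rintro rfl; exact absurd ht' (lt_irrefl k))
      have h2 : r ≠ p₀ := by
        rintro rfl
        exact hp₀ h1
      exact ⟨h1, h2, hr.2.1 _ h2.symm⟩
    obtain ⟨x, hx⟩ : ∃ x : unipotentSubgroup F n, ∀ p s, (x * h : GL (Fin n) F).1 p s =
        h.1 p s + (if p < p₀ then -(h.1 p t / h.1 p₀ t) else 0) * h.1 p₀ s := by
      obtain ⟨x, hx⟩ := exists_unipotent_col p₀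
        (fun p => if p < p₀ then -(h.1 p t / h.1 p₀ t) else 0) fun p hp => if_neg hp.not_gt
      exact ⟨x, fun p s => hx h.1 p s⟩
    have hxt : ∀ p, p ≠ p₀ → (x * h : GL (Fin n) F).1 p t = 0 := by
      intro p hp
      rw [hx]
      rcases lt_or_gt_of_ne hp with h1 | h1
      · rw [if_pos h1]
        field_simp
        ring
      · rw [if_neg h1.not_gt, hmax p h1]
        simp
    have hx₀ : ∀ s, (x * h : GL (Fin n) F).1 p₀ s = h.1 p₀ s := by
      intro s
      rw [hx, if_neg (lt_irrefl p₀)]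
      simp
    obtain ⟨y, hy⟩ : ∃ y : unipotentSubgroup F n, ∀ p s, (x * h * y : GL (Fin n) F).1 p s =
        (x * h : GL (Fin n) F).1 p s + (x * h : GL (Fin n) F).1 p t *
          (if t < s then -(h.1 p₀ s / h.1 p₀ t) else 0) := by
      obtain ⟨y, hy⟩ := exists_unipotent_row t
        (fun s => if t < s then -(h.1 p₀ s / h.1 p₀ t) else 0) fun s hs => if_neg hs.not_gt
      exact ⟨y, fun p s => hy (x * h : GL (Fin n) F).1 p s⟩
    refine ⟨x * u₁, u₂ * y, fun t' ht' => ?_⟩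
    have hmul : ((x * u₁ : unipotentSubgroup F n) * g * (u₂ * y : unipotentSubgroup F n) :
        GL (Fin n) F) = x * h * y := by
      rw [hh]
      push_cast
      group
    rw [hmul]
    rcases Nat.lt_succ_iff_lt_or_eq.1 ht' with ht' | ht'
    · obtain ⟨r, hrp⟩ := hu t' ht'
      obtain ⟨h1, h2, h3⟩ := hr t' r ht' hrp
      have htt : ¬ t < t' := fun h => absurd (Fin.lt_def.1 h) ht'.not_gt
      have hrow : ∀ s, (x * h : GL (Fin n) F).1 r s = h.1 r s := by
        intro s
        rw [hx, h1]
        simp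
      have hcol : ∀ p, (x * h : GL (Fin n) F).1 p t' = h.1 p t' := by
        intro p
        rw [hx, h3, mul_zero, add_zero]
      refine ⟨r, ?_, fun p hp => ?_, fun s hs => ?_⟩
      · rw [hy, if_neg htt, mul_zero, add_zero, hcol]
        exact hrp.1
      · rw [hy, if_neg htt, mul_zero, add_zero, hcol]
        exact hrp.2.1 p hp
      · rw [hy, hrow, hrow, h1, zero_mul, add_zero]
        exact hrp.2.2 s hs
    · obtain rfl : t' = t := Fin.ext ht'
      refine ⟨p₀, ?_, fun p hp => ?_, fun s hs => ?_⟩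
      · rw [hy, hx₀, if_neg (lt_irrefl _), mul_zero, add_zero]
        exact hp₀
      · rw [hy, hxt p hp, zero_mul, add_zero]
      · rw [hy, hx₀, hx₀]
        rcases lt_or_gt_of_ne hs with h1 | h1
        · obtain ⟨r, hrp⟩ := hu s (ht' ▸ Fin.lt_def.1 h1)
          rw [(hr s r (ht' ▸ Fin.lt_def.1 h1) hrp).2.2, if_neg h1.not_gt]
          simp
        · rw [if_pos h1]
          field_simp
          ring

/-- The Bruhat decomposition: the monomial matrices represent all double cosets of the unipotent
subgroup. -/
lemma exists_isMonomial_unipotent_mul (g : GL (Fin n) F) :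
    ∃ v : GL (Fin n) F, IsMonomial v.1 ∧ ∃ u₁ u₂ : unipotentSubgroup F n, g = u₁ * v * u₂ := by
  obtain ⟨u₁, u₂, h⟩ := exists_pivots g n le_rfl
  refine ⟨u₁ * g * u₂, ?_, u₁⁻¹, u₂⁻¹, by push_cast; group⟩
  choose r hr using fun t : Fin n => h t t.2
  have hinj : Function.Injective r := by
    intro s t hst
    by_contra hne
    refine (hr s).1 ?_
    rw [hst]
    exact (hr t).2.2 s hne
  refine ⟨fun p => ?_, fun t => ⟨r t, (hr t).1, fun p hp => ?_⟩⟩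
  · obtain ⟨t, rfl⟩ := Finite.surjective_of_injective hinj p
    refine ⟨t, (hr t).1, fun s hs => ?_⟩
    by_contra hne
    exact hs ((hr t).2.2 s hne)
  · by_contra hne
    exact hp ((hr t).2.1 p hne)

end Bruhat

section HeckeDimension

variable {F : Type u} [Field F] [Finite F] {n : ℕ}

/-- The monomial matrices are double coset representatives, so that Mackey's theorem applies. -/
lemma finrank_heckeAlgebra (ψ : AddChar F ℂ) (μ : Composition n) :
    FiniteDimensional ℂ (HeckeAlgebra ψ μ) ∧
      Module.finrank ℂ (HeckeAlgebra ψ μ) = Nat.card (Nset ψ μ) :=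
  finrank_indEnd (χ := psiMu ψ μ) {v : GL (Fin n) F | IsMonomial v.1}
    exists_isMonomial_unipotent_mul fun _ hv _ hv' => eq_of_unipotent_mul hv hv'

end HeckeDimension

/-! ### Simple modules of a semisimple algebra -/

section Semisimple

/-- The commutant of a representation of a finite group is semisimple, by Maschke's theorem. -/
lemma isSemisimpleRing_centralizer {G V : Type*} [Group G] [Finite G] [AddCommGroup V] [Module ℂ V]
    [FiniteDimensional ℂ V] (ρ : Representation ℂ G V) :
    IsSemisimpleRing (Subalgebra.centralizer ℂ (Set.range ρ)) := by
  have : NeZero (Nat.card G : ℂ) := ⟨by exact_mod_cast Nat.card_pos.ne'⟩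
  have : Module.Finite (MonoidAlgebra ℂ G) ρ.asModule := .of_restrictScalars_finite ℂ _ _
  have : IsSemisimpleRing (Module.End (MonoidAlgebra ℂ G) ρ.asModule) :=
    IsSemisimpleRing.moduleEnd _ _
  have e : Subalgebra.centralizer ℂ (Set.range ρ) ≃+* Representation.IntertwiningMap ρ ρ :=
    { toFun := fun T => ⟨T.1, fun g => (T.2 _ ⟨g, rfl⟩).symm⟩
      invFun := fun T => ⟨T.toLinearMap, by
        rintro _ ⟨g, rfl⟩
        exact (T.isIntertwining' g).symm⟩
      left_inv := fun _ => rfl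
      right_inv := fun _ => rfl
      map_mul' := fun _ _ => rfl
      map_add' := fun _ _ => rfl }
  exact (e.trans (Representation.IntertwiningMap.equivAlgEnd
    (ρ := ρ)).toRingEquiv).symm.isSemisimpleRing

/-- Schur's lemma over the complex numbers. -/
lemma finrank_hom_of_isSimpleModule {H S T : Type*} [Ring H] [Algebra ℂ H] [AddCommGroup S]
    [AddCommGroup T] [Module ℂ S]
    [Module ℂ T] [Module H S] [Module H T] [IsScalarTower ℂ H S] [IsScalarTower ℂ H T]
    [FiniteDimensional ℂ T] [IsSimpleModule H S] [IsSimpleModule H T]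
    [Decidable (Nonempty (S ≃ₗ[H] T))] :
    Module.finrank ℂ (S →ₗ[H] T) = if Nonempty (S ≃ₗ[H] T) then 1 else 0 := by
  split_ifs with h
  · obtain ⟨e⟩ := h
    have := IsSimpleModule.nontrivial H T
    have e₁ : (S →ₗ[H] T) ≃ₗ[ℂ] (T →ₗ[H] T) := LinearEquiv.congrLeft T ℂ e
    have e₂ : ℂ ≃ₗ[ℂ] (T →ₗ[H] T) := LinearEquiv.ofBijective (Algebra.linearMap ℂ (Module.End H T))
      (IsSimpleModule.algebraMap_end_bijective_of_isAlgClosed ℂ)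
    rw [(e₁.trans e₂.symm).finrank_eq, Module.finrank_self]
  · have : Subsingleton (S →ₗ[H] T) := by
      refine ⟨fun f g => ?_⟩
      have h0 : ∀ f : S →ₗ[H] T, f = 0 := fun f =>
        (LinearMap.bijective_or_eq_zero f).resolve_left fun hf =>
          h ⟨LinearEquiv.ofBijective f hf⟩
      rw [h0 f, h0 g]
    exact Module.finrank_zero_of_subsingleton

/-- A semisimple algebra over the complex numbers has finitely many simple modules, up to
isomorphism, and its dimension is the sum of the squares of their dimensions: by Schur's lemma,
the multiplicity of a simple module `S` in the regular module is `dim Hom(H, S) = dim S`. -/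
theorem exists_simple_modules {H : Type u} [Ring H] [Algebra ℂ H] [FiniteDimensional ℂ H]
    [IsSemisimpleRing H] :
    ∃ (m : ℕ) (S : Fin m → Submodule H H),
      (∀ i, IsSimpleModule H (S i)) ∧
      (∀ i j, Nonempty (S i ≃ₗ[H] S j) → i = j) ∧
      (∀ (V : Type u) [AddCommGroup V] [Module H V],
        IsSimpleModule H V → ∃ i, Nonempty (V ≃ₗ[H] S i)) ∧
      Module.finrank ℂ H = ∑ i, Module.finrank ℂ (S i) ^ 2 := by
  classical
  obtain ⟨N, T, e₀, hT⟩ := IsSemisimpleModule.exists_linearEquiv_fin_dfinsupp H H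
  let e : H ≃ₗ[H] ∀ i, T i := e₀.trans (DFinsupp.linearEquivFunOnFintype (R := H))
  have hmul : ∀ I : Submodule H H, IsSimpleModule H I →
      Module.finrank ℂ I = (Finset.univ.filter fun i => Nonempty (T i ≃ₗ[H] I)).card := by
    intro I hI
    have e₁ : (H →ₗ[H] I) ≃ₗ[ℂ] ((∀ i, T i) →ₗ[H] I) := LinearEquiv.congrLeft I ℂ e
    have e₂ : (∀ i, T i →ₗ[H] I) ≃ₗ[ℂ] ((∀ i, T i) →ₗ[H] I) := LinearMap.lsum H (fun i => T i) ℂ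
    rw [((LinearMap.ringLmapEquivSelf H ℂ I).symm.trans (e₁.trans e₂.symm)).finrank_eq,
      Module.finrank_pi_fintype, Finset.card_filter]
    exact Finset.sum_congr rfl fun i _ => finrank_hom_of_isSimpleModule
  have hdim : Module.finrank ℂ H = ∑ i, Module.finrank ℂ (T i) := by
    rw [(e.restrictScalars ℂ).finrank_eq, Module.finrank_pi_fintype]
  -- representatives of the isomorphism classes of the summands
  let r : Setoid (Fin N) := ⟨fun i j => Nonempty (T i ≃ₗ[H] T j), fun _ => ⟨LinearEquiv.refl _ _⟩,
    fun ⟨f⟩ => ⟨f.symm⟩, fun ⟨f⟩ ⟨g⟩ => ⟨f.trans g⟩⟩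
  let E := Fintype.equivFin (Quotient r)
  have hout : ∀ i, Nonempty (T i ≃ₗ[H] T (⟦i⟧ : Quotient r).out) := fun i =>
    Quotient.exact (Quotient.out_eq (⟦i⟧ : Quotient r)).symm
  refine ⟨Fintype.card (Quotient r), fun k => T (E.symm k).out, fun k => hT _, ?_, ?_, ?_⟩
  · intro k l hkl
    apply E.symm.injective
    rw [← Quotient.out_eq (E.symm k), ← Quotient.out_eq (E.symm l)]
    exact Quotient.sound hkl
  · intro V _ _ hV
    obtain ⟨I, ⟨f⟩⟩ := IsSemisimpleRing.exists_linearEquiv_ideal_of_isSimpleModule H V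
    have hI : IsSimpleModule H I := IsSimpleModule.congr f.symm
    have hne : (Finset.univ.filter fun i => Nonempty (T i ≃ₗ[H] I)).Nonempty := by
      have : Nontrivial I := IsSimpleModule.nontrivial H I
      rw [← Finset.card_pos, ← hmul I hI]
      exact Module.finrank_pos
    obtain ⟨i, hi⟩ := hne
    obtain ⟨g⟩ := (Finset.mem_filter.1 hi).2
    obtain ⟨g'⟩ := hout i
    refine ⟨E ⟦i⟧, ?_⟩
    beta_reduce
    rw [Equiv.symm_apply_apply]
    exact ⟨f.trans (g.symm.trans g')⟩
  · rw [hdim, Equiv.sum_comp E.symm (fun q : Quotient r => Module.finrank ℂ (T q.out) ^ 2),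
      ← Finset.sum_fiberwise Finset.univ (fun i => (⟦i⟧ : Quotient r))]
    refine Finset.sum_congr rfl fun q _ => ?_
    rw [sq]
    nth_rewrite 2 [hmul _ (hT _)]
    have hq : (Finset.univ.filter fun i => (⟦i⟧ : Quotient r) = q) =
        Finset.univ.filter fun i => Nonempty (T i ≃ₗ[H] T q.out) := by
      ext i
      simp only [Finset.mem_filter, Finset.mem_univ, true_and]
      constructor
      · rintro rfl
        exact hout i
      · intro h
        rw [← Quotient.out_eq q]
        exact Quotient.sound h
    rw [hq, Finset.sum_const_nat (m := Module.finrank ℂ (T q.out)), mul_comm]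
    intro i hi
    obtain ⟨g⟩ := (Finset.mem_filter.1 hi).2
    exact (g.restrictScalars ℂ).finrank_eq

end Semisimple

/-! ### Matching index sets by counting -/

section Counting

variable {I X : Type*} (d : I → ℕ) (π : X → I)

/-- If the fibre of `π` over `i` has `d i` elements, then the number of `x` with `d (π x) = k` is
`k` times the number of `i` with `d i = k`. -/
lemma card_fiber_eq (hpos : ∀ i, 0 < d i) (hd : ∀ i, Nat.card {x // π x = i} = d i) (k : ℕ)
    (hfin : Finite {x // d (π x) = k}) :
    Finite {i // d i = k} ∧ Nat.card {x // d (π x) = k} = k * Nat.card {i // d i = k} := by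
  have hsurj : Function.Surjective π := by
    intro i
    have : Nonempty {x // π x = i} := by
      refine (Nat.card_pos_iff.1 ?_).1
      rw [hd]
      exact hpos i
    exact ⟨this.some.1, this.some.2⟩
  have hI : Finite {i // d i = k} :=
    Finite.of_surjective (fun x : {x // d (π x) = k} => (⟨π x.1, x.2⟩ : {i // d i = k}))
      fun ⟨i, hi⟩ => by
        obtain ⟨x, rfl⟩ := hsurj i
        exact ⟨⟨x, hi⟩, rfl⟩
  refine ⟨hI, ?_⟩
  have := Fintype.ofFinite {i // d i = k}
  let e : {x // d (π x) = k} ≃ Σ i : {i // d i = k}, {x // π x = i.1} :=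
    { toFun := fun x => ⟨⟨π x.1, x.2⟩, ⟨x.1, rfl⟩⟩
      invFun := fun y => ⟨y.2.1, by rw [y.2.2]; exact y.1.2⟩
      left_inv := fun _ => rfl
      right_inv := by
        rintro ⟨⟨i, hi⟩, x, hx⟩
        change π x = i at hx
        subst hx
        rfl }
  have hfib : ∀ i : {i // d i = k}, Finite {x // π x = i.1} := fun i => by
    refine (Nat.card_pos_iff.1 ?_).2
    rw [hd]
    exact hpos _
  rw [Nat.card_congr e, Nat.card_sigma, Finset.sum_congr rfl fun i _ => (hd i.1).trans i.2,
    Finset.sum_const, smul_eq_mul, Finset.card_univ, ← Nat.card_eq_fintype_card, mul_comm]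

lemma sum_card_divisors {Z : Type*} (δ : Z → ℕ) (m : ℕ) (hm : m ≠ 0)
    (hfin : Finite {x // δ x ∣ m}) :
    Nat.card {x // δ x ∣ m} = ∑ k ∈ m.divisors, Nat.card {x // δ x = k} := by
  have hf : ∀ k : m.divisors, Finite {x // δ x = k.1} := fun k =>
    Finite.of_injective (β := {x // δ x ∣ m})
      (fun x => ⟨x.1, x.2.symm ▸ Nat.dvd_of_mem_divisors k.2⟩) fun x y h => by
        simpa [Subtype.ext_iff] using h
  let e : {x // δ x ∣ m} ≃ Σ k : m.divisors, {x // δ x = k.1} :=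
    { toFun := fun x => ⟨⟨δ x.1, Nat.mem_divisors.2 ⟨x.2, hm⟩⟩, x.1, rfl⟩
      invFun := fun y => ⟨y.2.1, by rw [y.2.2]; exact Nat.dvd_of_mem_divisors y.1.2⟩
      left_inv := fun _ => rfl
      right_inv := by
        rintro ⟨⟨i, hi⟩, x, hx⟩
        change δ x = i at hx
        subst hx
        rfl }
  rw [Nat.card_congr e, Nat.card_sigma, Finset.sum_coe_sort m.divisors
    (fun k => Nat.card {x // δ x = k})]

/-- Two index sets with degrees are in bijection, compatibly with the degrees, if the elements of
degree `d` are the fibres with `d` elements of maps for which the number of points of degree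
dividing `m` is the same for every `m`. -/
theorem exists_equiv_of_card_eq {J Y : Type*} (d' : J → ℕ) (ρ : Y → J) (N : ℕ → ℕ)
    (hN : ∀ m, m ≠ 0 → 0 < N m)
    (hpos : ∀ i, 0 < d i) (hd : ∀ i, Nat.card {x // π x = i} = d i)
    (hcard : ∀ m, m ≠ 0 → Nat.card {x // d (π x) ∣ m} = N m)
    (hpos' : ∀ j, 0 < d' j) (hd' : ∀ j, Nat.card {y // ρ y = j} = d' j)
    (hcard' : ∀ m, m ≠ 0 → Nat.card {y // d' (ρ y) ∣ m} = N m) :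
    ∃ e : I ≃ J, ∀ i, d' (e i) = d i := by
  have hfin : ∀ m, m ≠ 0 → Finite {x // d (π x) ∣ m} := fun m hm =>
    (Nat.card_pos_iff.1 (hcard m hm ▸ hN m hm)).2
  have hfin' : ∀ m, m ≠ 0 → Finite {y // d' (ρ y) ∣ m} := fun m hm =>
    (Nat.card_pos_iff.1 (hcard' m hm ▸ hN m hm)).2
  have hA : ∀ m, m ≠ 0 → Nat.card {x // d (π x) = m} = Nat.card {y // d' (ρ y) = m} := by
    intro m
    induction m using Nat.strong_induction_on with
    | _ m ih =>
      intro hm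
      have h1 := (hcard m hm).trans (hcard' m hm).symm
      rw [sum_card_divisors _ m hm (hfin m hm), sum_card_divisors _ m hm (hfin' m hm),
        ← Nat.insert_self_properDivisors hm, Finset.sum_insert Nat.self_notMem_properDivisors,
        Finset.sum_insert Nat.self_notMem_properDivisors,
        Finset.sum_congr rfl fun k hk => ih k (Nat.mem_properDivisors.1 hk).2
          (Nat.pos_of_mem_properDivisors hk).ne'] at h1
      exact Nat.add_right_cancel h1
  have hB : ∀ k, Nonempty ({i // d i = k} ≃ {j // d' j = k}) := by
    intro k
    rcases Nat.eq_zero_or_pos k with rfl | hk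
    · have h1 : IsEmpty {i // d i = 0} := ⟨fun i => (hpos i.1).ne' i.2⟩
      have h2 : IsEmpty {j // d' j = 0} := ⟨fun i => (hpos' i.1).ne' i.2⟩
      exact ⟨Equiv.equivOfIsEmpty _ _⟩
    · have h1 : Finite {x // d (π x) = k} := by
        have := hfin k hk.ne'
        exact Finite.of_injective (β := {x // d (π x) ∣ k}) (fun x => ⟨x.1, x.2.dvd⟩)
          fun x y h => by simpa [Subtype.ext_iff] using h
      have h2 : Finite {y // d' (ρ y) = k} := by
        have := hfin' k hk.ne'
        exact Finite.of_injective (β := {y // d' (ρ y) ∣ k}) (fun x => ⟨x.1, x.2.dvd⟩)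
          fun x y h => by simpa [Subtype.ext_iff] using h
      obtain ⟨f1, c1⟩ := card_fiber_eq d π hpos hd k h1
      obtain ⟨f2, c2⟩ := card_fiber_eq d' ρ hpos' hd' k h2
      rw [hA k hk.ne', c2] at c1
      exact Finite.card_eq.1 (Nat.eq_of_mul_eq_mul_left hk c1.symm)
  have E := fun k => (hB k).some
  refine ⟨(Equiv.sigmaFiberEquiv d).symm.trans
    ((Equiv.sigmaCongrRight E).trans (Equiv.sigmaFiberEquiv d')), fun i => ?_⟩
  exact (E (d i) ⟨i, rfl⟩).2

end Counting

/-! ### Counting in the index set `Φ` -/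

section Phi

variable {F : Type u} [Field F]

/-- The minimal polynomial of an element of an algebraic closure, as an element of `Φ`. -/
noncomputable def phiOf (F : Type u) [Field F] (x : (AlgebraicClosure F)ˣ) : Phi F :=
  ⟨minpoly F (x : AlgebraicClosure F), minpoly.monic (Algebra.IsIntegral.isIntegral _),
    minpoly.irreducible (Algebra.IsIntegral.isIntegral _), by
      rw [← coeff_zero_eq_eval_zero]
      exact minpoly.coeff_zero_ne_zero (Algebra.IsIntegral.isIntegral _) x.ne_zero⟩

lemma phiOf_eq_iff (x : (AlgebraicClosure F)ˣ) (f : Phi F) :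
    phiOf F x = f ↔ aeval (x : AlgebraicClosure F) f.1 = 0 := by
  constructor
  · rintro rfl
    exact minpoly.aeval _ _
  · intro h
    exact Subtype.ext (minpoly.eq_of_irreducible_of_monic f.2.2.1 h f.2.1).symm

/-- An element of `Φ` is separable, so it has as many roots as its degree, and they are nonzero. -/
lemma card_phiOf_fiber [Finite F] (f : Phi F) : Nat.card {x // phiOf F x = f} = f.degree := by
  have hsep : f.1.Separable := PerfectField.separable_of_irreducible f.2.2.1
  have h := card_rootSet_eq_natDegree (K := AlgebraicClosure F) hsep
    (IsAlgClosed.splits _)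
  rw [← Nat.card_eq_fintype_card] at h
  rw [Phi.degree, ← h]
  have hne : f.1 ≠ 0 := f.2.2.1.ne_zero
  have h0 : ∀ y ∈ f.1.rootSet (AlgebraicClosure F), y ≠ 0 := by
    rintro y hy rfl
    have := (mem_rootSet.1 hy).2
    rw [aeval_def, eval₂_at_zero, coeff_zero_eq_eval_zero, map_eq_zero] at this
    exact f.2.2.2 this
  exact Nat.card_congr
    { toFun := fun x => ⟨x.1.1, mem_rootSet.2 ⟨hne, (phiOf_eq_iff _ _).1 x.2⟩⟩
      invFun := fun y => ⟨Units.mk0 y.1 (h0 _ y.2), (phiOf_eq_iff _ _).2 (mem_rootSet.1 y.2).2⟩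
      left_inv := fun x => Subtype.ext (Units.ext rfl)
      right_inv := fun y => rfl }

lemma one_lt_card_pow (F : Type u) [Field F] [Finite F] (m : ℕ+) :
    1 < Nat.card F ^ (m : ℕ) :=
  Nat.one_lt_pow m.ne_zero Finite.one_lt_card

instance (F : Type u) [Field F] [Finite F] (m : ℕ+) : NeZero (Nat.card F ^ (m : ℕ) - 1) :=
  ⟨(Nat.sub_pos_of_lt (one_lt_card_pow F m)).ne'⟩

lemma card_extUnits (F : Type u) [Field F] [Finite F] (m : ℕ+) :
    Nat.card (extUnits F m) = Nat.card F ^ (m : ℕ) - 1 := by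
  have : NeZero ((Nat.card F ^ (m : ℕ) - 1 : ℕ) : AlgebraicClosure F) := by
    refine ⟨?_⟩
    rw [Nat.cast_sub (one_lt_card_pow F m).le, Nat.cast_pow,
      ← map_natCast (algebraMap F (AlgebraicClosure F))]
    have := Fintype.ofFinite F
    rw [Nat.card_eq_fintype_card, FiniteField.cast_card_eq_zero, map_zero,
      zero_pow m.ne_zero]
    simp
  exact HasEnoughRootsOfUnity.natCard_rootsOfUnity _ _

/-- The elements whose degree divides `m` are those of the field with `q ^ m` elements. -/
lemma card_phiOf_degree_dvd [Finite F] (m : ℕ+) :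
    Nat.card {x // (phiOf F x).degree ∣ m} = Nat.card F ^ (m : ℕ) - 1 := by
  rw [← card_extUnits]
  refine Nat.card_congr (Equiv.subtypeEquivRight fun x => ?_)
  rw [Phi.degree, Irreducible.natDegree_dvd_iff_dvd_X_pow_card_pow_sub_X (phiOf F x).2.2.1,
    mem_rootsOfUnity]
  change minpoly F (x : AlgebraicClosure F) ∣ _ ↔ _
  rw [minpoly.dvd_iff, map_sub, map_pow, aeval_X, sub_eq_zero, ← Units.val_pow_eq_pow_val,
    Units.val_inj]
  nth_rewrite 1 [← Nat.sub_add_cancel (one_lt_card_pow F m).le]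
  rw [pow_succ, mul_eq_right]

end Phi

/-! ### Counting in the index set `Θ` -/

section Theta

lemma exists_pow_eq {K : Type*} [Field K] [IsAlgClosed K] (x : Kˣ) {s : ℕ} (hs : 0 < s) :
    ∃ y : Kˣ, y ^ s = x := by
  obtain ⟨y, hy⟩ := IsAlgClosed.exists_pow_nat_eq (x : K) hs
  refine ⟨Units.mk0 y ?_, Units.ext hy⟩
  rintro rfl
  rw [zero_pow hs.ne'] at hy
  exact x.ne_zero hy.symm

/-- The exponent of the norm from the field with `q ^ N` elements to the field with `q ^ m`
elements. -/
noncomputable def normExp (F : Type u) (m N : ℕ+) : ℕ :=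
  (Nat.card F ^ (N : ℕ) - 1) / (Nat.card F ^ (m : ℕ) - 1)

lemma normExp_mul {F : Type u} {m N : ℕ+} (h : (m : ℕ) ∣ N) :
    normExp F m N * (Nat.card F ^ (m : ℕ) - 1) = Nat.card F ^ (N : ℕ) - 1 :=
  Nat.div_mul_cancel (Nat.pow_sub_one_dvd_pow_sub_one _ h)

variable {F : Type u} [Field F] [Finite F]

lemma normExp_pos {m N : ℕ+} (h : (m : ℕ) ∣ N) : 0 < normExp F m N := by
  refine Nat.pos_of_ne_zero fun h0 => ?_
  have := normExp_mul (F := F) h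
  rw [h0, zero_mul] at this
  exact (Nat.sub_pos_of_lt (one_lt_card_pow F N)).ne this

lemma normExp_trans {l m N : ℕ+} (h : (l : ℕ) ∣ m) (h' : (m : ℕ) ∣ N) :
    normExp F m N * normExp F l m = normExp F l N := by
  refine Nat.eq_of_mul_eq_mul_right (Nat.sub_pos_of_lt (one_lt_card_pow F l)) ?_
  rw [mul_assoc, normExp_mul h, normExp_mul h', normExp_mul (h.trans h')]

lemma sum_eq_normExp (m r : ℕ+) :
    ∑ i ∈ Finset.range r, (Nat.card F ^ (m : ℕ)) ^ i = normExp F m (m * r) := by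
  rw [Nat.geomSum_eq (one_lt_card_pow F m), normExp, PNat.mul_coe, pow_mul]

lemma normHom_apply (m r : ℕ+) (x : extUnits F (m * r)) :
    (normHom F m r x : (AlgebraicClosure F)ˣ) =
      (x : (AlgebraicClosure F)ˣ) ^ normExp F m (m * r) := by
  rw [← sum_eq_normExp]
  rfl

lemma pow_normExp_mem {F : Type u} [Field F] {m N : ℕ+} (h : (m : ℕ) ∣ N)
    {x : (AlgebraicClosure F)ˣ}
    (hx : x ∈ extUnits F N) : x ^ normExp F m N ∈ extUnits F m := by
  rw [mem_rootsOfUnity] at hx ⊢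
  rw [← pow_mul, normExp_mul h, hx]

lemma exists_pow_normExp_eq {m N : ℕ+} (h : (m : ℕ) ∣ N) {x : (AlgebraicClosure F)ˣ}
    (hx : x ∈ extUnits F m) : ∃ y ∈ extUnits F N, y ^ normExp F m N = x := by
  obtain ⟨y, rfl⟩ := exists_pow_eq x (normExp_pos (F := F) h)
  refine ⟨y, ?_, rfl⟩
  rw [mem_rootsOfUnity] at hx ⊢
  rw [← normExp_mul h, pow_mul, hx]

lemma normHom_surjective (m r : ℕ+) : Function.Surjective (normHom F m r) := by
  rintro ⟨x, hx⟩
  obtain ⟨y, hy, hyx⟩ := exists_pow_normExp_eq (N := m * r) ⟨r, PNat.mul_coe m r⟩ hx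
  exact ⟨⟨y, hy⟩, Subtype.ext ((normHom_apply m r ⟨y, hy⟩).trans hyx)⟩

open Classical in
/-- The extension of a character of the units of a finite field by `1`. -/
noncomputable def extendUnitsChar {m : ℕ+} (γ : extUnits F m →* ℂˣ) (y : (AlgebraicClosure F)ˣ) :
    ℂˣ :=
  if h : y ∈ extUnits F m then γ ⟨y, h⟩ else 1

/-- The value of a character of the units of the field with `q ^ m` elements at the norm of a unit
`x` of the field with `q ^ N` elements. -/
noncomputable def charAt (a : Σ m : ℕ+, (extUnits F m →* ℂˣ)) (N : ℕ+)
    (x : (AlgebraicClosure F)ˣ) : ℂˣ :=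
  extendUnitsChar a.2 (x ^ normExp F a.1 N)

/-- Two characters of units of finite fields agree after composition with the norms from every
common extension field. -/
def CharEquiv (a b : Σ m : ℕ+, (extUnits F m →* ℂˣ)) : Prop :=
  ∀ N : ℕ+, (a.1 : ℕ) ∣ N → (b.1 : ℕ) ∣ N → ∀ x ∈ extUnits F N, charAt a N x = charAt b N x

/-- Transitivity of the norms. -/
lemma charAt_pow_normExp (a : Σ m : ℕ+, (extUnits F m →* ℂˣ)) {N M : ℕ+} (h : (a.1 : ℕ) ∣ N)
    (h' : (N : ℕ) ∣ M) (x : (AlgebraicClosure F)ˣ) :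
    charAt a N (x ^ normExp F N M) = charAt a M x := by
  unfold charAt
  rw [← pow_mul, normExp_trans h h']

lemma CharEquiv.trans {a b c : Σ m : ℕ+, (extUnits F m →* ℂˣ)} (hab : CharEquiv a b)
    (hbc : CharEquiv b c) : CharEquiv a c := by
  intro N ha hc x hx
  have hN : (N : ℕ) ∣ (N * b.1 : ℕ+) := ⟨b.1, PNat.mul_coe _ _⟩
  have hb : (b.1 : ℕ) ∣ (N * b.1 : ℕ+) := ⟨N, by rw [PNat.mul_coe, mul_comm]⟩
  obtain ⟨y, hy, rfl⟩ := exists_pow_normExp_eq hN hx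
  rw [charAt_pow_normExp a ha hN, charAt_pow_normExp c hc hN,
    hab _ (ha.trans hN) hb y hy, hbc _ hb (hc.trans hN) y hy]

lemma charEquiv_normHom (a : Σ m : ℕ+, (extUnits F m →* ℂˣ)) (r : ℕ+) :
    CharEquiv a ⟨a.1 * r, a.2.comp (normHom F a.1 r)⟩ := by
  intro N ha hb x hx
  have h1 : (a.1 : ℕ) ∣ (a.1 * r : ℕ+) := ⟨r, PNat.mul_coe _ _⟩
  rw [← charAt_pow_normExp a h1 hb]
  have h2 := pow_normExp_mem hb hx
  unfold charAt extendUnitsChar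
  rw [dif_pos (pow_normExp_mem h1 h2), dif_pos h2]
  exact congrArg a.2 (Subtype.ext (normHom_apply a.1 r ⟨_, h2⟩).symm)

/-- Characters with the same class in `L` agree after composition with norms. -/
lemma charEquiv_of_mk_eq {a b : Σ m : ℕ+, (extUnits F m →* ℂˣ)}
    (h : (Quot.mk _ a : CharUnion F) = Quot.mk _ b) : CharEquiv a b := by
  have h' := Quot.eqvGen_exact h
  clear h
  induction h' with
  | rel a b h =>
    obtain ⟨r, rfl⟩ := h
    exact charEquiv_normHom a r
  | refl a => exact fun N _ _ x _ => rfl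
  | symm a b _ ih => exact fun N ha hb x hx => (ih N hb ha x hx).symm
  | trans a b c _ _ h1 h2 => exact h1.trans h2

variable (F) in
/-- The map from the characters of the units of the field with `q ^ m` elements to `L`. -/
def CharUnion.mk (m : ℕ+) (γ : extUnits F m →* ℂˣ) : CharUnion F := Quot.mk _ ⟨m, γ⟩

lemma CharUnion.mk_injective (m : ℕ+) : Function.Injective (CharUnion.mk F m) := by
  intro γ γ' h
  ext1 x
  have h1 := charEquiv_of_mk_eq h m dvd_rfl dvd_rfl x x.2
  have h2 : (x : (AlgebraicClosure F)ˣ) ^ normExp F m m = x := by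
    rw [normExp, Nat.div_self (Nat.sub_pos_of_lt (one_lt_card_pow F m)), pow_one]
  have h3 : (x : (AlgebraicClosure F)ˣ) ^ normExp F m m ∈ extUnits F m := by
    rw [h2]
    exact x.2
  unfold charAt extendUnitsChar at h1
  rw [dif_pos h3, dif_pos h3] at h1
  have h4 : (⟨_, h3⟩ : extUnits F m) = x := Subtype.ext h2
  rwa [h4] at h1

lemma CharUnion.mk_normHom (m r : ℕ+) (γ : extUnits F m →* ℂˣ) :
    CharUnion.mk F (m * r) (γ.comp (normHom F m r)) = CharUnion.mk F m γ :=
  (Quot.sound ⟨r, rfl⟩).symm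

lemma CharUnion.frobenius_iterate_mk (k : ℕ) (m : ℕ+) (γ : extUnits F m →* ℂˣ) :
    (CharUnion.frobenius F)^[k] (CharUnion.mk F m γ) = CharUnion.mk F m (γ ^ Nat.card F ^ k) := by
  induction k with
  | zero => exact congrArg (CharUnion.mk F m) (pow_one γ).symm
  | succ k ih =>
    have h : γ ^ Nat.card F ^ (k + 1) = (γ ^ Nat.card F ^ k) ^ Nat.card F := by
      rw [pow_succ]
      exact pow_mul γ _ _
    rw [Function.iterate_succ_apply', ih, h]
    rfl

lemma pow_card_pow_eq_iff {M : Type*} [Group M] (m : ℕ+) (γ : M) :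
    γ ^ Nat.card F ^ (m : ℕ) = γ ↔ γ ^ (Nat.card F ^ (m : ℕ) - 1) = 1 := by
  nth_rewrite 1 [← Nat.sub_add_cancel (one_lt_card_pow F m).le]
  rw [pow_succ, mul_eq_right]

lemma character_pow_eq_one {F : Type u} [Field F] (m : ℕ+) (γ : extUnits F m →* ℂˣ) :
    γ ^ (Nat.card F ^ (m : ℕ) - 1) = 1 := by
  ext1 x
  rw [MonoidHom.pow_apply, ← map_pow]
  have : x ^ (Nat.card F ^ (m : ℕ) - 1) = 1 := Subtype.ext x.2
  rw [this, map_one, MonoidHom.one_apply]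

/-- The elements of `L` that are fixed by the `m`-th power of the Frobenius map are the characters
of the units of the field with `q ^ m` elements. -/
lemma CharUnion.frobenius_iterate_eq_iff (m : ℕ+) (x : CharUnion F) :
    (CharUnion.frobenius F)^[m] x = x ↔ x ∈ Set.range (CharUnion.mk F m) := by
  constructor
  · intro h
    obtain ⟨⟨l, γ⟩, rfl⟩ := Quot.exists_rep x
    change (CharUnion.frobenius F)^[m] (CharUnion.mk F l γ) = CharUnion.mk F l γ at h
    change CharUnion.mk F l γ ∈ _
    rw [CharUnion.frobenius_iterate_mk] at h
    have h1 := (pow_card_pow_eq_iff (F := F) m γ).1 (CharUnion.mk_injective l h)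
    obtain ⟨δ, hδ, hδ'⟩ : ∃ δ : extUnits F (m * l) →* ℂˣ,
        CharUnion.mk F (m * l) δ = CharUnion.mk F l γ ∧
          δ ^ (Nat.card F ^ (m : ℕ) - 1) = 1 := by
      rw [mul_comm m l]
      refine ⟨_, CharUnion.mk_normHom l m γ, ?_⟩
      ext1 y
      exact DFunLike.congr_fun h1 (normHom F l m y)
    -- the kernel of the norm consists of powers with exponent `q ^ m - 1`
    have hker : (normHom F m l).ker ≤ δ.ker := by
      intro y hy
      rw [MonoidHom.mem_ker] at hy ⊢
      have hy' : (y : (AlgebraicClosure F)ˣ) ^ normExp F m (m * l) = 1 := by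
        rw [← normHom_apply, hy]
        rfl
      obtain ⟨z, hz⟩ := exists_pow_eq (y : (AlgebraicClosure F)ˣ)
        (Nat.sub_pos_of_lt (one_lt_card_pow F m))
      have hz' : z ∈ extUnits F (m * l) := by
        rw [mem_rootsOfUnity, ← normExp_mul (F := F) (m := m) ⟨l, PNat.mul_coe m l⟩, mul_comm,
          pow_mul, hz, hy']
      have : y = (⟨z, hz'⟩ : extUnits F (m * l)) ^ (Nat.card F ^ (m : ℕ) - 1) :=
        Subtype.ext hz.symm
      rw [this, map_pow, ← MonoidHom.pow_apply, hδ', MonoidHom.one_apply]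
    let ε := (normHom F m l).liftOfSurjective (normHom_surjective m l) ⟨δ, hker⟩
    refine ⟨ε, ?_⟩
    rw [← CharUnion.mk_normHom m l, ← hδ]
    congr 1
    ext1 y
    exact (normHom F m l).liftOfRightInverse_comp_apply _
      (Function.rightInverse_surjInv (normHom_surjective m l)) ⟨δ, hker⟩ y
  · rintro ⟨γ, rfl⟩
    rw [CharUnion.frobenius_iterate_mk,
      (pow_card_pow_eq_iff (F := F) m γ).2 (character_pow_eq_one m γ)]

lemma CharUnion.mem_periodicPts (x : CharUnion F) :
    x ∈ Function.periodicPts (CharUnion.frobenius F) := by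
  obtain ⟨⟨m, γ⟩, rfl⟩ := Quot.exists_rep x
  exact ⟨m, m.pos, (CharUnion.frobenius_iterate_eq_iff m _).2 ⟨γ, rfl⟩⟩

/-- For a map all of whose points are periodic, the size of an orbit is the minimal period. -/
lemma card_orbit_eq_minimalPeriod {X : Type*} (φ : X → X) (hφ : ∀ x, x ∈ Function.periodicPts φ)
    (x : X) :
    Nat.card {y // Quot.mk (fun x y => y = φ x) y = Quot.mk _ x} = Function.minimalPeriod φ x := by
  have hiff : ∀ y, Quot.mk (fun x y => y = φ x) y = Quot.mk _ x ↔ ∃ k, φ^[k] x = y := by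
    intro y
    constructor
    · intro h
      have h' := Quot.eqvGen_exact h.symm
      clear h
      induction h' with
      | rel a b h => exact ⟨1, h.symm⟩
      | refl a => exact ⟨0, rfl⟩
      | symm a b _ ih =>
        obtain ⟨k, rfl⟩ := ih
        obtain ⟨n, hn, hper⟩ := hφ a
        refine ⟨n * k - k, ?_⟩
        rw [← Function.iterate_add_apply, Nat.sub_add_cancel (Nat.le_mul_of_pos_left k hn)]
        exact hper.mul_const k
      | trans a b c _ _ h1 h2 =>
        obtain ⟨k, rfl⟩ := h1
        obtain ⟨l, rfl⟩ := h2
        exact ⟨l + k, Function.iterate_add_apply _ _ _ _⟩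
    · rintro ⟨k, rfl⟩
      induction k with
      | zero => rfl
      | succ k ih =>
        rw [Function.iterate_succ_apply', ← ih]
        exact (Quot.sound (r := fun x y => y = φ x) rfl).symm
  have hpos := Function.minimalPeriod_pos_of_mem_periodicPts (hφ x)
  refine (Nat.card_congr (Equiv.ofBijective (fun k : Fin (Function.minimalPeriod φ x) =>
    (⟨φ^[k] x, (hiff _).2 ⟨k, rfl⟩⟩ : {y // Quot.mk (fun x y => y = φ x) y = Quot.mk _ x}))
    ⟨?_, ?_⟩)).symm.trans (Nat.card_fin _)
  · intro k l hkl
    exact Fin.ext ((Function.iterate_eq_iterate_iff_of_lt_minimalPeriod k.2 l.2).1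
      (congrArg Subtype.val hkl))
  · rintro ⟨y, hy⟩
    obtain ⟨k, rfl⟩ := (hiff y).1 hy
    exact ⟨⟨k % _, Nat.mod_lt _ hpos⟩, Subtype.ext Function.iterate_mod_minimalPeriod_eq⟩

lemma Theta.size_mk (x : CharUnion F) :
    Theta.size (Quot.mk _ x : Theta F) = Function.minimalPeriod (CharUnion.frobenius F) x :=
  card_orbit_eq_minimalPeriod _ CharUnion.mem_periodicPts x

lemma Theta.size_pos (φ : Theta F) : 0 < φ.size := by
  obtain ⟨x, rfl⟩ := Quot.exists_rep φ
  rw [Theta.size_mk]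
  exact Function.minimalPeriod_pos_of_mem_periodicPts (CharUnion.mem_periodicPts x)

/-- The elements of `L` whose orbit size divides `m` are the characters of the units of the field
with `q ^ m` elements; there are as many of them as there are units. -/
lemma card_theta_size_dvd (m : ℕ+) :
    Nat.card {x : CharUnion F // Theta.size (Quot.mk _ x : Theta F) ∣ m} =
      Nat.card F ^ (m : ℕ) - 1 := by
  have : NeZero (Monoid.exponent (extUnits F m) : ℂ) := by
    refine ⟨?_⟩
    have : Finite (extUnits F m) := by
      refine (Nat.card_pos_iff.1 ?_).2
      rw [card_extUnits]
      exact Nat.sub_pos_of_lt (one_lt_card_pow F m)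
    exact_mod_cast Monoid.exponent_ne_zero_of_finite
  have : Finite (extUnits F m) := by
    refine (Nat.card_pos_iff.1 ?_).2
    rw [card_extUnits]
    exact Nat.sub_pos_of_lt (one_lt_card_pow F m)
  rw [← card_extUnits F m, ← CommGroup.card_monoidHom_of_hasEnoughRootsOfUnity (extUnits F m) ℂ]
  refine Nat.card_congr ((Equiv.subtypeEquivRight fun x => ?_).trans
    (Equiv.ofInjective _ (CharUnion.mk_injective (F := F) m)).symm)
  rw [Theta.size_mk, ← Function.isPeriodicPt_iff_minimalPeriod_dvd]
  exact CharUnion.frobenius_iterate_eq_iff m x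

variable (F) in
/-- The index sets `Φ` and `Θ` have the same number of elements of every degree. -/
theorem exists_equiv_phi_theta : ∃ e : Phi F ≃ Theta F, ∀ f, (e f).size = f.degree :=
  exists_equiv_of_card_eq Phi.degree (phiOf F) Theta.size (Quot.mk _)
    (fun m => Nat.card F ^ m - 1)
    (fun m hm => Nat.sub_pos_of_lt (one_lt_card_pow F ⟨m, Nat.pos_of_ne_zero hm⟩))
    Phi.degree_pos card_phiOf_fiber
    (fun m hm => card_phiOf_degree_dvd ⟨m, Nat.pos_of_ne_zero hm⟩)
    Theta.size_pos (fun _ => rfl)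
    (fun m hm => card_theta_size_dvd ⟨m, Nat.pos_of_ne_zero hm⟩)

end Theta

/-! ### Counting pairs of tableaux -/

section Reindex

variable {S S' : Type*} {d : S → ℕ} {d' : S' → ℕ} {n : ℕ} {μ : Composition n}

lemma PairsOfWeight.exists_reindex (e : S ≃ S') (hd : ∀ s, d' (e s) = d s)
    (t : PairsOfWeight d μ) :
    ∃ t' : PairsOfWeight d' μ, ∀ s r c, (t'.2.1.1 s).1 r c = (t.2.1.1 (e.symm s)).1 r c ∧
      (t'.2.2.1 s).1 r c = (t.2.2.1 (e.symm s)).1 r c := by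
  have hd' : ∀ s, d' s = d (e.symm s) := fun s => by rw [← hd, e.apply_symm_apply]
  have hwt : ∀ (P : TableauxOfWeight d μ t.1) (k : ℕ),
      ∑ᶠ s, d' s * boxCount (fun r c => (P.1 (e.symm s)).1 r c) (k + 1) = μ.blocks.getD k 0 := by
    intro P k
    rw [← P.2 k, wt_eq_finsum, ← finsum_comp_equiv e.symm]
    exact finsum_congr fun s => by rw [hd']
  refine PairsOfWeight.exists_of_fillings (fun s => (t.2.1.1 (e.symm s)).isColumnStrict)
    (fun s => (t.2.2.1 (e.symm s)).isColumnStrict) (fun s r c => ?_) ?_ (hwt t.2.1) (hwt t.2.2)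
  · rw [ColumnStrictTableau.ne_zero_iff, ColumnStrictTableau.ne_zero_iff]
  · refine (t.1.finite_support.preimage e.symm.injective.injOn).subset fun s hs hbot => ?_
    obtain ⟨r, c, hrc⟩ := hs
    exact hrc ((part_eq_bot_iff t.2.1.1 _).1 hbot r c)

/-- Pairs of tableaux of the same shape depend on the index set only through the degrees of its
elements. -/
lemma PairsOfWeight.nonempty_equiv (e : S ≃ S') (hd : ∀ s, d' (e s) = d s) :
    Nonempty (PairsOfWeight d μ ≃ PairsOfWeight d' μ) := by
  choose f hf using PairsOfWeight.exists_reindex (μ := μ) e hd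
  choose g hg using PairsOfWeight.exists_reindex (μ := μ) e.symm
    (fun s => (by rw [← hd, e.apply_symm_apply] : d (e.symm s) = d' s))
  refine ⟨f, g, fun t => ?_, fun t => ?_⟩
  · refine PairsOfWeight.ext (fun s r c => ?_) fun s r c => ?_
    · rw [(hg _ s r c).1, (hf _ _ r c).1, Equiv.symm_symm, Equiv.symm_apply_apply]
    · rw [(hg _ s r c).2, (hf _ _ r c).2, Equiv.symm_symm, Equiv.symm_apply_apply]
  · refine PairsOfWeight.ext (fun s r c => ?_) fun s r c => ?_
    · rw [(hf _ s r c).1, (hg _ _ r c).1, Equiv.symm_symm, Equiv.apply_symm_apply]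
    · rw [(hf _ s r c).2, (hg _ _ r c).2, Equiv.symm_symm, Equiv.apply_symm_apply]

/-- Sorting pairs of tableaux by their shape. -/
lemma PairsOfWeight.card_eq_finsum [Finite (PairsOfWeight d μ)] :
    {lam : SPartition S | Nonempty (TableauxOfWeight d μ lam)}.Finite ∧
      (∀ lam, Finite (TableauxOfWeight d μ lam)) ∧
      Nat.card (PairsOfWeight d μ) =
        ∑ᶠ lam ∈ {lam : SPartition S | Nonempty (TableauxOfWeight d μ lam)},
          Nat.card (TableauxOfWeight d μ lam) ^ 2 := by
  have h1 : ∀ lam, Finite (TableauxOfWeight d μ lam) := fun lam =>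
    Finite.of_injective (fun P => (⟨lam, P, P⟩ : PairsOfWeight d μ)) fun P P' h => by
      simpa using h
  have h2 : {lam : SPartition S | Nonempty (TableauxOfWeight d μ lam)}.Finite :=
    (Set.finite_range (Sigma.fst : PairsOfWeight d μ → SPartition S)).subset
      fun lam ⟨P⟩ => ⟨⟨lam, P, P⟩, rfl⟩
  refine ⟨h2, h1, ?_⟩
  have := h2.fintype
  let e : PairsOfWeight d μ ≃
      Σ lam : {lam : SPartition S | Nonempty (TableauxOfWeight d μ lam)},
        TableauxOfWeight d μ lam.1 × TableauxOfWeight d μ lam.1 :=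
    { toFun := fun t => ⟨⟨t.1, ⟨t.2.1⟩⟩, t.2⟩
      invFun := fun t => ⟨t.1.1, t.2⟩
      left_inv := fun _ => rfl
      right_inv := fun _ => rfl }
  rw [Nat.card_congr e, Nat.card_sigma, ← finsum_set_coe_eq_finsum_mem, finsum_eq_sum_of_fintype]
  exact Finset.sum_congr rfl fun lam _ => by rw [Nat.card_prod, sq]

end Reindex

/-- The index set `Φ` may be replaced by `Θ` when the pairs of tableaux are counted. -/
lemma card_Nset_eq_finsum {F : Type u} [Field F] [Finite F] {ψ : AddChar F ℂ} (hψ : ψ ≠ 1)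
    {n : ℕ} (μ : Composition n) :
    (Hhat F μ).Finite ∧ (∀ lam : SPartition (Theta F), Finite (HhatTableaux μ lam)) ∧
      Nat.card (Nset ψ μ) = ∑ᶠ lam ∈ Hhat F μ, Nat.card (HhatTableaux μ lam) ^ 2 := by
  obtain ⟨A, -⟩ := exists_equiv_Mset hψ μ
  obtain ⟨C, -⟩ := exists_equiv_tableauPairs F μ
  obtain ⟨e, he⟩ := exists_equiv_phi_theta F
  obtain ⟨D⟩ := PairsOfWeight.nonempty_equiv (μ := μ) e he
  have : Finite (PairsOfWeight (Theta.size (F := F)) μ) :=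
    Finite.of_equiv _ (A.trans (C.trans D))
  obtain ⟨h1, h2, h3⟩ := PairsOfWeight.card_eq_finsum (d := Theta.size (F := F)) (μ := μ)
  exact ⟨h1, h2, (Nat.card_congr (A.trans (C.trans D))).trans h3⟩


end UnipotentHecke


theorem theorem4p2 {F : Type u} [Field F] [Finite F] (ψ : AddChar F ℂ) (hψ : ψ ≠ 1)
    {n : ℕ} (μ : Composition n) :
    (∃ (A : Nset ψ μ ≃ Mset F μ) (B : Nset ψ μ ≃ TableauPairs F μ),
      (∀ v : Nset ψ μ, vMatrix μ (A v).1 = (v.1 : Matrix (Fin n) (Fin n) F)) ∧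
      ∀ (v : Nset ψ μ) (f : Phi F) (r c : ℕ),
        ((B v).2.1.1 f).1 r c = rskP (exponentMatrix (A v).1 f) r c ∧
        ((B v).2.2.1 f).1 r c = rskQ (exponentMatrix (A v).1 f) r c) ∧
    (Finite (Nset ψ μ) ∧ (Hhat F μ).Finite ∧
      (∀ lam : SPartition (Theta F), Finite (HhatTableaux μ lam)) ∧
      FiniteDimensional ℂ (HeckeAlgebra ψ μ) ∧
      Module.finrank ℂ (HeckeAlgebra ψ μ) = Nat.card (Nset ψ μ) ∧
      Nat.card (Nset ψ μ) = ∑ᶠ lam ∈ Hhat F μ, Nat.card (HhatTableaux μ lam) ^ 2) ∧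
    ∃ (m : ℕ) (S : Fin m → Submodule (HeckeAlgebra ψ μ) (HeckeAlgebra ψ μ)),
      (∀ i, IsSimpleModule (HeckeAlgebra ψ μ) (S i)) ∧
      (∀ i j, Nonempty (S i ≃ₗ[HeckeAlgebra ψ μ] S j) → i = j) ∧
      (∀ (V : Type u) [AddCommGroup V] [Module (HeckeAlgebra ψ μ) V],
        IsSimpleModule (HeckeAlgebra ψ μ) V →
          ∃ i, Nonempty (V ≃ₗ[HeckeAlgebra ψ μ] S i)) ∧
      Module.finrank ℂ (HeckeAlgebra ψ μ) = ∑ i, Module.finrank ℂ (S i) ^ 2 := by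
  refine ⟨?_, ?_, ?_⟩
  · obtain ⟨A, hA⟩ := exists_equiv_Mset hψ μ
    obtain ⟨C, hC⟩ := exists_equiv_tableauPairs F μ
    exact ⟨A, A.trans C, hA, fun v => hC (A v)⟩
  · obtain ⟨hfd, hdim⟩ := finrank_heckeAlgebra ψ μ
    obtain ⟨h1, h2, h3⟩ := card_Nset_eq_finsum hψ μ
    exact ⟨inferInstance, h1, h2, hfd, hdim, h3⟩
  · have : IsSemisimpleRing (HeckeAlgebra ψ μ) :=
      have : FiniteDimensional ℂ
          (Representation.IndV (unipotentSubgroup F n).subtype (psiRep ψ μ)) :=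
        inferInstanceAs (FiniteDimensional ℂ (IndChar (psiMu ψ μ)))
      isSemisimpleRing_centralizer _
    have := (finrank_heckeAlgebra ψ μ).1
    exact exists_simple_modules
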